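/- Let $[n]=\{1,\dots,n\}$ and let $\binom{[n]}{k}$ be the set of all $k$-element subsets of $[n]$. Two families $\mathcal A,\mathcal B$ of subsets of $[n]$ are called cross $t$-intersecting if $|A\cap B|\ge t$ for all $A\in\mathcal A$ and $B\in\mathcal B$, and isomorphic, written $\mathcal A\cong\mathcal B$, if there is a permutation $f$ of $[n]$ with $\mathcal A=\{f(B):B\in\mathcal B\}$. Put $\mathcal F_0^t(n,k)=\{F\in\binom{[n]}{k}:|F\cap[t]|\ge t\}=\{F\in\binom{[n]}{k}:[t]\subseteq F\}$. Theorem. Let $k\ge t\ge 14$ and $n\ge (t+1)k$ be integers. If $\mathcal A,\mathcal B\subseteq\binom{[n]}{k}$ are cross $t$-intersecting, then $$|\mathcal A|\,|\mathcal B|\le\binom{n-t}{k-t}^2,$$ and equality holds if and only if $\mathcal A=\mathcal B\cong\mathcal F_0^t(n,k)$. -/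

import Mathlib

/-- Two families of subsets of an `n`-element set are cross `t`-intersecting if
every member of the first meets every member of the second in at least `t` points. -/
def CrossIntersecting {n : ℕ} (t : ℕ) (A B : Finset (Finset (Fin n))) : Prop :=
  ∀ S ∈ A, ∀ T ∈ B, t ≤ (S ∩ T).card

/-- The first `m` elements of the ground set; the element `j` of `{1, …, n}` is represented
by the element of `Fin n` with value `j - 1`. -/
def initialSegment (n m : ℕ) : Finset (Fin n) :=
  Finset.univ.filter (fun x => (x : ℕ) < m)

/-- The family of all `k`-subsets `F` of `[n]` with `|F ∩ [t + 2 i]| ≥ t + i`. -/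
def franklFamily (n k t i : ℕ) : Finset (Finset (Fin n)) :=
  (Finset.powersetCard k Finset.univ).filter
    (fun F => t + i ≤ (F ∩ initialSegment n (t + 2 * i)).card)

/-- Two families are isomorphic if a permutation of the ground set carries one to the other. -/
def FamilyIsomorphic {n : ℕ} (A B : Finset (Finset (Fin n))) : Prop :=
  ∃ f : Equiv.Perm (Fin n), A = B.image (fun S => S.image f)

/-!
The proof shifts the families and counts lattice walks.

Shifting preserves sizes and the cross `t`-intersecting property, and in shifted families Frankl's
prefix criterion (`CrossIntersecting.meets`) holds: for all members `S`, `T` there is an `m` such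
that `S` and `T` together have at least `m + t` elements among the first `m`. Reading a set as a
lattice walk (a step up for an element, a step to the right for a non-element), let `y = x + u`
and `y = x + v` be the highest lines met by all walks of `A` and of `B`. Two walks that do not
pass their lines satisfy the criterion only if `u + v ≥ 2 t`, and if `u + v = 2 t` then only if
they touch their lines at a common time. Since the reflection principle gives a bound for the
walks that pass a line that is smaller by a factor `t` than that for those that meet it, the count
depends on those that only touch it.

* If `u + v > 2 t`, the reflection bounds suffice (`choose_mul_choose_lt`).
* If `u + v = 2 t` and in one family all walks that do not pass the line touch it twice, the count of
  such walks suffices (`mul_lt_of_touchesTwice`). This is where `t ≥ 14` is needed.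
* Otherwise some walk of each family touches its line exactly once, so that all walks that do not
  pass their lines touch them at one and the same time. For most levels and times a ballot number
  bound (`touchBound`) suffices. There remain the time `t` or `t + 2` with `u = v = t`, and the time
  `t + 1` with levels `t - 1` and `t + 1`. Apart from walks that pass the line, the families are then
  contained in the star with centre `[t]`, in `{F : |F ∩ [t + 2]| ≥ t + 1}`, or in
  `{F : |F ∩ [t + 1]| ≥ t}` and `{F : [t + 1] ⊆ F}`, respectively, and the walks gained by leaving
  these families are outweighed by the walks lost in the other one (`subset_capped_or_gain_loss`).
  Only the star attains the bound.

Thus shifted families of maximal product are both the same star (`mul_card_lt_or_eq_star`), and this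
property is pulled back through each shift (`exists_star_of_compression`).
-/

/-! ### Counting lattice walks -/

/-- The words of length `n` over `{true, false}` with exactly `k` letters `true`. A word is read
as a lattice walk from the origin, `true` being a step up and `false` a step to the right. -/
def words : ℕ → ℕ → Finset (List Bool)
  | 0, 0 => {[]}
  | 0, _ + 1 => ∅
  | n + 1, 0 => (words n 0).image (List.cons false)
  | n + 1, k + 1 => (words n k).image (List.cons true) ∪ (words n (k + 1)).image (List.cons false)

/-- The number of steps up among the first `m` steps of `l`; past the end of the word it is
constant. -/
def ups (l : List Bool) (m : ℕ) : ℕ := (l.take m).count true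

/-- The walk `l` meets the line `y = x + u`. Since steps change `y - x` by one and the walk starts
at the origin, this is the same as reaching a point with `y - x ≥ u`. -/
def Reaches (u : ℕ) (l : List Bool) : Prop := ∃ m, m + u ≤ 2 * ups l m

noncomputable instance decidableReaches (u : ℕ) (l : List Bool) : Decidable (Reaches u l) :=
  Classical.propDecidable _

theorem mem_words {n k : ℕ} {l : List Bool} :
    l ∈ words n k ↔ l.length = n ∧ l.count true = k := by
  induction n generalizing k l with
  | zero =>
    cases k with
    | zero => cases l <;> simp [words]
    | succ k => cases l <;> simp [words]
  | succ n ih =>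
    cases k with
    | zero => cases l with
      | nil => simp [words]
      | cons b l => cases b <;> simp [words, ih]
    | succ k => cases l with
      | nil => simp [words]
      | cons b l => cases b <;> simp [words, ih]

theorem card_filter_words_succ_zero (n : ℕ) (P : List Bool → Prop) [DecidablePred P] :
    ((words (n + 1) 0).filter P).card = ((words n 0).filter fun l => P (false :: l)).card := by
  rw [words, Finset.filter_image, Finset.card_image_of_injective _ (List.cons_injective)]

theorem card_filter_words_succ_succ (n k : ℕ) (P : List Bool → Prop) [DecidablePred P] :
    ((words (n + 1) (k + 1)).filter P).card = ((words n k).filter fun l => P (true :: l)).card +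
      ((words n (k + 1)).filter fun l => P (false :: l)).card := by
  rw [words, Finset.filter_union, Finset.card_union_of_disjoint, Finset.filter_image,
    Finset.filter_image, Finset.card_image_of_injective _ (List.cons_injective),
    Finset.card_image_of_injective _ (List.cons_injective)]
  rw [Finset.disjoint_left]
  intro l hl hl'
  simp only [Finset.mem_filter, Finset.mem_image] at hl hl'
  obtain ⟨⟨a, _, rfl⟩, _⟩ := hl
  obtain ⟨⟨b, _, h⟩, _⟩ := hl'
  simp at h

theorem card_words (n k : ℕ) : (words n k).card = n.choose k := by
  induction n generalizing k with
  | zero => cases k <;> simp [words]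
  | succ n ih =>
    cases k with
    | zero =>
      have := card_filter_words_succ_zero n (fun _ => True)
      simpa [ih] using this
    | succ k =>
      have := card_filter_words_succ_succ n k (fun _ => True)
      simpa [ih, Nat.choose_succ_succ] using this

@[simp] theorem ups_zero (l : List Bool) : ups l 0 = 0 := by simp [ups]
@[simp] theorem ups_cons_true (l : List Bool) (m : ℕ) : ups (true :: l) (m + 1) = ups l m + 1 := by
  simp [ups]
@[simp] theorem ups_cons_false (l : List Bool) (m : ℕ) : ups (false :: l) (m + 1) = ups l m := by
  simp [ups]

theorem ups_le (l : List Bool) (m : ℕ) : ups l m ≤ m :=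
  (List.count_le_length).trans (by simp)

theorem ups_le_count (l : List Bool) (m : ℕ) : ups l m ≤ l.count true :=
  (List.take_sublist m l).count_le true

theorem ups_add (l : List Bool) (a b : ℕ) : ups l (a + b) = ups l a + ups (l.drop a) b := by
  simp [ups, List.take_add]

theorem ups_mono (l : List Bool) {a b : ℕ} (h : a ≤ b) : ups l a ≤ ups l b := by
  obtain ⟨c, rfl⟩ := Nat.exists_eq_add_of_le h
  rw [ups_add]; omega

theorem ups_le_add (l : List Bool) {a b : ℕ} (h : a ≤ b) : ups l b ≤ ups l a + (b - a) := by
  obtain ⟨c, rfl⟩ := Nat.exists_eq_add_of_le h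
  have := ups_le (l.drop a) c
  rw [ups_add]; omega

theorem ups_of_length_le {l : List Bool} {m : ℕ} (h : l.length ≤ m) : ups l m = l.count true := by
  simp [ups, List.take_of_length_le h]

theorem ups_append_of_le {l l' : List Bool} {m : ℕ} (h : m ≤ l.length) :
    ups (l ++ l') m = ups l m := by
  simp [ups, List.take_append_of_le_length h]

theorem ups_append_add (l l' : List Bool) (m : ℕ) :
    ups (l ++ l') (l.length + m) = l.count true + ups l' m := by
  rw [ups_add]
  simp [ups]

theorem ups_take {l : List Bool} {a m : ℕ} (h : m ≤ a) : ups (l.take a) m = ups l m := by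
  simp [ups, List.take_take, Nat.min_eq_left h]

theorem reaches_zero (l : List Bool) : Reaches 0 l := ⟨0, by simp⟩

theorem Reaches.mono {u u' : ℕ} {l : List Bool} (h : Reaches u l) (h' : u' ≤ u) : Reaches u' l := by
  obtain ⟨m, hm⟩ := h
  exact ⟨m, by omega⟩

theorem not_reaches_iff {u : ℕ} {l : List Bool} :
    ¬ Reaches (u + 1) l ↔ ∀ m, 2 * ups l m ≤ m + u := by
  simp only [Reaches, not_exists]
  exact forall_congr' fun m => by omega

theorem Reaches.le_count {u : ℕ} {l : List Bool} (h : Reaches u l) : u ≤ l.count true := by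
  obtain ⟨m, hm⟩ := h
  have := ups_le l m
  have := ups_le_count l m
  omega

theorem reaches_cons_true {u : ℕ} {l : List Bool} :
    Reaches (u + 1) (true :: l) ↔ Reaches u l := by
  constructor
  · rintro ⟨m, hm⟩
    cases m with
    | zero => simp at hm
    | succ m => exact ⟨m, by simp at hm; omega⟩
  · rintro ⟨m, hm⟩
    exact ⟨m + 1, by simp; omega⟩

theorem reaches_cons_false {u : ℕ} {l : List Bool} :
    Reaches (u + 1) (false :: l) ↔ Reaches (u + 2) l := by
  constructor
  · rintro ⟨m, hm⟩
    cases m with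
    | zero => simp at hm
    | succ m => exact ⟨m, by simp at hm; omega⟩
  · rintro ⟨m, hm⟩
    exact ⟨m + 1, by simp; omega⟩

theorem card_reaches_eq_zero {n k u : ℕ} (h : k < u) : ((words n k).filter (Reaches u)).card = 0 := by
  rw [Finset.card_eq_zero, Finset.filter_eq_empty_iff]
  intro l hl hu
  have := hu.le_count
  rw [mem_words] at hl
  omega

/-- The half of the reflection principle that needs no restriction on the end point. -/
theorem card_reaches_le {n k u : ℕ} (h : u ≤ k) :
    ((words n k).filter (Reaches u)).card ≤ n.choose (k - u) := by
  induction n generalizing k u with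
  | zero =>
    refine (Finset.card_filter_le _ _).trans ?_
    rw [card_words]
    cases k with
    | zero => simp
    | succ k => simp
  | succ n ih =>
    cases u with
    | zero => exact (Finset.card_filter_le _ _).trans (card_words _ _).le
    | succ u =>
      cases k with
      | zero => omega
      | succ k =>
        rw [card_filter_words_succ_succ]
        have g1 : ((words n k).filter fun l => Reaches (u + 1) (true :: l)).card =
            ((words n k).filter (Reaches u)).card := by
          congr 1; ext l; simp [reaches_cons_true]
        have g2 : ((words n (k + 1)).filter fun l => Reaches (u + 1) (false :: l)).card =
            ((words n (k + 1)).filter (Reaches (u + 2))).card := by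
          congr 1; ext l; simp [reaches_cons_false]
        rw [g1, g2]
        have h1 := ih (k := k) (u := u) (by omega)
        have e1 : k + 1 - (u + 1) = k - u := by omega
        rw [e1]
        rcases Nat.lt_or_ge (k + 1) (u + 2) with h2 | h2
        · have e : k - u = 0 := by omega
          rw [card_reaches_eq_zero h2]
          simpa [e] using h1
        · have h3 := ih (k := k + 1) (u := u + 2) h2
          have e2 : k - u = (k + 1 - (u + 2)) + 1 := by omega
          rw [e2, Nat.choose_succ_succ', ← e2]
          omega

/-- The other half of the reflection principle: an upper bound for the number of walks staying
below the line `y = x + u`, when the end point is not above it. -/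
theorem card_not_reaches_add_le {n k u : ℕ} (h : u ≤ k) (hk : 2 * k ≤ n + u) :
    ((words n k).filter fun l => ¬ Reaches u l).card + n.choose (k - u) ≤ n.choose k := by
  induction n generalizing k u with
  | zero =>
    obtain rfl : k = 0 := by omega
    obtain rfl : u = 0 := by omega
    simp [reaches_zero]
  | succ n ih =>
    cases u with
    | zero =>
      simp [reaches_zero]
    | succ u =>
      cases k with
      | zero => omega
      | succ k =>
        rw [card_filter_words_succ_succ]
        simp only [reaches_cons_true, reaches_cons_false]
        have h1 := ih (k := k) (u := u) (by omega) (by omega)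
        have e1 : k + 1 - (u + 1) = k - u := by omega
        rw [e1]
        rcases Nat.lt_or_ge (k + 1) (u + 2) with h2 | h2
        · have e : k - u = 0 := by omega
          have h3 : ((words n (k + 1)).filter fun l => ¬ Reaches (u + 2) l).card
              ≤ n.choose (k + 1) := (Finset.card_filter_le _ _).trans (card_words _ _).le
          rw [e] at h1 ⊢
          rw [Nat.choose_succ_succ']
          simp only [Nat.choose_zero_right] at h1 ⊢
          omega
        · have h3 := ih (k := k + 1) (u := u + 2) h2 (by omega)
          have e2 : k - u = (k + 1 - (u + 2)) + 1 := by omega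
          rw [e2, Nat.choose_succ_succ', ← e2, Nat.choose_succ_succ']
          omega

theorem card_reaches_add_card_not_reaches (n k u : ℕ) :
    ((words n k).filter (Reaches u)).card + ((words n k).filter fun l => ¬ Reaches u l).card
      = n.choose k := by
  rw [← card_words]
  exact Finset.card_filter_add_card_filter_not (Reaches u)

/-- The walk `l` does not pass the line `y = x + u`, and meets it at two different times. -/
def TouchesTwice (u : ℕ) (l : List Bool) : Prop :=
  ¬ Reaches (u + 1) l ∧ ∃ m m', m < m' ∧ m + u = 2 * ups l m ∧ m' + u = 2 * ups l m'

noncomputable instance decidableTouchesTwice (u : ℕ) (l : List Bool) :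
    Decidable (TouchesTwice u l) :=
  Classical.propDecidable _

theorem touchesTwice_cons_true {u : ℕ} {l : List Bool} :
    TouchesTwice (u + 1) (true :: l) → TouchesTwice u l := by
  rintro ⟨h, m, m', hm, h1, h2⟩
  refine ⟨fun h' => h (reaches_cons_true.2 h'), ?_⟩
  cases m with
  | zero => simp at h1
  | succ m =>
    obtain ⟨m', rfl⟩ : ∃ x, m' = x + 1 := ⟨m' - 1, by omega⟩
    simp at h1 h2
    exact ⟨m, m', by omega, by omega, by omega⟩

theorem touchesTwice_cons_false {u : ℕ} {l : List Bool} :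
    TouchesTwice (u + 1) (false :: l) → TouchesTwice (u + 2) l := by
  rintro ⟨h, m, m', hm, h1, h2⟩
  refine ⟨fun h' => h (reaches_cons_false.2 h'), ?_⟩
  cases m with
  | zero => simp at h1
  | succ m =>
    obtain ⟨m', rfl⟩ : ∃ x, m' = x + 1 := ⟨m' - 1, by omega⟩
    simp at h1 h2
    exact ⟨m, m', by omega, by omega, by omega⟩

theorem not_touchesTwice_zero_cons_true {l : List Bool} : ¬ TouchesTwice 0 (true :: l) := by
  rintro ⟨h, -⟩
  exact h ⟨1, by simp⟩

theorem TouchesTwice.reaches_of_cons_false {l : List Bool} (h : TouchesTwice 0 (false :: l)) :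
    Reaches 1 l := by
  obtain ⟨-, m, m', hm, h1, h2⟩ := h
  obtain ⟨m', rfl⟩ : ∃ x, m' = x + 1 := ⟨m' - 1, by omega⟩
  exact ⟨m', by simp at h2; omega⟩

theorem TouchesTwice.lt_count {u : ℕ} {l : List Bool} (h : TouchesTwice u l) :
    u < l.count true := by
  obtain ⟨-, m, m', hm, h1, h2⟩ := h
  have := ups_le l m
  have := ups_le_count l m'
  omega

theorem card_touchesTwice_eq_zero {n k u : ℕ} (h : k ≤ u) :
    ((words n k).filter (TouchesTwice u)).card = 0 := by
  rw [Finset.card_eq_zero, Finset.filter_eq_empty_iff]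
  intro l hl hu
  have := hu.lt_count
  rw [mem_words] at hl
  omega

/-- Deleting the step to the right that follows the first visit to the line turns a walk visiting
it twice into a walk, one step shorter, that passes it. -/
theorem card_touchesTwice_le {n k u : ℕ} (h : u + 1 ≤ k) :
    ((words n k).filter (TouchesTwice u)).card ≤ (n - 1).choose (k - u - 1) := by
  induction n generalizing k u with
  | zero =>
    obtain ⟨k, rfl⟩ : ∃ x, k = x + 1 := ⟨k - 1, by omega⟩
    simp [words]
  | succ n ih =>
    obtain ⟨k, rfl⟩ : ∃ x, k = x + 1 := ⟨k - 1, by omega⟩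
    rw [card_filter_words_succ_succ]
    cases u with
    | zero =>
      have h1 : ((words n k).filter fun l => TouchesTwice 0 (true :: l)).card = 0 := by
        simp [not_touchesTwice_zero_cons_true]
      have h2 : ((words n (k + 1)).filter fun l => TouchesTwice 0 (false :: l)).card
          ≤ ((words n (k + 1)).filter (Reaches 1)).card :=
        Finset.card_le_card (Finset.monotone_filter_right _
          fun l _ hl => hl.reaches_of_cons_false)
      have h3 := card_reaches_le (n := n) (k := k + 1) (u := 1) (by omega)
      simp only [Nat.add_sub_cancel, Nat.sub_zero] at h1 h2 h3 ⊢
      omega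
    | succ u =>
      have h1 : ((words n k).filter fun l => TouchesTwice (u + 1) (true :: l)).card
          ≤ ((words n k).filter (TouchesTwice u)).card :=
        Finset.card_le_card (Finset.monotone_filter_right _
          fun l _ hl => touchesTwice_cons_true hl)
      have h2 : ((words n (k + 1)).filter fun l => TouchesTwice (u + 1) (false :: l)).card
          ≤ ((words n (k + 1)).filter (TouchesTwice (u + 2))).card :=
        Finset.card_le_card (Finset.monotone_filter_right _
          fun l _ hl => touchesTwice_cons_false hl)
      have h3 := ih (k := k) (u := u) (by omega)
      have e1 : k + 1 - (u + 1) - 1 = k - u - 1 := by omega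
      rw [e1, Nat.add_sub_cancel]
      rcases Nat.lt_or_ge (k + 1) (u + 3) with h4 | h4
      · rw [card_touchesTwice_eq_zero (by omega : k + 1 ≤ u + 2)] at h2
        have h5 : (n - 1).choose (k - u - 1) ≤ n.choose (k - u - 1) :=
          Nat.choose_le_choose _ (by omega)
        omega
      · have h5 := ih (k := k + 1) (u := u + 2) (by omega)
        cases n with
        | zero =>
          have : ((words 0 (k + 1)).filter (TouchesTwice (u + 2))).card = 0 := by simp [words]
          have : ((words 0 k).filter (TouchesTwice u)).card = 0 := by
            obtain ⟨k, rfl⟩ : ∃ x, k = x + 1 := ⟨k - 1, by omega⟩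
            simp [words]
          omega
        | succ n =>
          have e2 : k - u - 1 = (k + 1 - (u + 2) - 1) + 1 := by omega
          rw [e2, Nat.choose_succ_succ', ← e2]
          simp only [Nat.add_sub_cancel] at h3 h5
          omega

/-- Cutting words at position `i`. -/
theorem card_filter_words_split {n k i a : ℕ} (hi : i ≤ n) (ha : a ≤ k)
    (P Q : List Bool → Prop) [DecidablePred P] [DecidablePred Q] :
    ((words n k).filter fun l => ups l i = a ∧ P (l.take i) ∧ Q (l.drop i)).card =
      ((words i a).filter P).card * ((words (n - i) (k - a)).filter Q).card := by
  rw [← Finset.card_product]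
  refine Finset.card_bij' (fun l _ => (l.take i, l.drop i)) (fun p _ => p.1 ++ p.2) ?_ ?_ ?_ ?_
  · intro l hl
    obtain ⟨hl, h1, h2, h3⟩ := Finset.mem_filter.1 hl
    obtain ⟨hl, hc⟩ := mem_words.1 hl
    have h4 := congrArg (List.count true) (List.take_append_drop i l)
    rw [List.count_append] at h4
    rw [ups] at h1
    simp only [Finset.mem_product, Finset.mem_filter, mem_words, List.length_take,
      List.length_drop]
    exact ⟨⟨⟨by omega, h1⟩, h2⟩, ⟨by omega, by omega⟩, h3⟩
  · rintro ⟨x, y⟩ hp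
    simp only [Finset.mem_filter, mem_words, Finset.mem_product] at hp
    obtain ⟨⟨⟨rfl, h2⟩, h3⟩, ⟨h4, h5⟩, h6⟩ := hp
    refine Finset.mem_filter.2 ⟨mem_words.2 ⟨by simp; omega, by simp; omega⟩, ?_, ?_, ?_⟩
    · rw [ups_append_of_le le_rfl, ups_of_length_le le_rfl, h2]
    · simpa using h3
    · simpa using h6
  · intro l hl
    simp
  · rintro ⟨x, y⟩ hp
    simp only [Finset.mem_filter, mem_words, Finset.mem_product] at hp
    obtain ⟨⟨⟨rfl, h2⟩, h3⟩, ⟨h4, h5⟩, h6⟩ := hp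
    simp

/-! ### Binomial estimates -/

theorem mul_choose_le_choose_succ {c n m : ℕ} (h : c * (m + 1) + m ≤ n) :
    c * n.choose m ≤ n.choose (m + 1) := by
  have h1 := Nat.choose_succ_right_eq n m
  refine Nat.le_of_mul_le_mul_right (c := m + 1) ?_ (by omega)
  rw [h1, mul_assoc, mul_comm c, mul_assoc, mul_comm (m + 1)]
  exact Nat.mul_le_mul_left _ (by omega)

theorem pow_mul_choose_sub_le {c n m h : ℕ} (hm : h ≤ m) (hn : c * m + m ≤ n) :
    c ^ h * n.choose (m - h) ≤ n.choose m := by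
  induction h with
  | zero => simp
  | succ h ih =>
    have h1 : c * n.choose (m - (h + 1)) ≤ n.choose (m - (h + 1) + 1) := by
      apply mul_choose_le_choose_succ
      have : c * (m - (h + 1) + 1) ≤ c * m := Nat.mul_le_mul_left _ (by omega)
      omega
    have e : m - (h + 1) + 1 = m - h := by omega
    rw [e] at h1
    calc c ^ (h + 1) * n.choose (m - (h + 1)) = c ^ h * (c * n.choose (m - (h + 1))) := by ring
      _ ≤ c ^ h * n.choose (m - h) := Nat.mul_le_mul_left _ h1
      _ ≤ _ := ih (by omega)

theorem choose_succ_mul_choose_le {n a b : ℕ} (h : b ≤ a) :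
    n.choose (a + 1) * n.choose b ≤ n.choose a * n.choose (b + 1) := by
  have h1 := Nat.choose_succ_right_eq n a
  have h2 := Nat.choose_succ_right_eq n b
  refine Nat.le_of_mul_le_mul_right (c := (a + 1) * (b + 1)) ?_ (by positivity)
  calc n.choose (a + 1) * n.choose b * ((a + 1) * (b + 1))
      = (n.choose (a + 1) * (a + 1)) * (n.choose b * (b + 1)) := by ring
    _ = (n.choose a * n.choose b) * ((n - a) * (b + 1)) := by rw [h1]; ring
    _ ≤ (n.choose a * n.choose b) * ((n - b) * (a + 1)) := by gcongr
    _ = (n.choose a * (a + 1)) * (n.choose (b + 1) * (b + 1)) := by rw [h2]; ring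
    _ = _ := by ring

/-- Log-concavity of a row of the Pascal triangle. -/
theorem choose_add_mul_choose_sub_le {n a b d : ℕ} (h : b ≤ a) (hd : d ≤ b) :
    n.choose (a + d) * n.choose (b - d) ≤ n.choose a * n.choose b := by
  induction d with
  | zero => simp
  | succ d ih =>
    have h1 := choose_succ_mul_choose_le (n := n) (a := a + d) (b := b - (d + 1)) (by omega)
    have e : b - (d + 1) + 1 = b - d := by omega
    rw [e] at h1
    exact h1.trans (ih (by omega))

/-- Removing `s` elements of the ground set costs a binomial coefficient at most a factor
`((c + 1) / c) ^ s`, as long as `m / n` is at most `1 / (c + 1)` throughout. -/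
theorem pow_mul_choose_le {c n m s : ℕ} (h : (c + 1) * m + s ≤ n + 1) :
    c ^ s * n.choose m ≤ (c + 1) ^ s * (n - s).choose m := by
  induction s with
  | zero => simp
  | succ s ih =>
    have ih := ih (by omega)
    obtain ⟨N, hN⟩ : ∃ N, n - s = N + 1 ∧ n - (s + 1) = N ∨ (n - s = 0 ∧ N = 0) := by
      rcases Nat.eq_zero_or_pos (n - s) with h0 | h0
      · exact ⟨0, Or.inr ⟨h0, rfl⟩⟩
      · exact ⟨n - s - 1, Or.inl ⟨by omega, by omega⟩⟩
    rcases hN with ⟨h1, h2⟩ | ⟨h1, -⟩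
    · rw [h1] at ih
      rw [h2]
      have h3 := Nat.choose_mul_succ_eq N m
      have h4 : (c + 1) * m ≤ N + 1 := by omega
      have h5 : c * (N + 1) ≤ (c + 1) * (N + 1 - m) := by
        rw [Nat.mul_sub]
        have : (c + 1) * (N + 1) = c * (N + 1) + (N + 1) := by ring
        omega
      have h6 : c * (N + 1).choose m ≤ (c + 1) * N.choose m := by
        refine Nat.le_of_mul_le_mul_right (c := N + 1) ?_ (by omega)
        calc c * (N + 1).choose m * (N + 1) = (N + 1).choose m * (c * (N + 1)) := by ring
          _ ≤ (N + 1).choose m * ((c + 1) * (N + 1 - m)) := by gcongr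
          _ = (c + 1) * ((N + 1).choose m * (N + 1 - m)) := by ring
          _ = _ := by rw [← h3]; ring
      calc c ^ (s + 1) * n.choose m = c * (c ^ s * n.choose m) := by ring
        _ ≤ c * ((c + 1) ^ s * (N + 1).choose m) := by gcongr
        _ = (c + 1) ^ s * (c * (N + 1).choose m) := by ring
        _ ≤ (c + 1) ^ s * ((c + 1) * N.choose m) := by gcongr
        _ = _ := by ring
    · have : n - (s + 1) = n - s := by omega
      rw [this]
      calc c ^ (s + 1) * n.choose m = c * (c ^ s * n.choose m) := by ring
        _ ≤ (c + 1) * ((c + 1) ^ s * (n - s).choose m) := by gcongr; omega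
        _ = _ := by ring

theorem choose_mul_eq_choose_add_two (N K : ℕ) :
    N.choose K * ((N + 2) * (N + 1)) = (N + 2).choose (K + 1) * ((K + 1) * (N + 1 - K)) := by
  have h1 := Nat.choose_mul_succ_eq N K
  have h2 := Nat.add_one_mul_choose_eq (N + 1) K
  calc N.choose K * ((N + 2) * (N + 1)) = (N + 2) * (N.choose K * (N + 1)) := by ring
    _ = (N + 1 + 1) * (N + 1).choose K * (N + 1 - K) := by rw [h1]; ring
    _ = _ := by rw [h2]; ring

theorem mul_choose_le_choose_add_two {c N K : ℕ} (hK : K ≤ N)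
    (h : c * ((K + 1) * (N + 1 - K)) ≤ (N + 2) * (N + 1)) :
    c * N.choose K ≤ (N + 2).choose (K + 1) := by
  have h1 := choose_mul_eq_choose_add_two N K
  have h2 : 0 < (K + 1) * (N + 1 - K) := Nat.mul_pos (by omega) (by omega)
  refine Nat.le_of_mul_le_mul_right ?_ h2
  calc c * N.choose K * ((K + 1) * (N + 1 - K)) = N.choose K * (c * ((K + 1) * (N + 1 - K))) := by
        ring
    _ ≤ N.choose K * ((N + 2) * (N + 1)) := by gcongr
    _ = _ := h1

/-- Vandermonde's identity, truncated. -/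
theorem sum_choose_mul_choose_le (i N K j : ℕ) :
    ∑ r ∈ Finset.range (j + 1), i.choose r * N.choose (K + j - r) ≤ (i + N).choose (K + j) := by
  rw [Nat.add_choose_eq, Finset.Nat.sum_antidiagonal_eq_sum_range_succ
    (fun a b => i.choose a * N.choose b)]
  exact Finset.sum_le_sum_of_subset (Finset.range_subset_range.2 (by omega))

/-- `(t + 2) K (N - K) ≤ N (N - 1)` as soon as `N ≥ (t + 1) K + 2`. -/
theorem add_two_mul_mul_le {t K N : ℕ} (h : (t + 1) * K + 2 ≤ N) :
    (t + 2) * (K * (N - K)) ≤ N * (N - 1) := by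
  obtain ⟨s, rfl⟩ := Nat.exists_eq_add_of_le h
  have e1 : (t + 1) * K + 2 + s - K = t * K + 2 + s := by
    have : (t + 1) * K = t * K + K := by ring
    omega
  have e2 : (t + 1) * K + 2 + s - 1 = (t + 1) * K + 1 + s := by omega
  rw [e1, e2]
  rcases Nat.eq_zero_or_pos K with rfl | hK
  · simp
  · rcases Nat.eq_zero_or_pos t with rfl | ht
    · nlinarith
    · nlinarith [mul_pos hK ht, Nat.zero_le (t * K * s), Nat.zero_le (K * s)]

/-! ### Powers of `1 + 1 / t` -/

theorem one_add_inv_pow_lt (t : ℕ) (ht : 0 < t) : (1 + 1 / (t : ℝ)) ^ t < 2.7183 := by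
  have h0 : (0 : ℝ) < t := by exact_mod_cast ht
  calc (1 + 1 / (t : ℝ)) ^ t ≤ (Real.exp (1 / t)) ^ t := by
        gcongr
        rw [add_comm]
        exact Real.add_one_le_exp _
    _ = Real.exp 1 := by rw [← Real.exp_nat_mul]; congr 1; field_simp
    _ < 2.7183 := lt_trans Real.exp_one_lt_d9 (by norm_num)

theorem one_add_inv_pow_pos (t : ℕ) : 0 < (1 + 1 / (t : ℝ)) ^ t := by positivity

/-- The constant `0.0725` is chosen just small enough for `t = 14`, where the left-hand side is
about `0.993`. -/
theorem one_add_inv_pow_sq_mul_lt {t : ℕ} (ht : 14 ≤ t) :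
    ((1 + 1 / (t : ℝ)) ^ t) ^ 2 * (0.0725 + 1 / t) < 1 := by
  rcases Nat.lt_or_ge t 16 with h | h
  · interval_cases t <;> norm_num
  · have h1 := one_add_inv_pow_lt t (by omega)
    have h2 := one_add_inv_pow_pos t
    have h3 : (1 : ℝ) / t ≤ 1 / 16 := by
      gcongr; exact_mod_cast h
    calc ((1 + 1 / (t : ℝ)) ^ t) ^ 2 * (0.0725 + 1 / t) ≤ 2.7183 ^ 2 * (0.0725 + 1 / 16) := by
          gcongr
      _ < 1 := by norm_num

/-- Here `14 ≤ t` is needed: for `t = 13` the left-hand side is about `1.02`. -/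
theorem one_add_inv_pow_sq_mul_lt' {t : ℕ} (ht : 14 ≤ t) :
    ((1 + 1 / (t : ℝ)) ^ t) ^ 2 * (1 / (t + 1) + 1 / t) < 1 := by
  refine lt_of_le_of_lt ?_ (one_add_inv_pow_sq_mul_lt ht)
  have : (1 : ℝ) / (t + 1) ≤ 0.0725 := by
    have : (14 : ℝ) ≤ t := by exact_mod_cast ht
    rw [div_le_iff₀ (by positivity)]
    linarith
  gcongr

/-- In the form `2 (t + 2) (t / (t - 1)) ^ (t + h + 3) < t ^ (h + 1)`, this is the numerical fact
that makes the loss outweigh the gain: the gain decreases by a factor `t` with each line, whereas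
the loss decreases by a factor close to `1`. -/
theorem two_mul_pow_lt {t h : ℕ} (ht : 14 ≤ t) (hh : 1 ≤ h) :
    2 * (t + 2) * t ^ (t + h + 3) < t ^ (h + 1) * (t - 1) ^ (t + h + 3) := by
  obtain ⟨c, rfl⟩ : ∃ c, t = c + 1 := ⟨t - 1, by omega⟩
  obtain ⟨h, rfl⟩ : ∃ x, h = x + 1 := ⟨h - 1, by omega⟩
  rw [Nat.add_sub_cancel]
  have hc : (13 : ℝ) ≤ c := by exact_mod_cast (by omega : 13 ≤ c)
  have h0 : (0 : ℝ) < c := by linarith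
  have h1 := one_add_inv_pow_lt c (by omega)
  have e : (1 + 1 / (c : ℝ)) = (c + 1) / c := by field_simp
  have h2 : ((c : ℝ) + 1) ^ c < 2.7183 * c ^ c := by
    rw [e, div_pow, div_lt_iff₀ (by positivity)] at h1
    exact h1
  have h3 : ((c : ℝ) + 1) ^ 5 * 2.7183 * (2 * (c + 3)) ≤ (c + 1) * c ^ 6 := by
    have h31 : ((c : ℝ) + 1) ≤ 14 / 13 * (c : ℝ) := by linarith
    have h32 : ((c : ℝ) + 1) ^ 4 ≤ (14 / 13 * c) ^ 4 := by gcongr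
    have h33 : 2 * ((c : ℝ) + 3) ≤ 32 / 13 * c := by linarith
    calc ((c : ℝ) + 1) ^ 5 * 2.7183 * (2 * (c + 3))
        = ((c : ℝ) + 1) * ((c + 1) ^ 4 * (2.7183 * (2 * (c + 3)))) := by ring
      _ ≤ ((c : ℝ) + 1) * ((14 / 13 * c) ^ 4 * (2.7183 * (32 / 13 * c))) := by gcongr
      _ = ((c : ℝ) + 1) * c ^ 5 * ((14 / 13) ^ 4 * (2.7183 * (32 / 13))) := by ring
      _ ≤ ((c : ℝ) + 1) * c ^ 5 * 13 := by gcongr; norm_num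
      _ ≤ ((c : ℝ) + 1) * c ^ 5 * c := by gcongr
      _ = _ := by ring
  have h4 : (c + 1 : ℝ) ^ h ≤ ((c + 1) * c) ^ h := by
    gcongr; nlinarith
  have key : (2 * ((c : ℝ) + 1 + 2)) * (c + 1) ^ (c + 1 + (h + 1) + 3) <
      (c + 1) ^ (h + 1 + 1) * c ^ (c + 1 + (h + 1) + 3) := by
    calc (2 * ((c : ℝ) + 1 + 2)) * (c + 1) ^ (c + 1 + (h + 1) + 3)
        = ((c + 1) ^ c) * ((c + 1) ^ 5 * (2 * (c + 3)) * (c + 1) ^ h) := by ring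
      _ < (2.7183 * c ^ c) * ((c + 1) ^ 5 * (2 * (c + 3)) * (c + 1) ^ h) := by gcongr
      _ = c ^ c * ((c + 1) ^ 5 * 2.7183 * (2 * (c + 3)) * (c + 1) ^ h) := by ring
      _ ≤ c ^ c * (((c + 1) * c ^ 6) * ((c + 1) * c) ^ h) := by gcongr
      _ ≤ c ^ c * (((c + 1) * c ^ 5 * (c + 1)) * ((c + 1) * c) ^ h) := by
          refine mul_le_mul_of_nonneg_left (mul_le_mul_of_nonneg_right ?_ (by positivity))
            (by positivity)
          nlinarith [pow_pos h0 5, pow_pos h0 6]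
      _ = _ := by rw [mul_pow]; ring
  exact_mod_cast key

/-! ### Walks touching a line at a given time -/

/-- An upper bound for the number of walks of length `n` with `k` steps up that touch the line
`y = x + u` after `u + 2 j` steps, at the point `(j, u + j)`, and do not pass the line before: a
ballot number times the number of ways to continue. -/
noncomputable def touchBound (n k u j : ℕ) : ℝ :=
  ((u : ℝ) + 1) / (u + j + 1) * (u + 2 * j).choose j * (n - u - 2 * j).choose (k - u - j)

theorem touchBound_nonneg (n k u j : ℕ) : 0 ≤ touchBound n k u j := by
  unfold touchBound; positivity

/-- From one possible touching time to the next the ballot number grows by at most the factor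
`t + 1`, and the number of continuations decreases by at least that factor. -/
theorem touchBound_succ_le {n k t u j : ℕ} (ht : 14 ≤ t) (hn : (t + 1) * k ≤ n) (hj : 1 ≤ j)
    (hu : u ≤ t + 2) (hk : u + j + 1 ≤ k) :
    touchBound n k u (j + 1) ≤ touchBound n k u j := by
  have hkn : 15 * k ≤ n := le_trans (Nat.mul_le_mul_right _ (by omega)) hn
  obtain ⟨N, hN⟩ : ∃ N, n - u - 2 * j = N + 2 := ⟨n - u - 2 * j - 2, by omega⟩
  obtain ⟨K, hK⟩ : ∃ K, k - u - j = K + 1 := ⟨k - u - j - 1, by omega⟩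
  have e1 : n - u - 2 * (j + 1) = N := by omega
  have e2 : k - u - (j + 1) = K := by omega
  have hZ : (t + 1) * N.choose K ≤ (N + 2).choose (K + 1) := by
    apply mul_choose_le_choose_add_two (by omega)
    have h1 : (t + 1) * (K + 1) ≤ N + 2 := by
      have : (t + 1) * (K + 1) + (t + 1) * (u + j) ≤ n := by
        rw [← mul_add]; exact le_trans (Nat.mul_le_mul_left _ (by omega)) hn
      have : 15 * (u + j) ≤ (t + 1) * (u + j) := Nat.mul_le_mul_right _ (by omega)
      omega
    calc (t + 1) * ((K + 1) * (N + 1 - K)) = ((t + 1) * (K + 1)) * (N + 1 - K) := by ring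
      _ ≤ (N + 2) * (N + 1) := Nat.mul_le_mul h1 (by omega)
  have hc := choose_mul_eq_choose_add_two (u + 2 * j) j
  have e3 : u + 2 * j + 1 - j = u + j + 1 := by omega
  rw [e3] at hc
  have hpoly : (u + 2 * j + 2) * (u + 2 * j + 1) ≤ (t + 1) * ((j + 1) * (u + j + 2)) := by
    rcases Nat.lt_or_ge j 2 with h | h
    · obtain rfl : j = 1 := by omega
      nlinarith
    · calc (u + 2 * j + 2) * (u + 2 * j + 1) ≤ (2 * (u + j + 2)) * (u + 2 * j + 1) := by
            exact Nat.mul_le_mul_right _ (by omega)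
        _ = (2 * (u + 2 * j + 1)) * (u + j + 2) := by ring
        _ ≤ ((t + 1) * (j + 1)) * (u + j + 2) := Nat.mul_le_mul_right _ (by nlinarith)
        _ = _ := by ring
  unfold touchBound
  rw [e1, e2, hN, hK]
  have e4 : u + 2 * (j + 1) = u + 2 * j + 2 := by ring
  rw [e4]
  generalize (N + 2).choose (K + 1) = Z at *
  generalize N.choose K = Z' at *
  generalize (u + 2 * j + 2).choose (j + 1) = c' at *
  generalize (u + 2 * j).choose j = c at *
  have hZ' : ((t : ℝ) + 1) * Z' ≤ Z := by exact_mod_cast hZ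
  have hc' : (c : ℝ) * ((u + 2 * j + 2) * (u + 2 * j + 1)) = c' * ((j + 1) * (u + j + 1)) := by
    exact_mod_cast hc
  have hpoly' : ((u : ℝ) + 2 * j + 2) * (u + 2 * j + 1) ≤ (t + 1) * ((j + 1) * (u + j + 2)) := by
    exact_mod_cast hpoly
  have hc'' : (c' : ℝ) = c * ((u + 2 * j + 2) * (u + 2 * j + 1)) / ((j + 1) * (u + j + 1)) := by
    rw [eq_div_iff (by positivity), hc']
  rw [hc'']
  push_cast
  have h1 : ((u : ℝ) + 2 * j + 2) * (u + 2 * j + 1) * Z' ≤ (j + 1) * (u + j + 2) * Z := by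
    calc ((u : ℝ) + 2 * j + 2) * (u + 2 * j + 1) * Z' ≤ (t + 1) * ((j + 1) * (u + j + 2)) * Z' := by
          gcongr
      _ = (j + 1) * (u + j + 2) * ((t + 1) * Z') := by ring
      _ ≤ _ := by gcongr
  have e5 : ((u : ℝ) + 1) / (u + (j + 1) + 1) *
      (c * ((u + 2 * j + 2) * (u + 2 * j + 1)) / ((j + 1) * (u + j + 1))) * Z' =
      (((u : ℝ) + 1) * c / ((u + j + 1) * ((j + 1) * (u + j + 2)))) *
        ((u + 2 * j + 2) * (u + 2 * j + 1) * Z') := by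
    field_simp
    ring
  have e6 : ((u : ℝ) + 1) / (u + j + 1) * c * Z =
      (((u : ℝ) + 1) * c / ((u + j + 1) * ((j + 1) * (u + j + 2)))) *
        ((j + 1) * (u + j + 2) * Z) := by
    field_simp
  rw [e5, e6]
  gcongr

theorem touchBound_le_of_le {n k t u j j₀ : ℕ} (ht : 14 ≤ t) (hn : (t + 1) * k ≤ n) (hj : 1 ≤ j₀)
    (hjj : j₀ ≤ j) (hu : u ≤ t + 2) (hk : u + j ≤ k) :
    touchBound n k u j ≤ touchBound n k u j₀ := by
  induction j, hjj using Nat.le_induction with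
  | base => exact le_rfl
  | succ j hjj ih =>
    exact (touchBound_succ_le ht hn (hj.trans hjj) hu (by omega)).trans (ih (by omega))

theorem touchBound_one (n k u : ℕ) :
    touchBound n k u 1 = (u + 1) * (n - u - 2).choose (k - u - 1) := by
  unfold touchBound
  rw [Nat.choose_one_right]
  push_cast
  have : (u : ℝ) + 1 + 1 ≠ 0 := by positivity
  have e : (u : ℝ) + 2 = u + 1 + 1 := by ring
  rw [e]
  field_simp

theorem touchBound_two (n k u : ℕ) :
    touchBound n k u 2 = (u + 1) * (u + 4) / 2 * (n - u - 4).choose (k - u - 2) := by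
  unfold touchBound
  rw [Nat.cast_choose_two]
  push_cast
  have : (u : ℝ) + 3 ≠ 0 := by positivity
  have e : (u : ℝ) + 2 + 1 = u + 3 := by ring
  have e' : (u : ℝ) + 4 - 1 = u + 3 := by ring
  rw [e, e']
  field_simp

theorem cast_add_six_choose_three (u : ℕ) :
    (((u + 6).choose 3 : ℕ) : ℝ) = (u + 6) * (u + 5) * (u + 4) / 6 := by
  have h1 := Nat.choose_succ_right_eq (u + 6) 2
  have e : u + 6 - 2 = u + 4 := by omega
  rw [e] at h1
  have h2 : (((u + 6).choose 3 : ℕ) : ℝ) * 3 = ((u + 6).choose 2 : ℕ) * (u + 4) := by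
    exact_mod_cast h1
  rw [Nat.cast_choose_two] at h2
  push_cast at h2
  linarith

theorem touchBound_three (n k u : ℕ) :
    touchBound n k u 3 = (u + 1) * (u + 5) * (u + 6) / 6 * (n - u - 6).choose (k - u - 3) := by
  unfold touchBound
  have h : (((u + 2 * 3).choose 3 : ℕ) : ℝ) = (u + 6) * (u + 5) * (u + 4) / 6 :=
    cast_add_six_choose_three u
  rw [h]
  have : (u : ℝ) + 4 ≠ 0 := by positivity
  have e : (u : ℝ) + (3 : ℕ) + 1 = u + 4 := by push_cast; ring
  rw [e]
  field_simp

/-- Consecutive binomial coefficients that occur below grow at least by the factor `t`. -/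
theorem mul_choose_le_choose_succ_of_le {n k t a m : ℕ} (hn : (t + 1) * k ≤ n)
    (h : t * (m + 1) + m + a ≤ (t + 1) * k) :
    t * (n - a).choose m ≤ (n - a).choose (m + 1) :=
  mul_choose_le_choose_succ (by omega)

/-- In the truncated Vandermonde sum, each coefficient `(n - u - 2).choose _` is at least `t` times
the preceding one, so that the whole sum is a multiple of the smallest. The two lemmas that follow
do the same with three and with four terms. -/
theorem mul_choose_le_choose_one {n k t u : ℕ} (ht : 14 ≤ t) (hn : (t + 1) * k ≤ n)
    (hu : u + 1 ≤ k) (hu1 : 1 ≤ u) :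
    (u + 2 + t) * (n - u - 2).choose (k - u - 1) ≤ n.choose (k - u) := by
  obtain ⟨K, rfl⟩ : ∃ K, k = K + u + 1 := ⟨k - u - 1, by omega⟩
  have hkn : 15 * (K + u + 1) ≤ n := le_trans (Nat.mul_le_mul_right _ (by omega)) hn
  have h1 := sum_choose_mul_choose_le (u + 2) (n - u - 2) K 1
  have h2 := mul_choose_le_choose_succ_of_le (a := u + 2) (m := K) hn (by nlinarith)
  rw [← Nat.sub_sub] at h2
  have e1 : u + 2 + (n - u - 2) = n := by omega
  have e2 : K + u + 1 - u - 1 = K := by omega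
  have e3 : K + u + 1 - u = K + 1 := by omega
  rw [e2, e3]
  simp [Finset.sum_range_succ, e1] at h1
  nlinarith

theorem mul_choose_le_choose_two {n k t u : ℕ} (ht : 14 ≤ t) (hn : (t + 1) * k ≤ n)
    (hu : u + 2 ≤ k) (hu1 : 1 ≤ u) :
    ((u + 4) * (u + 3) / 2 + (u + 4) * t + t ^ 2 : ℝ) * (n - u - 4).choose (k - u - 2)
      ≤ n.choose (k - u) := by
  obtain ⟨K, rfl⟩ : ∃ K, k = K + u + 2 := ⟨k - u - 2, by omega⟩
  have hkn : 15 * (K + u + 2) ≤ n := le_trans (Nat.mul_le_mul_right _ (by omega)) hn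
  have h1 := sum_choose_mul_choose_le (u + 4) (n - u - 4) K 2
  have h2 := mul_choose_le_choose_succ_of_le (a := u + 4) (m := K) hn (by nlinarith)
  have h3 := mul_choose_le_choose_succ_of_le (a := u + 4) (m := K + 1) hn (by nlinarith)
  rw [← Nat.sub_sub] at h2 h3
  have e1 : u + 4 + (n - u - 4) = n := by omega
  have e2 : K + u + 2 - u - 2 = K := by omega
  have e3 : K + u + 2 - u = K + 2 := by omega
  rw [e2, e3]
  simp [Finset.sum_range_succ, e1] at h1
  have h1' : (((n - u - 4).choose (K + 2) : ℕ) : ℝ) + (u + 4) * (n - u - 4).choose (K + 1) +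
      ((u + 4).choose 2 : ℕ) * (n - u - 4).choose K ≤ n.choose (K + 2) := by exact_mod_cast h1
  have h2' : (t : ℝ) * (n - u - 4).choose K ≤ (n - u - 4).choose (K + 1) := by exact_mod_cast h2
  have h3' : (t : ℝ) * (n - u - 4).choose (K + 1) ≤ (n - u - 4).choose (K + 2) := by
    exact_mod_cast h3
  rw [Nat.cast_choose_two] at h1'
  push_cast at h1'
  have h4 : (t : ℝ) * (t * (n - u - 4).choose K) ≤ t * (n - u - 4).choose (K + 1) := by gcongr
  have h5 : ((u : ℝ) + 4) * (t * (n - u - 4).choose K) ≤ (u + 4) * (n - u - 4).choose (K + 1) := by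
    gcongr
  nlinarith

theorem mul_choose_le_choose_three {n k t u : ℕ} (ht : 14 ≤ t) (hn : (t + 1) * k ≤ n)
    (hu : u + 3 ≤ k) (hu1 : 1 ≤ u) :
    ((u + 6) * (u + 5) * (u + 4) / 6 + (u + 6) * (u + 5) / 2 * t + (u + 6) * t ^ 2 + t ^ 3 : ℝ) *
      (n - u - 6).choose (k - u - 3) ≤ n.choose (k - u) := by
  obtain ⟨K, rfl⟩ : ∃ K, k = K + u + 3 := ⟨k - u - 3, by omega⟩
  have hkn : 15 * (K + u + 3) ≤ n := le_trans (Nat.mul_le_mul_right _ (by omega)) hn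
  have h1 := sum_choose_mul_choose_le (u + 6) (n - u - 6) K 3
  have h2 := mul_choose_le_choose_succ_of_le (a := u + 6) (m := K) hn (by nlinarith)
  have h3 := mul_choose_le_choose_succ_of_le (a := u + 6) (m := K + 1) hn (by nlinarith)
  have h4 := mul_choose_le_choose_succ_of_le (a := u + 6) (m := K + 2) hn (by nlinarith)
  rw [← Nat.sub_sub] at h2 h3 h4
  have e1 : u + 6 + (n - u - 6) = n := by omega
  have e2 : K + u + 3 - u - 3 = K := by omega
  have e3 : K + u + 3 - u = K + 3 := by omega
  rw [e2, e3]
  simp [Finset.sum_range_succ, e1] at h1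
  have h1' : (((n - u - 6).choose (K + 3) : ℕ) : ℝ) + (u + 6) * (n - u - 6).choose (K + 2) +
      ((u + 6).choose 2 : ℕ) * (n - u - 6).choose (K + 1) +
      ((u + 6).choose 3 : ℕ) * (n - u - 6).choose K ≤ n.choose (K + 3) := by exact_mod_cast h1
  have h2' : (t : ℝ) * (n - u - 6).choose K ≤ (n - u - 6).choose (K + 1) := by exact_mod_cast h2
  have h3' : (t : ℝ) * (n - u - 6).choose (K + 1) ≤ (n - u - 6).choose (K + 2) := by
    exact_mod_cast h3
  have h4' : (t : ℝ) * (n - u - 6).choose (K + 2) ≤ (n - u - 6).choose (K + 3) := by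
    exact_mod_cast h4
  rw [Nat.cast_choose_two, cast_add_six_choose_three] at h1'
  push_cast at h1'
  generalize (((n - u - 6).choose K : ℕ) : ℝ) = z at *
  generalize (((n - u - 6).choose (K + 1) : ℕ) : ℝ) = z1 at *
  generalize (((n - u - 6).choose (K + 2) : ℕ) : ℝ) = z2 at *
  generalize (((n - u - 6).choose (K + 3) : ℕ) : ℝ) = z3 at *
  have ht0 : (0 : ℝ) ≤ t := by positivity
  have h5 : (t : ℝ) ^ 2 * z ≤ z2 := by nlinarith
  have h6 : (t : ℝ) ^ 3 * z ≤ z3 := by nlinarith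
  have h7 : ((u : ℝ) + 6) * (t ^ 2 * z) ≤ (u + 6) * z2 := by gcongr
  have h8 : ((u : ℝ) + 6) * (u + 5) / 2 * (t * z) ≤ (u + 6) * (u + 5) / 2 * z1 := by gcongr
  nlinarith

/-! ### Comparison of the reflection bounds with a star -/

theorem choose_le_one_add_inv_pow_mul {n k t : ℕ} (ht : 14 ≤ t) (htk : t ≤ k)
    (hn : (t + 1) * k ≤ n) :
    (n.choose (k - t) : ℝ) ≤ (1 + 1 / (t : ℝ)) ^ t * (n - t).choose (k - t) := by
  have h1 : (t + 1) * (k - t) + t ≤ n + 1 := by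
    obtain ⟨K, rfl⟩ := Nat.exists_eq_add_of_le htk
    rw [Nat.add_sub_cancel_left]
    nlinarith
  have h2 := pow_mul_choose_le (c := t) (n := n) (m := k - t) (s := t) h1
  have h3 : (t : ℝ) ^ t * n.choose (k - t) ≤ (t + 1) ^ t * (n - t).choose (k - t) := by
    exact_mod_cast h2
  have h0 : (0 : ℝ) < t := by exact_mod_cast (by omega : 0 < t)
  have e : (1 + 1 / (t : ℝ)) = (t + 1) / t := by field_simp
  rw [e, div_pow, div_mul_eq_mul_div, le_div_iff₀ (by positivity)]
  linarith

theorem choose_sub_pos {n k t : ℕ} (htk : t ≤ k) (hn : (t + 1) * k ≤ n) :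
    (0 : ℝ) < (n - t).choose (k - t) := by
  have : k ≤ n := le_trans (Nat.le_mul_of_pos_left _ (by omega)) hn
  exact_mod_cast Nat.choose_pos (by omega)

/-- By log-concavity the product of the reflection bounds for levels `u` and `v` is largest at
`u = v = t`, where it exceeds the bound sought by a factor less than `e ^ 2`. -/
theorem choose_mul_choose_le {n k t u v : ℕ} (ht : 14 ≤ t) (htk : t ≤ k) (hn : (t + 1) * k ≤ n)
    (huv : u + v = 2 * t) (hu : u ≤ k) (hv : v ≤ k) :
    (n.choose (k - u) : ℝ) * n.choose (k - v) ≤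
      ((1 + 1 / (t : ℝ)) ^ t) ^ 2 * ((n - t).choose (k - t) : ℝ) ^ 2 := by
  have key : n.choose (k - u) * n.choose (k - v) ≤ n.choose (k - t) * n.choose (k - t) := by
    rcases le_total u v with h | h
    · have := choose_add_mul_choose_sub_le (n := n) (a := k - t) (b := k - t) (d := t - u) le_rfl
        (by omega)
      rwa [show k - t + (t - u) = k - u by omega, show k - t - (t - u) = k - v by omega] at this
    · have := choose_add_mul_choose_sub_le (n := n) (a := k - t) (b := k - t) (d := t - v) le_rfl
        (by omega)
      rw [show k - t + (t - v) = k - v by omega, show k - t - (t - v) = k - u by omega] at this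
      linarith
  have h2 := choose_le_one_add_inv_pow_mul ht htk hn
  calc (n.choose (k - u) : ℝ) * n.choose (k - v) ≤ n.choose (k - t) * n.choose (k - t) := by
        exact_mod_cast key
    _ ≤ ((1 + 1 / (t : ℝ)) ^ t * (n - t).choose (k - t)) *
        ((1 + 1 / (t : ℝ)) ^ t * (n - t).choose (k - t)) := by gcongr
    _ = _ := by ring

theorem mul_choose_sub_le {n k t u : ℕ} (hn : (t + 1) * k ≤ n) (hu : u + 1 ≤ k) :
    t * n.choose (k - u - 1) ≤ n.choose (k - u) := by
  have h := mul_choose_le_choose_succ (c := t) (n := n) (m := k - u - 1) (by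
    obtain ⟨K, rfl⟩ := Nat.exists_eq_add_of_le hu
    rw [show u + 1 + K - u - 1 = K by omega]
    nlinarith [Nat.zero_le (t * u)])
  rwa [show k - u - 1 + 1 = k - u by omega] at h

/-- The case of levels with sum greater than `2 t`: the reflection bounds suffice, since one more
level gains a factor `t > e ^ 2`. -/
theorem choose_mul_choose_lt {n k t u v : ℕ} (ht : 14 ≤ t) (htk : t ≤ k) (hn : (t + 1) * k ≤ n)
    (huv : u + v = 2 * t + 1) (hle : u ≤ v) (hv : v ≤ k) :
    (n.choose (k - u) : ℝ) * n.choose (k - v) < ((n - t).choose (k - t) : ℝ) ^ 2 := by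
  have key := choose_add_mul_choose_sub_le (n := n) (a := k - t) (b := k - t - 1) (d := t - u)
    (by omega) (by omega)
  rw [show k - t + (t - u) = k - u by omega, show k - t - 1 - (t - u) = k - v by omega] at key
  have h1 := mul_choose_sub_le (u := t) hn (by omega)
  have h2 := choose_le_one_add_inv_pow_mul ht htk hn
  have hD := choose_sub_pos htk hn
  have h3 := one_add_inv_pow_sq_mul_lt ht
  have h0 : (0 : ℝ) < t := by exact_mod_cast (by omega : 0 < t)
  have h1' : (n.choose (k - t - 1) : ℝ) ≤ 1 / t * n.choose (k - t) := by
    rw [div_mul_eq_mul_div, le_div_iff₀ h0]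
    have : (t : ℝ) * n.choose (k - t - 1) ≤ n.choose (k - t) := by exact_mod_cast h1
    linarith
  have hE : ((1 + 1 / (t : ℝ)) ^ t) ^ 2 * (1 / t) < 1 := by
    refine lt_of_le_of_lt ?_ h3
    gcongr
    norm_num
  calc (n.choose (k - u) : ℝ) * n.choose (k - v) ≤ n.choose (k - t) * n.choose (k - t - 1) := by
        exact_mod_cast key
    _ ≤ n.choose (k - t) * (1 / t * n.choose (k - t)) := by gcongr
    _ ≤ ((1 + 1 / (t : ℝ)) ^ t * (n - t).choose (k - t)) *
        (1 / t * ((1 + 1 / (t : ℝ)) ^ t * (n - t).choose (k - t))) := by gcongr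
    _ = (((1 + 1 / (t : ℝ)) ^ t) ^ 2 * (1 / t)) * ((n - t).choose (k - t) : ℝ) ^ 2 := by ring
    _ < 1 * ((n - t).choose (k - t) : ℝ) ^ 2 := by gcongr
    _ = _ := one_mul _

/-- The case in which all walks of one family that do not pass its line touch it twice. The
estimate fails for `t = 13`. -/
theorem twice_mul_choose_lt {n k t u v : ℕ} (ht : 14 ≤ t) (htk : t ≤ k) (hn : (t + 1) * k ≤ n)
    (huv : u + v = 2 * t) (hu : u + 1 ≤ k) (hv : v ≤ k) :
    ((n.choose (k - u - 1) : ℝ) + (n - 1).choose (k - u - 1)) * n.choose (k - v) <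
      ((n - t).choose (k - t) : ℝ) ^ 2 := by
  have h0 : (0 : ℝ) < t := by exact_mod_cast (by omega : 0 < t)
  have h1 : (n.choose (k - u - 1) : ℝ) ≤ 1 / t * n.choose (k - u) := by
    rw [div_mul_eq_mul_div, le_div_iff₀ h0]
    have : (t : ℝ) * n.choose (k - u - 1) ≤ n.choose (k - u) := by
      exact_mod_cast mul_choose_sub_le hn hu
    linarith
  have h2 : ((n - 1).choose (k - u - 1) : ℝ) ≤ 1 / (t + 1) * n.choose (k - u) := by
    rw [div_mul_eq_mul_div, le_div_iff₀ (by positivity)]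
    obtain ⟨K, hK⟩ : ∃ K, k - u = K + 1 := ⟨k - u - 1, by omega⟩
    have hkn : 1 * k ≤ n := le_trans (Nat.mul_le_mul_right _ (by omega)) hn
    obtain ⟨N, rfl⟩ : ∃ N, n = N + 1 := ⟨n - 1, by omega⟩
    rw [hK, Nat.add_sub_cancel, Nat.add_sub_cancel]
    have h := Nat.add_one_mul_choose_eq N K
    have h' : (t + 1) * (K + 1) ≤ N + 1 := le_trans (Nat.mul_le_mul_left _ (by omega)) hn
    have : N.choose K * (t + 1) ≤ (N + 1).choose (K + 1) := by
      refine Nat.le_of_mul_le_mul_right (c := K + 1) ?_ (by omega)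
      rw [← h]
      calc N.choose K * (t + 1) * (K + 1) = (t + 1) * (K + 1) * N.choose K := by ring
        _ ≤ _ := by gcongr
    have : (N.choose K : ℝ) * (t + 1) ≤ (N + 1).choose (K + 1) := by exact_mod_cast this
    linarith
  have hD := choose_sub_pos htk hn
  have h3 := one_add_inv_pow_sq_mul_lt' ht
  have h4 := choose_mul_choose_le ht htk hn huv (by omega) hv
  calc ((n.choose (k - u - 1) : ℝ) + (n - 1).choose (k - u - 1)) * n.choose (k - v)
      ≤ (1 / t * n.choose (k - u) + 1 / (t + 1) * n.choose (k - u)) * n.choose (k - v) := by gcongr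
    _ = (1 / (t + 1) + 1 / t) * ((n.choose (k - u) : ℝ) * n.choose (k - v)) := by ring
    _ ≤ (1 / (t + 1) + 1 / t) * (((1 + 1 / (t : ℝ)) ^ t) ^ 2 * ((n - t).choose (k - t) : ℝ) ^ 2) := by
        gcongr
    _ = (((1 + 1 / (t : ℝ)) ^ t) ^ 2 * (1 / (t + 1) + 1 / t)) * ((n - t).choose (k - t) : ℝ) ^ 2 := by
        ring
    _ < 1 * ((n - t).choose (k - t) : ℝ) ^ 2 := by gcongr
    _ = _ := one_mul _

theorem touchBound_three_le {n k t u : ℕ} (ht : 14 ≤ t) (hn : (t + 1) * k ≤ n) (hu : u + 2 ≤ t)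
    (hk : u + 3 ≤ k) : touchBound n k u 3 ≤ 0.0725 * n.choose (k - u) := by
  have hkn : 15 * k ≤ n := le_trans (Nat.mul_le_mul_right _ (by omega)) hn
  have ht' : (14 : ℝ) ≤ t := by exact_mod_cast ht
  rw [touchBound_three]
  rcases Nat.eq_zero_or_pos u with rfl | hu0
  · have h1 := pow_mul_choose_sub_le (c := t) (n := n) (m := k) (h := 3) (by omega) (by linarith)
    have h2 : (n - 0 - 6).choose (k - 0 - 3) ≤ n.choose (k - 3) := Nat.choose_le_choose _ (by omega)
    have h1' : (t : ℝ) ^ 3 * n.choose (k - 3) ≤ n.choose k := by exact_mod_cast h1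
    have h2' : ((n - 0 - 6).choose (k - 0 - 3) : ℝ) ≤ n.choose (k - 3) := by exact_mod_cast h2
    have h3 : (14 : ℝ) ^ 3 * n.choose (k - 3) ≤ t ^ 3 * n.choose (k - 3) := by gcongr
    have h4 : (0 : ℝ) ≤ n.choose (k - 3) := by positivity
    simp only [Nat.sub_zero] at h2' ⊢
    norm_num
    norm_num at h3
    linarith
  · have h1 := mul_choose_le_choose_three ht hn hk hu0
    have hz : (0 : ℝ) ≤ (n - u - 6).choose (k - u - 3) := by positivity
    have hu' : (u : ℝ) + 2 ≤ t := by exact_mod_cast hu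
    have hu0' : (1 : ℝ) ≤ u := by exact_mod_cast hu0
    have key : ((u : ℝ) + 1) * (u + 5) * (u + 6) / 6 ≤ 0.0725 * ((u + 6) * (u + 5) * (u + 4) / 6 +
        (u + 6) * (u + 5) / 2 * t + (u + 6) * t ^ 2 + t ^ 3) := by
      -- the right-hand side increases with `t`, so it suffices to take `t = max 14 (u + 2)`
      rcases le_total (u : ℝ) 12 with h12 | h12
      · have e : ((u : ℝ) + 6) * (u + 5) * (u + 4) / 6 + (u + 6) * (u + 5) / 2 * 14 +
            (u + 6) * 14 ^ 2 + 14 ^ 3 ≤ (u + 6) * (u + 5) * (u + 4) / 6 +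
            (u + 6) * (u + 5) / 2 * t + (u + 6) * t ^ 2 + t ^ 3 := by gcongr
        refine le_trans ?_ (mul_le_mul_of_nonneg_left e (by norm_num))
        nlinarith [mul_nonneg (sub_nonneg.2 h12) (sub_nonneg.2 hu0'),
          mul_nonneg (mul_nonneg (sub_nonneg.2 h12) (sub_nonneg.2 hu0')) (sub_nonneg.2 hu0')]
      · have e : ((u : ℝ) + 6) * (u + 5) * (u + 4) / 6 + (u + 6) * (u + 5) / 2 * (u + 2) +
            (u + 6) * (u + 2) ^ 2 + (u + 2) ^ 3 ≤ (u + 6) * (u + 5) * (u + 4) / 6 +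
            (u + 6) * (u + 5) / 2 * t + (u + 6) * t ^ 2 + t ^ 3 := by gcongr
        refine le_trans ?_ (mul_le_mul_of_nonneg_left e (by norm_num))
        nlinarith [mul_nonneg (sub_nonneg.2 h12) (sub_nonneg.2 h12),
          mul_nonneg (mul_nonneg (sub_nonneg.2 h12) (sub_nonneg.2 h12)) (sub_nonneg.2 h12)]
    calc _ ≤ _ := mul_le_mul_of_nonneg_right key hz
      _ = _ := mul_assoc _ _ _
      _ ≤ _ := mul_le_mul_of_nonneg_left h1 (by norm_num)

theorem touchBound_two_le {n k t u : ℕ} (ht : 14 ≤ t) (hn : (t + 1) * k ≤ n) (hu : u ≤ t)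
    (hu1 : 1 ≤ u) (hk : u + 2 ≤ k) : touchBound n k u 2 ≤ 0.226 * n.choose (k - u) := by
  have ht' : (14 : ℝ) ≤ t := by exact_mod_cast ht
  rw [touchBound_two]
  have h1 := mul_choose_le_choose_two ht hn hk hu1
  have hz : (0 : ℝ) ≤ (n - u - 4).choose (k - u - 2) := by positivity
  have hu' : (u : ℝ) ≤ t := by exact_mod_cast hu
  have hu0' : (1 : ℝ) ≤ u := by exact_mod_cast hu1
  have key : ((u : ℝ) + 1) * (u + 4) / 2 ≤
      0.226 * ((u + 4) * (u + 3) / 2 + (u + 4) * t + t ^ 2) := by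
    nlinarith
  calc _ ≤ _ := mul_le_mul_of_nonneg_right key hz
    _ = _ := mul_assoc _ _ _
    _ ≤ _ := mul_le_mul_of_nonneg_left h1 (by norm_num)

theorem touchBound_two_le' {n k t u : ℕ} (ht : 14 ≤ t) (hn : (t + 1) * k ≤ n) (hu : u + 1 ≤ t)
    (hu1 : 1 ≤ u) (hk : u + 2 ≤ k) : touchBound n k u 2 ≤ 0.21 * n.choose (k - u) := by
  have ht' : (14 : ℝ) ≤ t := by exact_mod_cast ht
  rw [touchBound_two]
  have h1 := mul_choose_le_choose_two ht hn hk hu1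
  have hz : (0 : ℝ) ≤ (n - u - 4).choose (k - u - 2) := by positivity
  have hu' : (u : ℝ) + 1 ≤ t := by exact_mod_cast hu
  have hu0' : (1 : ℝ) ≤ u := by exact_mod_cast hu1
  have key : ((u : ℝ) + 1) * (u + 4) / 2 ≤
      0.21 * ((u + 4) * (u + 3) / 2 + (u + 4) * t + t ^ 2) := by
    nlinarith
  calc _ ≤ _ := mul_le_mul_of_nonneg_right key hz
    _ = _ := mul_assoc _ _ _
    _ ≤ _ := mul_le_mul_of_nonneg_left h1 (by norm_num)

theorem touchBound_one_le {n k t : ℕ} (ht : 14 ≤ t) (hn : (t + 1) * k ≤ n)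
    (hk : t + 2 ≤ k) : touchBound n k (t + 1) 1 ≤ 0.52 * n.choose (k - (t + 1)) := by
  have ht' : (14 : ℝ) ≤ t := by exact_mod_cast ht
  rw [touchBound_one]
  have h1 := mul_choose_le_choose_one (u := t + 1) ht hn hk (by omega)
  have h1' : ((t : ℝ) + 1 + 2 + t) * (n - (t + 1) - 2).choose (k - (t + 1) - 1) ≤
    n.choose (k - (t + 1)) := by exact_mod_cast h1
  have hz : (0 : ℝ) ≤ (n - (t + 1) - 2).choose (k - (t + 1) - 1) := by positivity
  have key : (((t + 1 : ℕ) : ℝ) + 1) ≤ 0.52 * ((t : ℝ) + 1 + 2 + t) := by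
    push_cast; linarith
  calc _ ≤ _ := mul_le_mul_of_nonneg_right key hz
    _ = _ := mul_assoc _ _ _
    _ ≤ _ := mul_le_mul_of_nonneg_left h1' (by norm_num)

/-! ### Comparison of the ballot bounds with a star -/

/-- The case of a common touching time that is late for the lower of the two lines. -/
theorem late_touch_lt {n k t u v j : ℕ} (ht : 14 ≤ t) (htk : t ≤ k) (hn : (t + 1) * k ≤ n)
    (huv : u + v = 2 * t) (hu : u + 2 ≤ t) (hv : v ≤ k) (hj : 3 ≤ j) (hk : u + j ≤ k) :
    (touchBound n k u j + n.choose (k - u) / t) * n.choose (k - v) <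
      ((n - t).choose (k - t) : ℝ) ^ 2 := by
  have h1 : touchBound n k u j ≤ 0.0725 * n.choose (k - u) :=
    (touchBound_le_of_le ht hn (by norm_num) hj (by omega) hk).trans
      (touchBound_three_le ht hn hu (by omega))
  have hD := choose_sub_pos htk hn
  have h3 := one_add_inv_pow_sq_mul_lt ht
  have h4 := choose_mul_choose_le ht htk hn huv (by omega) hv
  calc (touchBound n k u j + n.choose (k - u) / t) * n.choose (k - v)
      ≤ (0.0725 * n.choose (k - u) + n.choose (k - u) / t) * n.choose (k - v) := by gcongr
    _ = (0.0725 + 1 / t) * ((n.choose (k - u) : ℝ) * n.choose (k - v)) := by ring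
    _ ≤ (0.0725 + 1 / t) * (((1 + 1 / (t : ℝ)) ^ t) ^ 2 * ((n - t).choose (k - t) : ℝ) ^ 2) := by
        gcongr
    _ = (((1 + 1 / (t : ℝ)) ^ t) ^ 2 * (0.0725 + 1 / t)) * ((n - t).choose (k - t) : ℝ) ^ 2 := by
        ring
    _ < 1 * ((n - t).choose (k - t) : ℝ) ^ 2 := by gcongr
    _ = _ := one_mul _

/-- The case of a common touching time that is not early, for two equal lines. -/
theorem equal_levels_lt {n k t j : ℕ} (ht : 14 ≤ t) (htk : t ≤ k) (hn : (t + 1) * k ≤ n)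
    (hj : 2 ≤ j) (hk : t + j ≤ k) :
    (touchBound n k t j + n.choose (k - t) / t) * (touchBound n k t j + n.choose (k - t) / t) <
      ((n - t).choose (k - t) : ℝ) ^ 2 := by
  have h1 : touchBound n k t j ≤ 0.226 * n.choose (k - t) :=
    (touchBound_le_of_le ht hn (by norm_num) hj (by omega) hk).trans
      (touchBound_two_le ht hn le_rfl (by omega) (by omega))
  have hD := choose_sub_pos htk hn
  have h2 := choose_le_one_add_inv_pow_mul ht htk hn
  have h3 := one_add_inv_pow_lt t (by omega)
  have h4 : (n.choose (k - t) : ℝ) / t ≤ 1 / 14 * n.choose (k - t) := by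
    rw [div_eq_inv_mul, ← one_div]
    gcongr
    exact_mod_cast ht
  have h5 : touchBound n k t j + n.choose (k - t) / t < ((n - t).choose (k - t) : ℝ) := by
    calc touchBound n k t j + n.choose (k - t) / t
        ≤ 0.226 * n.choose (k - t) + 1 / 14 * n.choose (k - t) := by gcongr
      _ = (0.226 + 1 / 14) * n.choose (k - t) := by ring
      _ ≤ (0.226 + 1 / 14) * ((1 + 1 / (t : ℝ)) ^ t * (n - t).choose (k - t)) := by gcongr
      _ ≤ (0.226 + 1 / 14) * (2.7183 * (n - t).choose (k - t)) := by gcongr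
      _ < _ := by norm_num; linarith
  have h6 : 0 ≤ touchBound n k t j + n.choose (k - t) / t :=
    add_nonneg (touchBound_nonneg _ _ _ _) (by positivity)
  rw [sq]
  exact mul_self_lt_mul_self h6 h5

/-- The pairs `(F, x)` with `x ∈ [t + 2]` and `[t + 2] \ F = {x}` are at most as many as the sets
`F` with `[t] ⊆ F`. -/
theorem choose_sub_two_le {n k t : ℕ} (ht : 14 ≤ t) (hn : (t + 1) * k ≤ n) (hk : t + 1 ≤ k) :
    (t + 2) * (n - t - 2).choose (k - t - 1) ≤ (n - t).choose (k - t) := by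
  obtain ⟨K, rfl⟩ := Nat.exists_eq_add_of_le hk
  have h1 : (t + 1) * (K + 1) + 2 ≤ n - t := by
    have : (t + 1) * (t + 1 + K) = (t + 1) * (K + 1) + (t + 1) * t := by ring
    have : 15 * t ≤ (t + 1) * t := Nat.mul_le_mul_right _ (by omega)
    omega
  obtain ⟨N, hN⟩ : ∃ N, n - t = N + 2 := ⟨n - t - 2, by omega⟩
  have h2 := add_two_mul_mul_le h1
  have hKN : K ≤ N := by
    have : 15 * (K + 1) ≤ (t + 1) * (K + 1) := Nat.mul_le_mul_right _ (by omega)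
    omega
  rw [hN] at h1 h2 ⊢
  rw [show t + 1 + K - t - 1 = K by omega, show t + 1 + K - t = K + 1 by omega,
    Nat.add_sub_cancel]
  apply mul_choose_le_choose_add_two hKN
  rw [show N + 2 - (K + 1) = N + 1 - K by omega, show N + 2 - 1 = N + 1 by omega] at h2
  exact h2

/-- The case of levels `t - 1` and `t + 1` and a common touching time after the first possible
one. -/
theorem adjacent_levels_lt {n k t j : ℕ} (ht : 14 ≤ t) (hn : (t + 1) * k ≤ n)
    (hj : 1 ≤ j) (hk : t + 1 + j ≤ k) :
    (touchBound n k (t - 1) (j + 1) + n.choose (k - (t - 1)) / t) *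
      (touchBound n k (t + 1) j + n.choose (k - (t + 1)) / t) <
      ((n - t).choose (k - t) : ℝ) ^ 2 := by
  have h0 : (14 : ℝ) ≤ t := by exact_mod_cast ht
  have h1 : touchBound n k (t - 1) (j + 1) ≤ touchBound n k (t - 1) 2 :=
    touchBound_le_of_le ht hn (by norm_num) (by omega) (by omega) (by omega)
  have h2 : touchBound n k (t + 1) j ≤ touchBound n k (t + 1) 1 :=
    touchBound_le_of_le ht hn (by norm_num) (by omega) (by omega) (by omega)
  have h3 := touchBound_two_le' (u := t - 1) ht hn (by omega) (by omega) (by omega)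
  have h4 := touchBound_one_le ht hn (by omega : t + 2 ≤ k)
  have h5 := choose_mul_choose_le ht (by omega : t ≤ k) hn (by omega : t - 1 + (t + 1) = 2 * t)
    (by omega) (by omega)
  have hD := choose_sub_pos (by omega : t ≤ k) hn
  have hE := one_add_inv_pow_lt t (by omega)
  have hprod : touchBound n k (t - 1) 2 * touchBound n k (t + 1) 1 ≤
      1 / 2 * ((n - t).choose (k - t) : ℝ) ^ 2 := by
    rw [touchBound_two, touchBound_one]
    have h6 := choose_sub_two_le ht hn (by omega : t + 1 ≤ k)
    obtain ⟨K, rfl⟩ := Nat.exists_eq_add_of_le (by omega : t + 2 ≤ k)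
    have hn2 : (t + 1) * (K + 1) + 2 ≤ n - t - 2 := by
      have : (t + 1) * (t + 2 + K) = (t + 1) * (K + 1) + (t + 1) * (t + 1) := by ring
      have : 15 * (t + 1) ≤ (t + 1) * (t + 1) := Nat.mul_le_mul_right _ (by omega)
      omega
    obtain ⟨M, hM⟩ : ∃ M, n - t - 2 = M + 1 := ⟨n - t - 3, by omega⟩
    have hKM : K + 1 ≤ M := by
      have : 15 * (K + 1) ≤ (t + 1) * (K + 1) := Nat.mul_le_mul_right _ (by omega)
      omega
    have e1 : n - (t - 1) - 4 = M := by omega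
    have e2 : n - (t + 1) - 2 = M := by omega
    rw [e1, e2, show t + 2 + K - (t - 1) - 2 = K + 1 by omega,
      show t + 2 + K - (t + 1) - 1 = K by omega]
    rw [hM, show t + 2 + K - t - 1 = K + 1 by omega] at h6
    rw [hM] at hn2
    have h7 := Nat.choose_mul_succ_eq M (K + 1)
    have h8 := Nat.add_one_mul_choose_eq M K
    have h9 : (t + 2) * ((K + 1) * (M + 1 - (K + 1))) ≤ (M + 1) * (M + 1) :=
      (add_two_mul_mul_le (by omega)).trans (by gcongr; omega)
    have h10 : (t + 2) * (M.choose (K + 1) * M.choose K) ≤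
        (M + 1).choose (K + 1) * (M + 1).choose (K + 1) := by
      refine Nat.le_of_mul_le_mul_right (c := (M + 1) * (M + 1)) ?_ (by positivity)
      calc (t + 2) * (M.choose (K + 1) * M.choose K) * ((M + 1) * (M + 1))
          = (t + 2) * ((M.choose (K + 1) * (M + 1)) * ((M + 1) * M.choose K)) := by ring
        _ = ((M + 1).choose (K + 1) * (M + 1).choose (K + 1)) *
            ((t + 2) * ((K + 1) * (M + 1 - (K + 1)))) := by rw [h7, h8]; ring
        _ ≤ _ := by gcongr
    have h11 : ((t : ℝ) + 2) * (M.choose (K + 1) * M.choose K) ≤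
        (M + 1).choose (K + 1) * (M + 1).choose (K + 1) := by exact_mod_cast h10
    have h12 : ((t : ℝ) + 2) * (M + 1).choose (K + 1) ≤ (n - t).choose (t + 2 + K - t) := by
      exact_mod_cast h6
    have h13 : (((t : ℝ) + 2) * (M + 1).choose (K + 1)) ^ 2 ≤
      ((n - t).choose (t + 2 + K - t) : ℝ) ^ 2 := by gcongr
    have e3 : ((t - 1 : ℕ) : ℝ) = t - 1 := by push_cast [show 1 ≤ t by omega]; ring
    rw [e3]
    push_cast
    calc ((t : ℝ) - 1 + 1) * (t - 1 + 4) / 2 * M.choose (K + 1) * ((t + 1 + 1) * M.choose K)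
        = t * (t + 3) / 2 * ((t + 2) * (M.choose (K + 1) * M.choose K)) := by ring
      _ ≤ t * (t + 3) / 2 * ((M + 1).choose (K + 1) * (M + 1).choose (K + 1)) := by gcongr
      _ ≤ (t + 2) ^ 2 / 2 * ((M + 1).choose (K + 1) * (M + 1).choose (K + 1)) := by
          gcongr; nlinarith
      _ = 1 / 2 * (((t : ℝ) + 2) * (M + 1).choose (K + 1)) ^ 2 := by ring
      _ ≤ _ := by gcongr
  have hT := touchBound_nonneg n k (t - 1) (j + 1)
  have hT' := touchBound_nonneg n k (t + 1) j
  have hT2 := touchBound_nonneg n k (t - 1) 2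
  have hT2' := touchBound_nonneg n k (t + 1) 1
  have h14 : (1 : ℝ) / t ≤ 1 / 14 := by gcongr
  have hE2 : ((1 + 1 / (t : ℝ)) ^ t) ^ 2 ≤ 2.7183 ^ 2 := by gcongr
  have h15 : (n.choose (k - (t - 1)) : ℝ) * n.choose (k - (t + 1)) ≤
      2.7183 ^ 2 * ((n - t).choose (k - t) : ℝ) ^ 2 := h5.trans (by gcongr)
  have hx : (n.choose (k - (t - 1)) : ℝ) / t ≤ 1 / 14 * n.choose (k - (t - 1)) := by
    rw [div_eq_inv_mul, ← one_div]; gcongr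
  have hy : (n.choose (k - (t + 1)) : ℝ) / t ≤ 1 / 14 * n.choose (k - (t + 1)) := by
    rw [div_eq_inv_mul, ← one_div]; gcongr
  have hD2 : (0 : ℝ) < ((n - t).choose (k - t) : ℝ) ^ 2 := by positivity
  generalize touchBound n k (t - 1) 2 = a at *
  generalize touchBound n k (t + 1) 1 = b at *
  generalize (n.choose (k - (t - 1)) : ℝ) = x at *
  generalize (n.choose (k - (t + 1)) : ℝ) = y at *
  generalize ((n - t).choose (k - t) : ℝ) ^ 2 = d at *
  have hx0 : 0 ≤ x := by linarith
  have hy0 : 0 ≤ y := by linarith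
  have hxt : 0 ≤ x / t := by positivity
  have hyt : 0 ≤ y / t := by positivity
  calc _ ≤ (a + 1 / 14 * x) * (b + 1 / 14 * y) := by gcongr
    _ = a * b + 1 / 14 * (a * y) + 1 / 14 * (x * b) + 1 / 196 * (x * y) := by ring
    _ ≤ 1 / 2 * d + 1 / 14 * (0.21 * x * y) + 1 / 14 * (x * (0.52 * y)) + 1 / 196 * (x * y) := by
        gcongr
    _ = 1 / 2 * d + (0.73 / 14 + 1 / 196) * (x * y) := by ring
    _ ≤ 1 / 2 * d + (0.73 / 14 + 1 / 196) * (2.7183 ^ 2 * d) := by gcongr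
    _ < d := by norm_num; linarith

/-- The case of levels `t - 2` and `t + 2` and the first possible common touching time. -/
theorem distant_levels_lt {n k t : ℕ} (ht : 14 ≤ t) (hn : (t + 1) * k ≤ n) (hk : t + 2 ≤ k)
    {p q : ℝ} (hp0 : 0 ≤ p) (hp : p ≤ n.choose (k - (t - 2)) / t)
    (hp' : p ≤ n.choose (k - (t - 2) - 1)) (hq0 : 0 ≤ q) (hq : q ≤ n.choose (k - (t + 2)) / t) :
    (touchBound n k (t - 2) 2 + p) * (touchBound n k (t + 2) 0 + q) <
      ((n - t).choose (k - t) : ℝ) ^ 2 := by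
  have h0 : (14 : ℝ) ≤ t := by exact_mod_cast ht
  have h3 := touchBound_two_le' (u := t - 2) ht hn (by omega) (by omega) (by omega)
  have h5 := choose_mul_choose_le ht (by omega : t ≤ k) hn (by omega : t - 2 + (t + 2) = 2 * t)
    (by omega) (by omega)
  have hD := choose_sub_pos (by omega : t ≤ k) hn
  have hE := one_add_inv_pow_lt t (by omega)
  have h6 := choose_sub_two_le ht hn (by omega : t + 1 ≤ k)
  have h16 := choose_le_one_add_inv_pow_mul ht (by omega : t ≤ k) hn
  have ht0 : touchBound n k (t + 2) 0 = (n - t - 2).choose (k - t - 2) := by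
    unfold touchBound
    rw [Nat.choose_zero_right]
    have e : ((t + 2 : ℕ) : ℝ) + (0 : ℕ) + 1 = ((t + 2 : ℕ) : ℝ) + 1 := by simp
    rw [e, div_self (by positivity)]
    simp [Nat.sub_sub]
  have hprod : touchBound n k (t - 2) 2 * touchBound n k (t + 2) 0 ≤
      1 / 2 * ((n - t).choose (k - t) : ℝ) ^ 2 := by
    rw [touchBound_two, ht0]
    have h7 := choose_succ_mul_choose_le (n := n - t - 2) (a := k - t - 1) (b := k - t - 2)
      (by omega)
    rw [show k - t - 1 + 1 = k - t by omega, show k - t - 2 + 1 = k - t - 1 by omega] at h7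
    rw [show n - (t - 2) - 4 = n - t - 2 by omega, show k - (t - 2) - 2 = k - t by omega]
    have h7' : ((n - t - 2).choose (k - t) : ℝ) * (n - t - 2).choose (k - t - 2) ≤
      (n - t - 2).choose (k - t - 1) * (n - t - 2).choose (k - t - 1) := by exact_mod_cast h7
    have h12 : ((t : ℝ) + 2) * (n - t - 2).choose (k - t - 1) ≤ (n - t).choose (k - t) := by
      exact_mod_cast h6
    have h13 : (((t : ℝ) + 2) * (n - t - 2).choose (k - t - 1)) ^ 2 ≤
      ((n - t).choose (k - t) : ℝ) ^ 2 := by gcongr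
    have e3 : ((t - 2 : ℕ) : ℝ) = t - 2 := by push_cast [show 2 ≤ t by omega]; ring
    rw [e3]
    have h17 : (0 : ℝ) ≤ (t - 2 + 1) * (t - 2 + 4) / 2 := by nlinarith
    calc ((t : ℝ) - 2 + 1) * (t - 2 + 4) / 2 * (n - t - 2).choose (k - t) *
          (n - t - 2).choose (k - t - 2)
        = (t - 2 + 1) * (t - 2 + 4) / 2 *
          ((n - t - 2).choose (k - t) * (n - t - 2).choose (k - t - 2)) := by ring
      _ ≤ (t - 2 + 1) * (t - 2 + 4) / 2 *
          ((n - t - 2).choose (k - t - 1) * (n - t - 2).choose (k - t - 1)) := by gcongr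
      _ ≤ (t + 2) ^ 2 / 2 * ((n - t - 2).choose (k - t - 1) * (n - t - 2).choose (k - t - 1)) := by
          gcongr; nlinarith
      _ = 1 / 2 * (((t : ℝ) + 2) * (n - t - 2).choose (k - t - 1)) ^ 2 := by ring
      _ ≤ _ := by gcongr
  have hcross : p * touchBound n k (t + 2) 0 ≤ 0.19 * ((n - t).choose (k - t) : ℝ) ^ 2 := by
    rw [ht0]
    have key : (t + 1) * ((n - t - 2).choose (k - t - 2) * n.choose (k - t + 1)) ≤
        (n - t).choose (k - t) * n.choose (k - t) := by
      obtain ⟨K, rfl⟩ := Nat.exists_eq_add_of_le hk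
      rw [show t + 2 + K - t - 2 = K by omega, show t + 2 + K - t = K + 2 by omega]
      have hn2 : (t + 1) * (K + 2) + 14 * t ≤ n - t := by
        have : (t + 1) * (t + 2 + K) = (t + 1) * (K + 2) + (t + 1) * t := by ring
        have : 15 * t ≤ (t + 1) * t := Nat.mul_le_mul_right _ (by omega)
        omega
      obtain ⟨N, hN⟩ : ∃ N, n - t = N + 2 := ⟨n - t - 2, by omega⟩
      have hn3 : n = N + 2 + t := by omega
      rw [hN] at hn2
      rw [hN, Nat.add_sub_cancel]
      have g1 := Nat.choose_succ_right_eq n (K + 2)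
      have g2 := Nat.add_one_mul_choose_eq N K
      have g3 := Nat.add_one_mul_choose_eq (N + 1) (K + 1)
      have g4 : n - (K + 2) = N + t - K := by omega
      rw [g4] at g1
      have g5 : (t + 1) * ((K + 1) * ((K + 2) * (N + t - K))) ≤ (K + 3) * ((N + 2) * (N + 1)) := by
        have g6 : (t + 1) * (K + 1) ≤ N + 1 := by nlinarith
        have g7 : (K + 2) * (N + t - K) ≤ (K + 3) * (N + 2) := by
          have : (K + 2) * (N + t - K) ≤ (K + 2) * (N + t) := by gcongr; omega
          nlinarith
        calc (t + 1) * ((K + 1) * ((K + 2) * (N + t - K)))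
            = ((t + 1) * (K + 1)) * ((K + 2) * (N + t - K)) := by ring
          _ ≤ (N + 1) * ((K + 3) * (N + 2)) := Nat.mul_le_mul g6 g7
          _ = _ := by ring
      refine Nat.le_of_mul_le_mul_right (c := (K + 3) * ((N + 2) * (N + 1))) ?_ (by positivity)
      calc (t + 1) * (N.choose K * n.choose (K + 2 + 1)) * ((K + 3) * ((N + 2) * (N + 1)))
          = (t + 1) * ((N + 2) * ((N + 1) * N.choose K) * (n.choose (K + 2 + 1) * (K + 2 + 1))) := by
            ring
        _ = (t + 1) * (((N + 1 + 1) * (N + 1).choose (K + 1)) * (K + 1) *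
            (n.choose (K + 2) * (N + t - K))) := by rw [g1, g2]; ring
        _ = ((N + 2).choose (K + 2) * n.choose (K + 2)) *
            ((t + 1) * ((K + 1) * ((K + 2) * (N + t - K)))) := by rw [g3]; ring
        _ ≤ _ := by gcongr
    have key' : ((t : ℝ) + 1) * ((n - t - 2).choose (k - t - 2) * n.choose (k - t + 1)) ≤
        (n - t).choose (k - t) * n.choose (k - t) := by exact_mod_cast key
    rw [show k - (t - 2) - 1 = k - t + 1 by omega] at hp'
    have g8 : (15 : ℝ) * ((n - t - 2).choose (k - t - 2) * n.choose (k - t + 1)) ≤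
        (n - t).choose (k - t) * (2.7183 * (n - t).choose (k - t)) := by
      calc (15 : ℝ) * ((n - t - 2).choose (k - t - 2) * n.choose (k - t + 1))
          ≤ (t + 1) * ((n - t - 2).choose (k - t - 2) * n.choose (k - t + 1)) := by
            gcongr; linarith
        _ ≤ (n - t).choose (k - t) * n.choose (k - t) := key'
        _ ≤ (n - t).choose (k - t) * ((1 + 1 / (t : ℝ)) ^ t * (n - t).choose (k - t)) := by gcongr
        _ ≤ _ := by gcongr
    calc p * (n - t - 2).choose (k - t - 2)
        ≤ n.choose (k - t + 1) * (n - t - 2).choose (k - t - 2) := by gcongr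
      _ ≤ _ := by nlinarith
  have hT2 := touchBound_nonneg n k (t - 2) 2
  have hE2 : ((1 + 1 / (t : ℝ)) ^ t) ^ 2 ≤ 2.7183 ^ 2 := by gcongr
  have h15 : (n.choose (k - (t - 2)) : ℝ) * n.choose (k - (t + 2)) ≤
      2.7183 ^ 2 * ((n - t).choose (k - t) : ℝ) ^ 2 := h5.trans (by gcongr)
  have hx : (n.choose (k - (t - 2)) : ℝ) / t ≤ 1 / 14 * n.choose (k - (t - 2)) := by
    rw [div_eq_inv_mul, ← one_div]; gcongr
  have hy : (n.choose (k - (t + 2)) : ℝ) / t ≤ 1 / 14 * n.choose (k - (t + 2)) := by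
    rw [div_eq_inv_mul, ← one_div]; gcongr
  have hD2 : (0 : ℝ) < ((n - t).choose (k - t) : ℝ) ^ 2 := by positivity
  have hp1 := hp.trans hx
  have hq1 := hq.trans hy
  generalize touchBound n k (t - 2) 2 = a at *
  generalize touchBound n k (t + 2) 0 = b at *
  generalize (n.choose (k - (t - 2)) : ℝ) = x at *
  generalize (n.choose (k - (t + 2)) : ℝ) = y at *
  generalize ((n - t).choose (k - t) : ℝ) ^ 2 = d at *
  have hx0 : 0 ≤ x := by linarith
  have hy0 : 0 ≤ y := by linarith
  calc (a + p) * (b + q) = a * b + a * q + p * b + p * q := by ring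
    _ ≤ 1 / 2 * d + (0.21 * x) * (1 / 14 * y) + 0.19 * d + (1 / 14 * x) * (1 / 14 * y) := by
        gcongr
    _ = 0.69 * d + (0.21 / 14 + 1 / 196) * (x * y) := by ring
    _ ≤ 0.69 * d + (0.21 / 14 + 1 / 196) * (2.7183 ^ 2 * d) := by gcongr
    _ < d := by norm_num; linarith

/-! ### Gain and loss in the early configurations -/

/-- `two_mul_pow_lt` for binomial coefficients. -/
theorem two_mul_choose_lt {n t h m s : ℕ} (ht : 14 ≤ t) (hh : 1 ≤ h) (hs : s ≤ t + h + 3)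
    (hm : t * m + s ≤ n + 1) (hmn : m + s ≤ n) :
    2 * (t + 2) * n.choose m < t ^ (h + 1) * (n - s).choose m := by
  obtain ⟨c, rfl⟩ : ∃ c, t = c + 1 := ⟨t - 1, by omega⟩
  have h1 := pow_mul_choose_le (c := c) (n := n) (m := m) (s := s) hm
  have h2 := two_mul_pow_lt ht hh
  rw [Nat.add_sub_cancel] at h2
  obtain ⟨r, hr⟩ := Nat.exists_eq_add_of_le hs
  have hcs : 0 < c ^ s := pow_pos (by omega) _
  have hpos : 0 < (n - s).choose m := Nat.choose_pos (by omega)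
  have h3 : 2 * (c + 1 + 2) * (c + 1) ^ s < (c + 1) ^ (h + 1) * c ^ s := by
    rw [hr, pow_add _ s r, pow_add _ s r] at h2
    refine Nat.lt_of_mul_lt_mul_right (a := (c + 1) ^ r) ?_
    calc 2 * (c + 1 + 2) * (c + 1) ^ s * (c + 1) ^ r
        = 2 * (c + 1 + 2) * ((c + 1) ^ s * (c + 1) ^ r) := by ring
      _ < (c + 1) ^ (h + 1) * (c ^ s * c ^ r) := h2
      _ = (c + 1) ^ (h + 1) * c ^ s * c ^ r := by ring
      _ ≤ _ := by gcongr; omega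
  refine Nat.lt_of_mul_lt_mul_left (a := c ^ s) ?_
  calc c ^ s * (2 * (c + 1 + 2) * n.choose m) = 2 * (c + 1 + 2) * (c ^ s * n.choose m) := by ring
    _ ≤ 2 * (c + 1 + 2) * ((c + 1) ^ s * (n - s).choose m) := by gcongr
    _ = (2 * (c + 1 + 2) * (c + 1) ^ s) * (n - s).choose m := by ring
    _ < ((c + 1) ^ (h + 1) * c ^ s) * (n - s).choose m := by gcongr
    _ = _ := by ring

/-- At least half of the walks with few steps up stay below the line `y = x + 1`. -/
theorem choose_le_two_mul_card_not_reaches {M K : ℕ} (h : 3 * K ≤ M + 1) :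
    M.choose K ≤ 2 * ((words M K).filter fun l => ¬ Reaches 1 l).card := by
  have h1 := card_reaches_add_card_not_reaches M K 1
  rcases Nat.eq_zero_or_pos K with rfl | hK
  · have := card_reaches_eq_zero (n := M) (k := 0) (u := 1) (by omega)
    omega
  · have h2 := card_reaches_le (n := M) (k := K) (u := 1) hK
    have h3 := mul_choose_le_choose_succ (c := 2) (n := M) (m := K - 1) (by omega)
    rw [Nat.sub_add_cancel hK] at h3
    omega

section GainLoss

variable {n k t h : ℕ}

/-- Gain against loss for the star with centre `[t]`: walks that meet the line `y = x + t + h` cost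
the other family more walks than they are worth. -/
theorem gain_lt_loss_star (ht : 14 ≤ t) (hn : (t + 1) * k ≤ n) (hh : 1 ≤ h) (hk : t + h ≤ k) :
    2 * n.choose (k - t - h) < (n - t - h - 1).choose (k - t) := by
  obtain ⟨K, rfl⟩ := Nat.exists_eq_add_of_le (by omega : t ≤ k)
  rw [Nat.add_sub_cancel_left]
  have h1 := pow_mul_choose_sub_le (c := t) (n := n) (m := K) (h := h) (by omega) (by nlinarith)
  have h2 := two_mul_choose_lt (n := n) (m := K) (s := t + h + 1) ht hh (by omega) (by nlinarith)
    (by nlinarith)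
  rw [show n - (t + h + 1) = n - t - h - 1 by omega] at h2
  have h3 : 2 * (t + 2) * n.choose (K - h) < t * (n - t - h - 1).choose K := by
    refine Nat.lt_of_mul_lt_mul_left (a := t ^ h) ?_
    calc t ^ h * (2 * (t + 2) * n.choose (K - h)) = 2 * (t + 2) * (t ^ h * n.choose (K - h)) := by
          ring
      _ ≤ 2 * (t + 2) * n.choose K := by gcongr
      _ < _ := h2
      _ = _ := by ring
  refine Nat.lt_of_mul_lt_mul_left (a := t) ?_
  nlinarith

/-- Gain against loss for `{F : |F ∩ [t + 2]| ≥ t + 1}`. -/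
theorem gain_lt_loss_second (ht : 14 ≤ t) (hn : (t + 1) * k ≤ n) (hh : 1 ≤ h) (hk : t + h ≤ k) :
    2 * n.choose (k - t - h) < t * (n - (t + 2) - h - 1).choose (k - t - 1) := by
  obtain ⟨K, rfl⟩ := Nat.exists_eq_add_of_le (by omega : t + 1 ≤ k)
  obtain ⟨g, rfl⟩ : ∃ g, h = g + 1 := ⟨h - 1, by omega⟩
  rw [show t + 1 + K - t - 1 = K by omega, show t + 1 + K - t - (g + 1) = K - g by omega]
  have h1 := pow_mul_choose_sub_le (c := t) (n := n) (m := K) (h := g) (by omega) (by nlinarith)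
  have h2 := two_mul_choose_lt (n := n) (m := K) (s := t + (g + 1) + 3) ht hh (by omega)
    (by nlinarith) (by nlinarith)
  rw [show n - (t + (g + 1) + 3) = n - (t + 2) - (g + 1) - 1 by omega] at h2
  have h3 : 2 * (t + 2) * n.choose (K - g) < t ^ 2 * (n - (t + 2) - (g + 1) - 1).choose K := by
    refine Nat.lt_of_mul_lt_mul_left (a := t ^ g) ?_
    calc t ^ g * (2 * (t + 2) * n.choose (K - g)) = 2 * (t + 2) * (t ^ g * n.choose (K - g)) := by
          ring
      _ ≤ 2 * (t + 2) * n.choose K := by gcongr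
      _ < _ := h2
      _ = _ := by ring
  refine Nat.lt_of_mul_lt_mul_left (a := t) ?_
  nlinarith

/-- The sizes of the two families `{F : |F ∩ [t + 1]| ≥ t}` and `{F : [t + 1] ⊆ F}` are in the
ratio `((t + 1) (n - k) + (k - t)) : (k - t)`. -/
theorem ratio_identity (htk : t + 1 ≤ k) :
    (k - t) * ((t + 1) * (n - t - 1).choose (k - t) + (n - t - 1).choose (k - t - 1)) =
      ((t + 1) * (n - k) + (k - t)) * (n - t - 1).choose (k - t - 1) := by
  have h := Nat.choose_succ_right_eq (n - t - 1) (k - t - 1)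
  rw [show k - t - 1 + 1 = k - t by omega, show n - t - 1 - (k - t - 1) = n - k by omega] at h
  calc (k - t) * ((t + 1) * (n - t - 1).choose (k - t) + (n - t - 1).choose (k - t - 1))
      = (t + 1) * ((n - t - 1).choose (k - t) * (k - t)) +
        (k - t) * (n - t - 1).choose (k - t - 1) := by ring
    _ = _ := by rw [h]; ring

/-- Gain against loss for the pair `{F : |F ∩ [t + 1]| ≥ t}`, `{F : [t + 1] ⊆ F}`, the gain being in
the first family. As the two differ in size, both sides are weighted by the size of the other
family. -/
theorem gain_mul_lt_loss_mul (ht : 14 ≤ t) (hn : (t + 1) * k ≤ n) (hh : 1 ≤ h)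
    (htk : t + 1 ≤ k) (hk : t + h ≤ k + 1) :
    2 * n.choose (k - (t - 1) - h) * (n - t - 1).choose (k - t - 1) <
      (n - (t + 1) - h - 1).choose (k - t - 1) *
        ((t + 1) * (n - t - 1).choose (k - t) + (n - t - 1).choose (k - t - 1)) := by
  have hid := ratio_identity (n := n) htk
  obtain ⟨K, rfl⟩ := Nat.exists_eq_add_of_le htk
  obtain ⟨g, rfl⟩ : ∃ g, h = g + 1 := ⟨h - 1, by omega⟩
  rw [show t + 1 + K - t - 1 = K by omega, show t + 1 + K - t = K + 1 by omega] at *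
  rw [show t + 1 + K - (t - 1) - (g + 1) = K + 1 - g by omega]
  have hkk : (t + 1) * (t + 1 + K) = t * K + t * t + 2 * t + 1 + K := by ring
  have htt : 14 * t ≤ t * t := Nat.mul_le_mul_right _ ht
  have h1 := pow_mul_choose_sub_le (c := t) (n := n) (m := K + 1) (h := g) (by omega)
    (by nlinarith)
  have h2 := two_mul_choose_lt (n := n) (m := K) (s := t + (g + 1) + 2) ht hh (by omega)
    (by nlinarith) (by nlinarith)
  rw [show n - (t + (g + 1) + 2) = n - (t + 1) - (g + 1) - 1 by omega] at h2
  have hy : 0 < (n - t - 1).choose K := Nat.choose_pos (by omega)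
  have h4 := Nat.choose_succ_right_eq n K
  have h5 : t * (n - K) ≤ (t + 1) * (n - (t + 1 + K)) := by
    obtain ⟨N, rfl⟩ := Nat.exists_eq_add_of_le (by nlinarith : t + 1 + K ≤ n)
    rw [Nat.add_sub_cancel_left, show t + 1 + K + N - K = t + 1 + N by omega]
    nlinarith
  generalize (n - t - 1).choose K = y at *
  generalize (t + 1) * (n - t - 1).choose (K + 1) + y = z at *
  generalize (n - (t + 1) - (g + 1) - 1).choose K = L at *
  generalize n.choose (K + 1 - g) = c at *
  have hn0 : 0 < n - K := by
    have : K < n := by nlinarith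
    omega
  have h6 : 2 * (t + 2) * ((K + 1) * c) < t ^ 2 * (n - K) * L := by
    refine Nat.lt_of_mul_lt_mul_left (a := t ^ g) ?_
    calc t ^ g * (2 * (t + 2) * ((K + 1) * c)) = 2 * (t + 2) * ((K + 1) * (t ^ g * c)) := by ring
      _ ≤ 2 * (t + 2) * ((K + 1) * n.choose (K + 1)) := by gcongr
      _ = (2 * (t + 2) * n.choose K) * (n - K) := by rw [mul_comm (K + 1), h4]; ring
      _ < (t ^ (g + 1 + 1) * L) * (n - K) := by gcongr
      _ = _ := by ring
  have h7 : 2 * ((K + 1) * c) < ((t + 1) * (n - (t + 1 + K)) + (K + 1)) * L := by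
    refine Nat.lt_of_mul_lt_mul_left (a := t + 2) ?_
    calc (t + 2) * (2 * ((K + 1) * c)) = 2 * (t + 2) * ((K + 1) * c) := by ring
      _ < t ^ 2 * (n - K) * L := h6
      _ = t * (t * (n - K)) * L := by ring
      _ ≤ (t + 2) * ((t + 1) * (n - (t + 1 + K)) + (K + 1)) * L := by gcongr <;> omega
      _ = _ := by ring
  refine Nat.lt_of_mul_lt_mul_left (a := K + 1) ?_
  calc (K + 1) * (2 * c * y) = 2 * ((K + 1) * c) * y := by ring
    _ < ((t + 1) * (n - (t + 1 + K)) + (K + 1)) * L * y := by gcongr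
    _ = L * (((t + 1) * (n - (t + 1 + K)) + (K + 1)) * y) := by ring
    _ = L * ((K + 1) * z) := by rw [hid]
    _ = _ := by ring

/-- As `gain_mul_lt_loss_mul`, the gain being in the second family. -/
theorem gain_mul_lt_loss_mul' (ht : 14 ≤ t) (hn : (t + 1) * k ≤ n) (hh : 1 ≤ h)
    (hk : t + 1 + h ≤ k) :
    2 * n.choose (k - (t + 1) - h) *
        ((t + 1) * (n - t - 1).choose (k - t) + (n - t - 1).choose (k - t - 1)) <
      t * (n - (t + 1) - h - 1).choose (k - t) * (n - t - 1).choose (k - t - 1) := by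
  have hid := ratio_identity (n := n) (by omega : t + 1 ≤ k)
  obtain ⟨K, rfl⟩ := Nat.exists_eq_add_of_le (by omega : t + 1 ≤ k)
  rw [show t + 1 + K - t - 1 = K by omega, show t + 1 + K - t = K + 1 by omega] at *
  rw [show t + 1 + K - (t + 1) - h = K - h by omega]
  have hkk : (t + 1) * (t + 1 + K) = t * K + t * t + 2 * t + 1 + K := by ring
  have htt : 14 * t ≤ t * t := Nat.mul_le_mul_right _ ht
  have htK : 14 * K ≤ t * K := Nat.mul_le_mul_right _ ht
  have h1 := pow_mul_choose_sub_le (c := t) (n := n) (m := K + 1) (h := h) (by omega)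
    (by nlinarith)
  have h2 := two_mul_choose_lt (n := n) (m := K + 1) (s := t + h + 2) ht hh (by omega)
    (by nlinarith) (by nlinarith)
  rw [show n - (t + h + 2) = n - (t + 1) - h - 1 by omega] at h2
  have hy : 0 < (n - t - 1).choose K := Nat.choose_pos (by omega)
  have h4 := Nat.choose_succ_right_eq n (K - h)
  rw [show K - h + 1 = K + 1 - h by omega] at h4
  generalize (n - t - 1).choose K = y at *
  generalize (t + 1) * (n - t - 1).choose (K + 1) + y = z at *
  generalize (n - (t + 1) - h - 1).choose (K + 1) = L at *
  generalize n.choose (K + 1 - h) = c at *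
  generalize n.choose (K - h) = d at *
  have h6 : 2 * (t + 2) * c < t * L := by
    refine Nat.lt_of_mul_lt_mul_left (a := t ^ h) ?_
    calc t ^ h * (2 * (t + 2) * c) = 2 * (t + 2) * (t ^ h * c) := by ring
      _ ≤ 2 * (t + 2) * n.choose (K + 1) := by gcongr
      _ < _ := h2
      _ = _ := by ring
  have h7 : (t + 1) * (n - (t + 1 + K)) + (K + 1) ≤ (t + 2) * (n - (K - h)) := by
    have : (t + 1) * (n - (t + 1 + K)) ≤ (t + 1) * (n - (K - h)) := Nat.mul_le_mul_left _ (by omega)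
    have e : (t + 2) * (n - (K - h)) = (t + 1) * (n - (K - h)) + (n - (K - h)) := by ring
    have : K + 1 ≤ n - (K - h) := by omega
    omega
  refine Nat.lt_of_mul_lt_mul_left (a := K + 1) ?_
  calc (K + 1) * (2 * d * z) = 2 * d * ((K + 1) * z) := by ring
    _ = 2 * (d * ((t + 1) * (n - (t + 1 + K)) + (K + 1))) * y := by rw [hid]; ring
    _ ≤ 2 * (d * ((t + 2) * (n - (K - h)))) * y := by gcongr
    _ = 2 * (t + 2) * (d * (n - (K - h))) * y := by ring
    _ = 2 * (t + 2) * c * (K + 1 - h) * y := by rw [← h4]; ring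
    _ ≤ 2 * (t + 2) * c * (K + 1) * y := by gcongr; omega
    _ < t * L * (K + 1) * y := by gcongr
    _ = _ := by ring

end GainLoss

/-- The family `{F : |F ∩ [t + 2]| ≥ t + 1}` is smaller than a star. -/
theorem second_family_lt {n k t : ℕ} (ht : 14 ≤ t) (hn : (t + 1) * k ≤ n) (hk : t + 1 ≤ k) :
    (t + 2) * (n - t - 2).choose (k - t - 1) +
      (if t + 2 ≤ k then (n - t - 2).choose (k - t - 2) else 0) < (n - t).choose (k - t) := by
  obtain ⟨K, rfl⟩ := Nat.exists_eq_add_of_le hk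
  rw [show t + 1 + K - t - 1 = K by omega, show t + 1 + K - t = K + 1 by omega,
    show K + 1 - 2 = K - 1 by omega]
  have hkk : (t + 1) * (t + 1 + K) = t * K + t * t + 2 * t + 1 + K := by ring
  have htt : 14 * t ≤ t * t := Nat.mul_le_mul_right _ ht
  obtain ⟨N, hN⟩ : ∃ N, n - t = N + 2 := ⟨n - t - 2, by omega⟩
  rw [hN, Nat.add_sub_cancel]
  have h1 : t * N.choose K < N.choose (K + 1) := by
    have h2 := Nat.choose_succ_right_eq N K
    have h3 : 0 < N.choose K := Nat.choose_pos (by omega)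
    have h4 : t * (K + 1) < N - K := by
      have : t * (K + 1) = t * K + t := by ring
      omega
    refine Nat.lt_of_mul_lt_mul_right (a := K + 1) ?_
    rw [h2]
    calc t * N.choose K * (K + 1) = N.choose K * (t * (K + 1)) := by ring
      _ < _ := by gcongr
  rw [Nat.choose_succ_succ' (N + 1) K, Nat.choose_succ_succ' N K]
  cases K with
  | zero => simp at h1 ⊢; omega
  | succ K =>
    rw [Nat.choose_succ_succ' N K]
    rw [if_pos (by omega), Nat.add_sub_cancel]
    have : (t + 2) * N.choose (K + 1) = t * N.choose (K + 1) + 2 * N.choose (K + 1) := by ring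
    omega

/-- The product of the sizes of `{F : |F ∩ [t + 1]| ≥ t}` and `{F : [t + 1] ⊆ F}` is smaller than the
square of the size of a star. -/
theorem adjacent_families_lt {n k t : ℕ} (ht : 14 ≤ t) (hn : (t + 1) * k ≤ n) (hk : t + 1 ≤ k) :
    ((t + 1) * (n - t - 1).choose (k - t) + (n - t - 1).choose (k - t - 1)) *
      (n - t - 1).choose (k - t - 1) < (n - t).choose (k - t) ^ 2 := by
  obtain ⟨K, rfl⟩ := Nat.exists_eq_add_of_le hk
  rw [show t + 1 + K - t - 1 = K by omega, show t + 1 + K - t = K + 1 by omega]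
  have hkk : (t + 1) * (t + 1 + K) = t * K + t * t + 2 * t + 1 + K := by ring
  have htt : 14 * t ≤ t * t := Nat.mul_le_mul_right _ ht
  obtain ⟨N, hN⟩ : ∃ N, n - t = N + 1 := ⟨n - t - 1, by omega⟩
  rw [hN, Nat.add_sub_cancel, Nat.choose_succ_succ' N K]
  have h1 := mul_choose_le_choose_succ (c := t) (n := N) (m := K) (by
    have : t * (K + 1) = t * K + t := by ring
    omega)
  have h3 : 0 < N.choose (K + 1) := Nat.choose_pos (by omega)
  have h4 : t * N.choose K * N.choose (K + 1) ≤ N.choose (K + 1) * N.choose (K + 1) := by gcongr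
  nlinarith [Nat.mul_pos h3 h3, Nat.zero_le (N.choose K * N.choose (K + 1))]

/-! ### Structure of cross-meeting families of walks -/

/-- The words that have at most `j` letters `false` among the first `i`. -/
def capped (n k i j : ℕ) : Finset (List Bool) := (words n k).filter fun l => i ≤ ups l i + j

/-- The prefix form of the cross `t`-intersecting property: the two walks together have at least
`m + t` steps up among the first `m`, for some `m`. -/
def Meets (t : ℕ) (a b : List Bool) : Prop := ∃ m, m + t ≤ ups a m + ups b m

theorem Meets.symm {t : ℕ} {a b : List Bool} (h : Meets t a b) : Meets t b a := by
  obtain ⟨m, hm⟩ := h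
  exact ⟨m, by omega⟩

theorem card_ups_eq {n k i a : ℕ} (hi : i ≤ n) (ha : a ≤ k) :
    ((words n k).filter fun l => ups l i = a).card = i.choose a * (n - i).choose (k - a) := by
  have h := card_filter_words_split hi ha (fun _ => True) (fun _ => True)
  simpa [card_words] using h

theorem capped_zero_eq (n k i : ℕ) : capped n k i 0 = (words n k).filter fun l => ups l i = i := by
  ext l
  have := ups_le l i
  simp only [capped, Finset.mem_filter]
  exact and_congr_right fun _ => by omega

theorem card_capped_zero {n k i : ℕ} (hi : i ≤ n) (hk : i ≤ k) :
    (capped n k i 0).card = (n - i).choose (k - i) := by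
  rw [capped_zero_eq, card_ups_eq hi hk]
  simp

theorem card_capped_one_le {n k i : ℕ} (hi : i + 1 ≤ n) (hk : i ≤ k) :
    (capped n k (i + 1) 1).card ≤ (i + 1) * (n - i - 1).choose (k - i) +
      (if i + 1 ≤ k then (n - i - 1).choose (k - i - 1) else 0) := by
  have h1 : capped n k (i + 1) 1 ⊆ ((words n k).filter fun l => ups l (i + 1) = i) ∪
      ((words n k).filter fun l => ups l (i + 1) = i + 1) := by
    intro l hl
    have := ups_le l (i + 1)
    simp only [capped, Finset.mem_filter, Finset.mem_union] at hl ⊢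
    by_cases h : ups l (i + 1) = i
    · exact Or.inl ⟨hl.1, h⟩
    · exact Or.inr ⟨hl.1, by omega⟩
  refine (Finset.card_le_card h1).trans ((Finset.card_union_le _ _).trans ?_)
  rw [card_ups_eq hi hk, Nat.choose_succ_self_right, Nat.sub_sub]
  gcongr
  split_ifs with h
  · rw [card_ups_eq hi h]
    simp [Nat.sub_sub]
  · rw [Nat.le_zero, Finset.card_eq_zero, Finset.filter_eq_empty_iff]
    intro l hl h'
    have := ups_le_count l (i + 1)
    rw [(mem_words.1 hl).2] at this
    omega

/-- The words lost in one family because of a single word `d` of the other, which has more than `j`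
letters `false` among the first `t + j + j'` and does not pass the line `y = x + u + h`. The
lost words have `j'` letters `false` among the first `t`, then `j + j'` steps up, then `h + 1`
steps to the right, and from there on they do not pass the diagonal. -/
theorem card_add_loss_le {n k t j j' u h : ℕ} {d : List Bool} {S : Finset (List Bool)}
    (hu : u + j = t + j') (hjt : j' ≤ t) (hk : t + j ≤ k) (hn : t + j + j' + h + 1 ≤ n)
    (hd : ups d (t + j + j') + j + 1 ≤ t + j + j') (hdr : ¬ Reaches (u + h + 1) d)
    (hS : S ⊆ capped n k (t + j + j') j') (hm : ∀ b ∈ S, Meets t d b) :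
    S.card + t.choose j' * ((words (n - (t + j + j') - h - 1) (k - (t + j))).filter
      fun l => ¬ Reaches 1 l).card ≤ (capped n k (t + j + j') j').card := by
  set W := (words (n - (t + j + j') - h - 1) (k - (t + j))).filter fun l => ¬ Reaches 1 l with hW
  set f : List Bool × List Bool → List Bool := fun p =>
    p.1 ++ (List.replicate (j + j') true ++ (List.replicate (h + 1) false ++ p.2)) with hf
  have hfacts : ∀ p ∈ words t (t - j') ×ˢ W, ups (f p) t = t - j' ∧ ups (f p) (t + j + j') = t + j ∧
      ∀ s, ups (f p) (t + j + j' + h + 1 + s) = t + j + ups p.2 s := by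
    rintro ⟨p, w⟩ hp
    obtain ⟨hp, -⟩ := Finset.mem_product.1 hp
    obtain ⟨hp1, hp2⟩ := mem_words.1 hp
    obtain rfl : p.length = t := hp1
    simp only at hp2
    refine ⟨?_, ?_, fun s => ?_⟩
    · simp only [hf]
      rw [ups_append_of_le le_rfl, ups_of_length_le le_rfl, hp2]
    · simp only [hf]
      have e : j + j' = (List.replicate (j + j') true).length := by simp
      rw [add_assoc p.length, ups_append_add, hp2, ups_append_of_le (by simp),
        ups_of_length_le (by simp)]
      simp
      omega
    · simp only [hf]
      rw [show p.length + j + j' + h + 1 + s = p.length + (j + j' + (h + 1 + s)) by omega,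
        ups_append_add, hp2]
      have h1 := ups_append_add (List.replicate (j + j') true)
        (List.replicate (h + 1) false ++ w) (h + 1 + s)
      have h2 := ups_append_add (List.replicate (h + 1) false) w s
      simp only [List.length_replicate, List.count_replicate_self] at h1 h2
      rw [h1, h2]
      simp [List.count_replicate]
      omega
  have hinj : Set.InjOn f (words t (t - j') ×ˢ W : Finset _) := by
    rintro ⟨p, w⟩ hp ⟨p', w'⟩ hp' heq
    obtain ⟨hp, -⟩ := Finset.mem_product.1 hp
    obtain ⟨hp', -⟩ := Finset.mem_product.1 hp'
    have h1 : p.length = p'.length := (mem_words.1 hp).1.trans (mem_words.1 hp').1.symm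
    simp only [hf] at heq
    obtain ⟨h2, h3⟩ := List.append_inj heq h1
    have h4 := List.append_cancel_left (List.append_cancel_left h3)
    rw [h2, h4]
  have hcard : ((words t (t - j') ×ˢ W).image f).card = t.choose j' * W.card := by
    rw [Finset.card_image_of_injOn hinj, Finset.card_product, card_words, Nat.choose_symm hjt]
  rw [← hcard, ← Finset.card_union_of_disjoint]
  · apply Finset.card_le_card
    refine Finset.union_subset hS ?_
    intro l hl
    obtain ⟨p, hp, rfl⟩ := Finset.mem_image.1 hl
    obtain ⟨-, h2, -⟩ := hfacts p hp
    obtain ⟨hp1, hpw⟩ := Finset.mem_product.1 hp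
    obtain ⟨hp1, hp2⟩ := mem_words.1 hp1
    obtain ⟨hp3, hp4⟩ := mem_words.1 (Finset.mem_filter.1 hpw).1
    refine Finset.mem_filter.2 ⟨mem_words.2 ⟨?_, ?_⟩, by omega⟩
    · simp [hf]; omega
    · simp [hf, List.count_replicate]; omega
  · rw [Finset.disjoint_right]
    intro l hl hlS
    obtain ⟨p, hp, rfl⟩ := Finset.mem_image.1 hl
    obtain ⟨h1, h2, h3⟩ := hfacts p hp
    have hw : ∀ m, 2 * ups p.2 m ≤ m + 0 := by
      have := (Finset.mem_filter.1 (Finset.mem_product.1 hp).2).2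
      exact not_reaches_iff.1 this
    have hd' := not_reaches_iff.1 hdr
    obtain ⟨m, hm⟩ := hm _ hlS
    have hdm := ups_le d m
    have hbm := ups_le (f p) m
    -- The two walks fail to meet before time `t`, up to time `t + j + j'`, during the following
    -- `h + 1` steps to the right, and after them.
    rcases Nat.lt_or_ge m t with hmt | hmt
    · omega
    have g1 := ups_le_add (f p) hmt
    rcases Nat.lt_or_ge m (t + j + j') with hmi | hmi
    · have := ups_mono d hmi.le
      omega
    have g2 := ups_le_add d hmi
    rcases Nat.lt_or_ge m (t + j + j' + h + 1) with hmq | hmq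
    · have g3 := ups_mono (f p) hmq.le
      have g4 := h3 0
      rw [add_zero, ups_zero] at g4
      omega
    · obtain ⟨s, rfl⟩ := Nat.exists_eq_add_of_le hmq
      have g5 := h3 s
      have g6 := hw s
      have g7 := hd' (t + j + j' + h + 1 + s)
      omega

/-- The highest line met by all walks of a family. -/
theorem exists_level {n k : ℕ} {S : Finset (List Bool)} (hS : S ⊆ words n k) (hne : S.Nonempty) :
    ∃ u ≤ k, (∀ a ∈ S, Reaches u a) ∧ ∃ a ∈ S, ¬ Reaches (u + 1) a := by
  classical
  obtain ⟨a₀, ha₀⟩ := hne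
  have hbound : ∀ u, (∀ a ∈ S, Reaches u a) → u ≤ k := fun u hu => by
    have := (hu a₀ ha₀).le_count
    rwa [(mem_words.1 (hS ha₀)).2] at this
  have h0 : ∀ a ∈ S, Reaches 0 a := fun a _ => reaches_zero a
  set u := Nat.findGreatest (fun u => ∀ a ∈ S, Reaches u a) k with hu
  have h1 : ∀ a ∈ S, Reaches u a :=
    Nat.findGreatest_spec (P := fun u => ∀ a ∈ S, Reaches u a) (Nat.zero_le k) h0
  refine ⟨u, hbound u h1, h1, ?_⟩
  by_contra! h
  have := Nat.le_findGreatest (P := fun u => ∀ a ∈ S, Reaches u a) (hbound _ h) h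
  omega

/-- Either all words of `A` have at most `j` letters `false` among the first `t + j + j'`, or
the few exceptional ones cost many words of `B`. Here `u + h` is the highest line met by all
exceptional words; `h` is positive because the words that do not pass `y = x + u` touch it at time
`t + j + j'`. -/
theorem subset_capped_or_gain_loss {n k t j j' u : ℕ} {A B : Finset (List Bool)}
    (hA : A ⊆ words n k) (hAB : ∀ a ∈ A, ∀ b ∈ B, Meets t a b)
    (hu : u + j = t + j') (hjt : j' ≤ t) (hk : t + j ≤ k) (hn : j + j' + k + t + 1 ≤ n + u)
    (htouch : ∀ a ∈ A, ¬ Reaches (u + 1) a → ups a (t + j + j') + j = t + j + j') :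
    A ⊆ capped n k (t + j + j') j ∨ ∃ h, 1 ≤ h ∧ u + h ≤ k ∧
      (A \ capped n k (t + j + j') j).card ≤ n.choose (k - u - h) ∧
      (B ∩ capped n k (t + j + j') j').card +
        t.choose j' * ((words (n - (t + j + j') - h - 1) (k - (t + j))).filter
          fun l => ¬ Reaches 1 l).card ≤ (capped n k (t + j + j') j').card := by
  rcases Finset.eq_empty_or_nonempty (A \ capped n k (t + j + j') j) with he | hne
  · exact Or.inl (Finset.sdiff_eq_empty_iff_subset.1 he)
  · right
    obtain ⟨e, hek, he, d, hd, hde⟩ := exists_level (Finset.sdiff_subset.trans hA) hne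
    obtain ⟨hdA, hdc⟩ := Finset.mem_sdiff.1 hd
    have hdc' : ups d (t + j + j') + j < t + j + j' := by
      by_contra hcon
      exact hdc (Finset.mem_filter.2 ⟨hA hdA, by omega⟩)
    have hue : u + 1 ≤ e := by
      by_contra hcon
      have := htouch d hdA fun h => hde (h.mono (by omega))
      omega
    obtain ⟨h, rfl⟩ : ∃ h, e = u + h := ⟨e - u, by omega⟩
    refine ⟨h, by omega, hek, ?_, ?_⟩
    · have h1 : A \ capped n k (t + j + j') j ⊆ (words n k).filter (Reaches (u + h)) :=
        fun a ha => Finset.mem_filter.2 ⟨hA (Finset.mem_sdiff.1 ha).1, he a ha⟩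
      have h2 := (Finset.card_le_card h1).trans (card_reaches_le hek)
      rwa [Nat.sub_sub]
    · exact card_add_loss_le hu hjt hk (by omega) (by omega) hde Finset.inter_subset_right
        fun b hb => hAB d hdA b (Finset.mem_inter.1 hb).1

/-- The ballot numbers: walks to the point `(j, u + j)` that do not pass the line `y = x + u`. -/
theorem card_not_reaches_prefix_le (u j : ℕ) :
    (((words (u + 2 * j) (u + j)).filter fun l => ¬ Reaches (u + 1) l).card : ℝ) ≤
      ((u : ℝ) + 1) / (u + j + 1) * (u + 2 * j).choose j := by
  cases j with
  | zero =>
    have h : ((words u u).filter fun l => ¬ Reaches (u + 1) l).card ≤ 1 :=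
      (Finset.card_filter_le _ _).trans (by simp [card_words])
    have e : ((u : ℝ) + 1) / (u + (0 : ℕ) + 1) = 1 := by
      simp only [Nat.cast_zero, add_zero]
      exact div_self (by positivity)
    rw [e]
    simpa using h
  | succ j =>
    have h1 := card_not_reaches_add_le (n := u + 2 * (j + 1)) (k := u + (j + 1)) (u := u + 1)
      (by omega) (by omega)
    rw [show u + (j + 1) - (u + 1) = j by omega,
      Nat.choose_symm_of_eq_add (show u + 2 * (j + 1) = u + (j + 1) + (j + 1) by ring)] at h1
    have h2 := Nat.choose_succ_right_eq (u + 2 * (j + 1)) j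
    rw [show u + 2 * (j + 1) - j = u + j + 2 by omega] at h2
    generalize (u + 2 * (j + 1)).choose (j + 1) = c at *
    generalize (u + 2 * (j + 1)).choose j = c' at *
    generalize ((words (u + 2 * (j + 1)) (u + (j + 1))).filter
      fun l => ¬ Reaches (u + 1) l).card = x at *
    have h1' : (x : ℝ) + c' ≤ c := by exact_mod_cast h1
    have h2' : (c : ℝ) * (j + 1) = c' * (u + j + 2) := by exact_mod_cast h2
    push_cast
    rw [div_mul_eq_mul_div, le_div_iff₀ (by positivity)]
    have h3 : ((x : ℝ) + c') * (u + j + 2) ≤ c * (u + j + 2) := by gcongr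
    nlinarith

/-- Walks that touch the line `y = x + u` at `(j, u + j)` and do not pass it. -/
theorem card_le_touchBound {n k u j : ℕ} {S : Finset (List Bool)} (hS : S ⊆ words n k)
    (hk : u + j ≤ k) (hn : u + 2 * j ≤ n)
    (h : ∀ a ∈ S, ¬ Reaches (u + 1) a ∧ ups a (u + 2 * j) = u + j) :
    (S.card : ℝ) ≤ touchBound n k u j := by
  have h1 := card_filter_words_split hn hk (fun l => ¬ Reaches (u + 1) l) (fun _ => True)
  have h2 : S ⊆ (words n k).filter fun l => ups l (u + 2 * j) = u + j ∧
      ¬ Reaches (u + 1) (l.take (u + 2 * j)) ∧ True := by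
    intro a ha
    refine Finset.mem_filter.2 ⟨hS ha, (h a ha).2, ?_, trivial⟩
    rintro ⟨m, hm⟩
    rcases le_total m (u + 2 * j) with hmi | hmi
    · rw [ups_take hmi] at hm
      exact (h a ha).1 ⟨m, hm⟩
    · have h3 : ups (a.take (u + 2 * j)) m = ups a (u + 2 * j) :=
        ups_of_length_le (by simp; omega)
      rw [h3, (h a ha).2] at hm
      omega
  have h3 := Finset.card_le_card h2
  rw [h1] at h3
  simp only [Finset.filter_true, card_words] at h3
  have h4 := card_not_reaches_prefix_le u j
  unfold touchBound
  rw [Nat.sub_sub n, Nat.sub_sub k]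
  calc (S.card : ℝ) ≤ (((words (u + 2 * j) (u + j)).filter fun l => ¬ Reaches (u + 1) l).card : ℝ) *
        (n - (u + 2 * j)).choose (k - (u + j)) := by exact_mod_cast h3
    _ ≤ _ := by gcongr

/-! ### The theorem for families of walks -/

theorem mul_lt_sq_of_add_lt {a b g : ℕ} (h : a + b < 2 * g) : a * b < g ^ 2 := by
  zify at *
  nlinarith [sq_nonneg ((a : ℤ) - b)]

/-- The inequality of the two means, with weights `x` and `y`. -/
theorem mul_le_mul_of_add_le {a b x y : ℕ} (hx : 0 < x) (hy : 0 < y)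
    (h : a * y + b * x ≤ 2 * (x * y)) : a * b ≤ x * y := by
  have h1 : (a * y) * (b * x) ≤ (x * y) * (x * y) := by
    have h2 := Nat.mul_self_le_mul_self h
    generalize a * y = p at *
    generalize b * x = q at *
    zify at *
    nlinarith [sq_nonneg ((p : ℤ) - q)]
  refine Nat.le_of_mul_le_mul_right (c := x * y) ?_ (Nat.mul_pos hx hy)
  calc a * b * (x * y) = (a * y) * (b * x) := by ring
    _ ≤ _ := h1

section Exact

variable {n k t : ℕ} {A B : Finset (List Bool)}

/-- Comparison with the star with centre `[t]`. Summing this and its mirror image bounds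
`A.card + B.card`. -/
theorem subset_star_or_lt (ht : 14 ≤ t) (htk : t ≤ k) (hn : (t + 1) * k ≤ n)
    (hA : A ⊆ words n k) (hAB : ∀ a ∈ A, ∀ b ∈ B, Meets t a b)
    (htouch : ∀ a ∈ A, ¬ Reaches (t + 1) a → ups a t = t) :
    A ⊆ capped n k t 0 ∨
      (A \ capped n k t 0).card + (B ∩ capped n k t 0).card < (capped n k t 0).card := by
  have hkn : 15 * k ≤ n := le_trans (Nat.mul_le_mul_right _ (by omega)) hn
  rcases subset_capped_or_gain_loss (j := 0) (j' := 0) (u := t) hA hAB (by omega) (by omega)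
    (by omega) (by omega) htouch with h | ⟨h, hh, hk, h1, h2⟩
  · exact Or.inl h
  · right
    simp only [add_zero, Nat.choose_zero_right, one_mul] at h1 h2
    have h3 := gain_lt_loss_star ht hn hh hk
    have h4 := choose_le_two_mul_card_not_reaches (M := n - t - h - 1) (K := k - t) (by omega)
    omega

theorem mul_lt_or_eq_star (ht : 14 ≤ t) (htk : t ≤ k) (hn : (t + 1) * k ≤ n)
    (hA : A ⊆ words n k) (hB : B ⊆ words n k) (hAB : ∀ a ∈ A, ∀ b ∈ B, Meets t a b)
    (hta : ∀ a ∈ A, ¬ Reaches (t + 1) a → ups a t = t)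
    (htb : ∀ b ∈ B, ¬ Reaches (t + 1) b → ups b t = t) :
    A.card * B.card < (n - t).choose (k - t) ^ 2 ∨
      A = capped n k t 0 ∧ B = capped n k t 0 := by
  have hkn : 15 * k ≤ n := le_trans (Nat.mul_le_mul_right _ (by omega)) hn
  have h1 := subset_star_or_lt ht htk hn hA hAB hta
  have h2 := subset_star_or_lt ht htk hn hB (fun b hb a ha => (hAB a ha b hb).symm) htb
  rw [← card_capped_zero (by omega : t ≤ n) htk]
  have hAc := Finset.card_sdiff_add_card_inter A (capped n k t 0)
  have hBc := Finset.card_sdiff_add_card_inter B (capped n k t 0)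
  have hAi : (A ∩ capped n k t 0).card ≤ (capped n k t 0).card :=
    Finset.card_le_card Finset.inter_subset_right
  have hBi : (B ∩ capped n k t 0).card ≤ (capped n k t 0).card :=
    Finset.card_le_card Finset.inter_subset_right
  by_cases hs : A ⊆ capped n k t 0 ∧ B ⊆ capped n k t 0
  · by_cases he : A = capped n k t 0 ∧ B = capped n k t 0
    · exact Or.inr he
    · left
      apply mul_lt_sq_of_add_lt
      have h3 := Finset.card_le_card hs.1
      have h4 := Finset.card_le_card hs.2
      by_contra hcon
      exact he ⟨Finset.eq_of_subset_of_card_le hs.1 (by omega),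
        Finset.eq_of_subset_of_card_le hs.2 (by omega)⟩
  · left
    apply mul_lt_sq_of_add_lt
    rcases h1 with h1 | h1
    · rw [Finset.card_eq_zero.2 (Finset.sdiff_eq_empty_iff_subset.2 h1)] at hAc
      rcases h2 with h2 | h2
      · exact absurd ⟨h1, h2⟩ hs
      · omega
    · rcases h2 with h2 | h2
      · rw [Finset.card_eq_zero.2 (Finset.sdiff_eq_empty_iff_subset.2 h2)] at hBc
        omega
      · omega

/-- Comparison with the family `{F : |F ∩ [t + 2]| ≥ t + 1}`. -/
theorem card_sdiff_add_card_inter_le_second (ht : 14 ≤ t) (htk : t + 1 ≤ k) (hn : (t + 1) * k ≤ n)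
    (hA : A ⊆ words n k) (hAB : ∀ a ∈ A, ∀ b ∈ B, Meets t a b)
    (htouch : ∀ a ∈ A, ¬ Reaches (t + 1) a → ups a (t + 2) + 1 = t + 2) :
    (A \ capped n k (t + 2) 1).card + (B ∩ capped n k (t + 2) 1).card
      ≤ (capped n k (t + 2) 1).card := by
  have hkn : 15 * k ≤ n := le_trans (Nat.mul_le_mul_right _ (by omega)) hn
  rcases subset_capped_or_gain_loss (j := 1) (j' := 1) (u := t) hA hAB (by omega) (by omega)
    (by omega) (by omega) htouch with h | ⟨h, hh, hk, h1, h2⟩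
  · rw [Finset.card_eq_zero.2 (Finset.sdiff_eq_empty_iff_subset.2 h), zero_add]
    exact Finset.card_le_card Finset.inter_subset_right
  · simp only [add_assoc, Nat.reduceAdd, Nat.choose_one_right] at h1 h2
    have h3 := gain_lt_loss_second ht hn hh hk
    have h4 := choose_le_two_mul_card_not_reaches (M := n - (t + 2) - h - 1) (K := k - (t + 1))
      (by omega)
    rw [Nat.sub_sub k t 1] at h3
    have h5 : t * (n - (t + 2) - h - 1).choose (k - (t + 1)) ≤
      t * (2 * ((words (n - (t + 2) - h - 1) (k - (t + 1))).filter
        fun l => ¬ Reaches 1 l).card) := Nat.mul_le_mul_left _ h4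
    rw [mul_left_comm] at h5
    omega

theorem mul_lt_of_touch_second (ht : 14 ≤ t) (htk : t + 1 ≤ k) (hn : (t + 1) * k ≤ n)
    (hA : A ⊆ words n k) (hB : B ⊆ words n k) (hAB : ∀ a ∈ A, ∀ b ∈ B, Meets t a b)
    (hta : ∀ a ∈ A, ¬ Reaches (t + 1) a → ups a (t + 2) + 1 = t + 2)
    (htb : ∀ b ∈ B, ¬ Reaches (t + 1) b → ups b (t + 2) + 1 = t + 2) :
    A.card * B.card < (n - t).choose (k - t) ^ 2 := by
  have hkn : 15 * k ≤ n := le_trans (Nat.mul_le_mul_right _ (by omega)) hn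
  have h1 := card_sdiff_add_card_inter_le_second ht htk hn hA hAB hta
  have h2 := card_sdiff_add_card_inter_le_second ht htk hn hB
    (fun b hb a ha => (hAB a ha b hb).symm) htb
  have hAc := Finset.card_sdiff_add_card_inter A (capped n k (t + 2) 1)
  have hBc := Finset.card_sdiff_add_card_inter B (capped n k (t + 2) 1)
  have h3 := card_capped_one_le (n := n) (k := k) (i := t + 1) (by omega) htk
  have h4 := second_family_lt ht hn htk
  rw [show n - (t + 1) - 1 = n - t - 2 by omega, show k - (t + 1) = k - t - 1 by omega,
    show k - t - 1 - 1 = k - t - 2 by omega] at h3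
  simp only [add_assoc, Nat.reduceAdd] at h3
  apply mul_lt_sq_of_add_lt
  omega

/-- Levels `t - 1` and `t + 1` with common touching time `t + 1`: comparison with the families
`{F : |F ∩ [t + 1]| ≥ t}` and `{F : [t + 1] ⊆ F}`. -/
theorem mul_lt_of_adjacent_levels (ht : 14 ≤ t) (htk : t + 1 ≤ k) (hn : (t + 1) * k ≤ n)
    (hA : A ⊆ words n k) (hB : B ⊆ words n k) (hAB : ∀ a ∈ A, ∀ b ∈ B, Meets t a b)
    (hta : ∀ a ∈ A, ¬ Reaches (t - 1 + 1) a → ups a (t + 1) + 1 = t + 1)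
    (htb : ∀ b ∈ B, ¬ Reaches (t + 1 + 1) b → ups b (t + 1) = t + 1) :
    A.card * B.card < (n - t).choose (k - t) ^ 2 := by
  have hkn : 15 * k ≤ n := le_trans (Nat.mul_le_mul_right _ (by omega)) hn
  have hAc := Finset.card_sdiff_add_card_inter A (capped n k (t + 1) 1)
  have hBc := Finset.card_sdiff_add_card_inter B (capped n k (t + 1) 0)
  have hAi := Finset.card_le_card (Finset.inter_subset_right (s₁ := A) (s₂ := capped n k (t + 1) 1))
  have hBi := Finset.card_le_card (Finset.inter_subset_right (s₁ := B) (s₂ := capped n k (t + 1) 0))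
  have hGA := card_capped_one_le (n := n) (k := k) (i := t) (by omega) (by omega)
  rw [if_pos htk] at hGA
  have hGB := card_capped_zero (n := n) (k := k) (i := t + 1) (by omega) htk
  rw [← Nat.sub_sub, ← Nat.sub_sub] at hGB
  have hprod := adjacent_families_lt ht hn htk
  have hy : 0 < (n - t - 1).choose (k - t - 1) := Nat.choose_pos (by omega)
  have hx : 0 < (t + 1) * (n - t - 1).choose (k - t) + (n - t - 1).choose (k - t - 1) := by omega
  -- bounds for the two weighted sums of a gain and a remainder
  have hside1 : (A \ capped n k (t + 1) 1).card * (n - t - 1).choose (k - t - 1) +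
      (B ∩ capped n k (t + 1) 0).card *
        ((t + 1) * (n - t - 1).choose (k - t) + (n - t - 1).choose (k - t - 1)) ≤
      ((t + 1) * (n - t - 1).choose (k - t) + (n - t - 1).choose (k - t - 1)) *
        (n - t - 1).choose (k - t - 1) := by
    rcases subset_capped_or_gain_loss (j := 1) (j' := 0) (u := t - 1) hA hAB (by omega) (by omega)
      (by omega) (by omega) hta with h | ⟨h, hh, hk, h1, h2⟩
    · rw [add_zero] at h
      rw [Finset.card_eq_zero.2 (Finset.sdiff_eq_empty_iff_subset.2 h), zero_mul, zero_add,
        mul_comm]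
      exact Nat.mul_le_mul_left _ (hBi.trans hGB.le)
    · simp only [add_zero, Nat.choose_zero_right, one_mul] at h1 h2
      have h3 := gain_mul_lt_loss_mul ht hn hh htk (by omega)
      have h4 := choose_le_two_mul_card_not_reaches (M := n - (t + 1) - h - 1) (K := k - (t + 1))
        (by omega)
      rw [hGB] at h2
      rw [← Nat.sub_sub k] at h2 h4
      generalize (t + 1) * (n - t - 1).choose (k - t) + (n - t - 1).choose (k - t - 1) = x at *
      generalize (n - t - 1).choose (k - t - 1) = y at *
      have h5 := Nat.mul_le_mul_right y h1
      have h6 := Nat.mul_le_mul_right x h4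
      have h7 := Nat.mul_le_mul_right x h2
      nlinarith
  have hside2 : (B \ capped n k (t + 1) 0).card *
        ((t + 1) * (n - t - 1).choose (k - t) + (n - t - 1).choose (k - t - 1)) +
      (A ∩ capped n k (t + 1) 1).card * (n - t - 1).choose (k - t - 1) ≤
      ((t + 1) * (n - t - 1).choose (k - t) + (n - t - 1).choose (k - t - 1)) *
        (n - t - 1).choose (k - t - 1) := by
    rcases subset_capped_or_gain_loss (j := 0) (j' := 1) (u := t + 1) hB
      (fun b hb a ha => (hAB a ha b hb).symm) (by omega) (by omega)
      (by omega) (by omega) htb with h | ⟨h, hh, hk, h1, h2⟩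
    · rw [add_zero] at h
      rw [Finset.card_eq_zero.2 (Finset.sdiff_eq_empty_iff_subset.2 h), zero_mul, zero_add]
      exact Nat.mul_le_mul_right _ (hAi.trans hGA)
    · simp only [add_zero, Nat.choose_one_right] at h1 h2
      have h3 := gain_mul_lt_loss_mul' ht hn hh hk
      have h4 := choose_le_two_mul_card_not_reaches (M := n - (t + 1) - h - 1) (K := k - t)
        (by omega)
      have h2 := h2.trans hGA
      generalize (t + 1) * (n - t - 1).choose (k - t) + (n - t - 1).choose (k - t - 1) = x at *
      generalize (n - t - 1).choose (k - t - 1) = y at *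
      have h5 := Nat.mul_le_mul_right x h1
      have h6 := Nat.mul_le_mul_right y (Nat.mul_le_mul_left t h4)
      have h7 := Nat.mul_le_mul_right y h2
      nlinarith
  refine lt_of_le_of_lt (mul_le_mul_of_add_le hx hy ?_) hprod
  rw [← hAc, ← hBc]
  linarith

end Exact

theorem card_reaches_succ_le {n k u : ℕ} {S : Finset (List Bool)} (hS : S ⊆ words n k) :
    (S.filter (Reaches (u + 1))).card ≤ n.choose (k - u - 1) := by
  have h1 : (S.filter (Reaches (u + 1))).card ≤ ((words n k).filter (Reaches (u + 1))).card :=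
    Finset.card_le_card (Finset.filter_subset_filter _ hS)
  rcases Nat.lt_or_ge k (u + 1) with h | h
  · rw [card_reaches_eq_zero h] at h1
    omega
  · rw [Nat.sub_sub]
    exact h1.trans (card_reaches_le h)

/-- Walks that pass the line are fewer by a factor `t` than the reflection bound for walks that
meet it. -/
theorem card_reaches_succ_le_div {n k t u : ℕ} {S : Finset (List Bool)} (ht : 14 ≤ t)
    (hn : (t + 1) * k ≤ n) (hS : S ⊆ words n k) :
    ((S.filter (Reaches (u + 1))).card : ℝ) ≤ n.choose (k - u) / t := by
  have h0 : (0 : ℝ) < t := by exact_mod_cast (by omega : 0 < t)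
  rw [le_div_iff₀ h0]
  rcases Nat.lt_or_ge k (u + 1) with h | h
  · have h1 : (S.filter (Reaches (u + 1))).card ≤ ((words n k).filter (Reaches (u + 1))).card :=
      Finset.card_le_card (Finset.filter_subset_filter _ hS)
    rw [card_reaches_eq_zero h, Nat.le_zero] at h1
    rw [h1]
    simp
  · have h1 := card_reaches_succ_le (u := u) hS
    have h2 := mul_choose_sub_le hn h
    have h3 := (Nat.mul_le_mul_left t h1).trans h2
    rw [mul_comm]
    exact_mod_cast h3

/-- All walks that do not pass their lines touch them at the same time `i`, which determines the
configuration: three early ones are compared with explicit families, and for the others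
`touchBound` suffices. -/
theorem mul_lt_or_eq_star_of_touch {n k t u v i : ℕ} {A B : Finset (List Bool)} (ht : 14 ≤ t)
    (htk : t ≤ k) (hn : (t + 1) * k ≤ n) (hA : A ⊆ words n k) (hB : B ⊆ words n k)
    (hAB : ∀ a ∈ A, ∀ b ∈ B, Meets t a b) (huv : u + v = 2 * t) (hle : u ≤ v) (hv : v ≤ k)
    (hBv : ∀ b ∈ B, Reaches v b)
    (hta : ∀ a ∈ A, ¬ Reaches (u + 1) a → i + u = 2 * ups a i)
    (htb : ∀ b ∈ B, ¬ Reaches (v + 1) b → i + v = 2 * ups b i)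
    (hneA : ∃ a ∈ A, ¬ Reaches (u + 1) a) (hneB : ∃ b ∈ B, ¬ Reaches (v + 1) b) :
    A.card * B.card < (n - t).choose (k - t) ^ 2 ∨
      A = capped n k t 0 ∧ B = capped n k t 0 := by
  have hkn : 15 * k ≤ n := le_trans (Nat.mul_le_mul_right _ (by omega)) hn
  obtain ⟨j, j', hj, hj', hjk, hj'k⟩ : ∃ j j', i = u + 2 * j ∧ i = v + 2 * j' ∧ u + j ≤ k ∧
      v + j' ≤ k := by
    obtain ⟨a, ha, hau⟩ := hneA
    obtain ⟨b, hb, hbv⟩ := hneB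
    have h1 := hta a ha hau
    have h2 := htb b hb hbv
    have h3 := ups_le a i
    have h4 := ups_le b i
    have h5 := ups_le_count a i
    have h6 := ups_le_count b i
    rw [(mem_words.1 (hA ha)).2] at h5
    rw [(mem_words.1 (hB hb)).2] at h6
    exact ⟨i - ups a i, i - ups b i, by omega, by omega, by omega, by omega⟩
  have hi : i = t + j + j' := by omega
  have hA1 : ((A.filter fun a => ¬ Reaches (u + 1) a).card : ℝ) ≤ touchBound n k u j := by
    refine card_le_touchBound ((Finset.filter_subset _ _).trans hA) hjk (by omega) fun a ha => ?_
    obtain ⟨h1, h2⟩ := Finset.mem_filter.1 ha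
    have := hta a h1 h2
    rw [← hj]
    exact ⟨h2, by omega⟩
  have hB1 : ((B.filter fun b => ¬ Reaches (v + 1) b).card : ℝ) ≤ touchBound n k v j' := by
    refine card_le_touchBound ((Finset.filter_subset _ _).trans hB) hj'k (by omega) fun a ha => ?_
    obtain ⟨h1, h2⟩ := Finset.mem_filter.1 ha
    have := htb a h1 h2
    rw [← hj']
    exact ⟨h2, by omega⟩
  have hA2 := card_reaches_succ_le_div (u := u) ht hn hA
  have hB2 := card_reaches_succ_le_div (u := v) ht hn hB
  have hAc : (A.card : ℝ) = (A.filter fun a => ¬ Reaches (u + 1) a).card +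
      (A.filter (Reaches (u + 1))).card := by
    rw [add_comm]
    exact_mod_cast (Finset.card_filter_add_card_filter_not (s := A) (Reaches (u + 1))).symm
  have hBc : (B.card : ℝ) = (B.filter fun b => ¬ Reaches (v + 1) b).card +
      (B.filter (Reaches (v + 1))).card := by
    rw [add_comm]
    exact_mod_cast (Finset.card_filter_add_card_filter_not (s := B) (Reaches (v + 1))).symm
  have hA3 : (A.card : ℝ) ≤ touchBound n k u j + n.choose (k - u) / t := by
    rw [hAc]; exact add_le_add hA1 hA2
  have hB3 : (B.card : ℝ) ≤ touchBound n k v j' + n.choose (k - v) / t := by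
    rw [hBc]; exact add_le_add hB1 hB2
  have hcast : (A.card : ℝ) * B.card < ((n - t).choose (k - t) : ℝ) ^ 2 →
      A.card * B.card < (n - t).choose (k - t) ^ 2 := fun h => by exact_mod_cast h
  have hT := touchBound_nonneg n k u j
  rcases Nat.lt_or_ge (u + 1) t with hu2 | hu2
  · left
    apply hcast
    rcases Nat.lt_or_ge j 3 with hj3 | hj3
    · obtain ⟨rfl, rfl, rfl, rfl⟩ : u = t - 2 ∧ v = t + 2 ∧ j = 2 ∧ j' = 0 := by omega
      have h1 := distant_levels_lt ht hn (by omega)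
        (p := ((A.filter (Reaches (t - 2 + 1))).card : ℝ))
        (q := ((B.filter (Reaches (t + 2 + 1))).card : ℝ)) (Nat.cast_nonneg _) hA2
        (by exact_mod_cast card_reaches_succ_le (u := t - 2) hA) (Nat.cast_nonneg _) hB2
      refine lt_of_le_of_lt ?_ h1
      rw [hAc, hBc]
      exact mul_le_mul (add_le_add hA1 le_rfl) (add_le_add hB1 le_rfl)
        (add_nonneg (Nat.cast_nonneg _) (Nat.cast_nonneg _))
        (add_nonneg hT (Nat.cast_nonneg _))
    · have h1 := late_touch_lt ht htk hn huv (by omega) hv hj3 hjk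
      have hB4 : B.card ≤ n.choose (k - v) := by
        refine le_trans (Finset.card_le_card fun b hb => ?_) (card_reaches_le (n := n) hv)
        exact Finset.mem_filter.2 ⟨hB hb, hBv b hb⟩
      refine lt_of_le_of_lt ?_ h1
      gcongr
  rcases Nat.eq_or_lt_of_le (by omega : u ≤ t) with rfl | hut
  · obtain rfl : v = u := by omega
    obtain rfl : j' = j := by omega
    rcases Nat.lt_or_ge j' 2 with hj2 | hj2
    · obtain rfl | rfl : j' = 0 ∨ j' = 1 := by omega
      · obtain rfl : i = v := by omega
        exact mul_lt_or_eq_star ht htk hn hA hB hAB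
          (fun a ha h => by have := hta a ha h; omega)
          (fun b hb h => by have := htb b hb h; omega)
      · obtain rfl : i = v + 2 := by omega
        exact Or.inl (mul_lt_of_touch_second ht (by omega) hn hA hB hAB
          (fun a ha h => by have := hta a ha h; omega)
          (fun b hb h => by have := htb b hb h; omega))
    · left
      apply hcast
      refine lt_of_le_of_lt ?_ (equal_levels_lt ht htk hn hj2 hjk)
      gcongr
  · left
    obtain ⟨rfl, rfl, rfl⟩ : u = t - 1 ∧ v = t + 1 ∧ j = j' + 1 := by omega
    rcases Nat.eq_zero_or_pos j' with rfl | hj1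
    · obtain rfl : i = t + 1 := by omega
      exact mul_lt_of_adjacent_levels ht (by omega) hn hA hB hAB
        (fun a ha h => by have := hta a ha h; omega)
        (fun b hb h => by have := htb b hb h; omega)
    · apply hcast
      refine lt_of_le_of_lt ?_ (adjacent_levels_lt ht hn hj1 (by omega))
      gcongr

/-- If every walk of `A` that does not pass its line touches it twice, the product is small. -/
theorem mul_lt_of_touchesTwice {n k t u v : ℕ} {A B : Finset (List Bool)} (ht : 14 ≤ t)
    (htk : t ≤ k) (hn : (t + 1) * k ≤ n) (hA : A ⊆ words n k) (hB : B ⊆ words n k)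
    (huv : u + v = 2 * t) (hv : v ≤ k) (hBv : ∀ b ∈ B, Reaches v b)
    (htw : ∀ a ∈ A, ¬ Reaches (u + 1) a → TouchesTwice u a)
    (hneA : ∃ a ∈ A, ¬ Reaches (u + 1) a) :
    A.card * B.card < (n - t).choose (k - t) ^ 2 := by
  have hu : u + 1 ≤ k := by
    obtain ⟨a, ha, hau⟩ := hneA
    have := (htw a ha hau).lt_count
    rw [(mem_words.1 (hA ha)).2] at this
    exact this
  have hB4 : B.card ≤ n.choose (k - v) := by
    refine le_trans (Finset.card_le_card fun b hb => ?_) (card_reaches_le (n := n) hv)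
    exact Finset.mem_filter.2 ⟨hB hb, hBv b hb⟩
  have hA1 := card_reaches_succ_le (u := u) hA
  have hA2 : (A.filter fun a => ¬ Reaches (u + 1) a).card ≤ (n - 1).choose (k - u - 1) := by
    refine le_trans (Finset.card_le_card fun a ha => ?_) (card_touchesTwice_le (n := n) hu)
    obtain ⟨h1, h2⟩ := Finset.mem_filter.1 ha
    exact Finset.mem_filter.2 ⟨hA h1, htw a h1 h2⟩
  have hA3 : A.card ≤ n.choose (k - u - 1) + (n - 1).choose (k - u - 1) := by
    rw [← Finset.card_filter_add_card_filter_not (s := A) (Reaches (u + 1))]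
    exact add_le_add hA1 hA2
  have h := twice_mul_choose_lt ht htk hn huv hu hv
  have h' : (n.choose (k - u - 1) + (n - 1).choose (k - u - 1)) * n.choose (k - v) <
    (n - t).choose (k - t) ^ 2 := by exact_mod_cast h
  exact lt_of_le_of_lt (Nat.mul_le_mul hA3 hB4) h'

/-- The theorem for families of walks with the prefix form of the cross `t`-intersecting
property. -/
theorem mul_card_lt_or_eq_star {n k t : ℕ} {A B : Finset (List Bool)} (ht : 14 ≤ t)
    (htk : t ≤ k) (hn : (t + 1) * k ≤ n) (hA : A ⊆ words n k) (hB : B ⊆ words n k)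
    (hAB : ∀ a ∈ A, ∀ b ∈ B, Meets t a b) :
    A.card * B.card < (n - t).choose (k - t) ^ 2 ∨
      A = capped n k t 0 ∧ B = capped n k t 0 := by
  have hD : 0 < (n - t).choose (k - t) := by exact_mod_cast choose_sub_pos htk hn
  have hBA : ∀ b ∈ B, ∀ a ∈ A, Meets t b a := fun b hb a ha => (hAB a ha b hb).symm
  rcases A.eq_empty_or_nonempty with rfl | hAne
  · left; simpa using pow_pos hD 2
  rcases B.eq_empty_or_nonempty with rfl | hBne
  · left; simpa using pow_pos hD 2
  obtain ⟨u, huk, hAu, a₀, ha₀, ha₀u⟩ := exists_level hA hAne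
  obtain ⟨v, hvk, hBv, b₀, hb₀, hb₀v⟩ := exists_level hB hBne
  have key : ∀ a ∈ A, ¬ Reaches (u + 1) a → ∀ b ∈ B, ¬ Reaches (v + 1) b →
      ∃ m, m + t ≤ ups a m + ups b m ∧ 2 * ups a m ≤ m + u ∧ 2 * ups b m ≤ m + v := by
    intro a ha hau b hb hbv
    obtain ⟨m, hm⟩ := hAB a ha b hb
    exact ⟨m, hm, not_reaches_iff.1 hau m, not_reaches_iff.1 hbv m⟩
  have huv : 2 * t ≤ u + v := by
    obtain ⟨m, h1, h2, h3⟩ := key a₀ ha₀ ha₀u b₀ hb₀ hb₀v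
    omega
  rcases Nat.eq_or_lt_of_le huv with huv | huv
  · have huv := huv.symm
    have key' : ∀ a ∈ A, ¬ Reaches (u + 1) a → ∀ b ∈ B, ¬ Reaches (v + 1) b →
        ∃ m, m + u = 2 * ups a m ∧ m + v = 2 * ups b m := by
      intro a ha hau b hb hbv
      obtain ⟨m, h1, h2, h3⟩ := key a ha hau b hb hbv
      exact ⟨m, by omega, by omega⟩
    -- If neither family has all its non-passing walks touch twice, a walk `a₁` and a walk `b₁` that
    -- touch only once force the same touching time upon all others.
    by_cases hA2 : ∀ a ∈ A, ¬ Reaches (u + 1) a → TouchesTwice u a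
    · exact Or.inl (mul_lt_of_touchesTwice ht htk hn hA hB huv hvk hBv hA2 ⟨a₀, ha₀, ha₀u⟩)
    by_cases hB2 : ∀ b ∈ B, ¬ Reaches (v + 1) b → TouchesTwice v b
    · left
      rw [mul_comm]
      exact mul_lt_of_touchesTwice ht htk hn hB hA (by omega) huk hAu hB2 ⟨b₀, hb₀, hb₀v⟩
    push Not at hA2 hB2
    obtain ⟨a₁, ha₁, ha₁u, ha₁t⟩ := hA2
    obtain ⟨b₁, hb₁, hb₁v, hb₁t⟩ := hB2
    obtain ⟨i, hia, hib⟩ := key' a₁ ha₁ ha₁u b₁ hb₁ hb₁v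
    have once : ∀ {w : ℕ} {l : List Bool}, ¬ Reaches (w + 1) l → ¬ TouchesTwice w l →
        i + w = 2 * ups l i → ∀ m, m + w = 2 * ups l m → m = i := by
      intro w l h1 h2 h3 m hm
      by_contra hne
      refine h2 ⟨h1, ?_⟩
      rcases lt_or_gt_of_ne hne with h | h
      · exact ⟨m, i, h, hm, h3⟩
      · exact ⟨i, m, h, h3, hm⟩
    have hta : ∀ a ∈ A, ¬ Reaches (u + 1) a → i + u = 2 * ups a i := by
      intro a ha hau
      obtain ⟨m, h1, h2⟩ := key' a ha hau b₁ hb₁ hb₁v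
      obtain rfl := once hb₁v hb₁t hib m h2
      exact h1
    have htb : ∀ b ∈ B, ¬ Reaches (v + 1) b → i + v = 2 * ups b i := by
      intro b hb hbv
      obtain ⟨m, h1, h2⟩ := key' a₁ ha₁ ha₁u b hb hbv
      obtain rfl := once ha₁u ha₁t hia m h1
      exact h2
    rcases le_total u v with hle | hle
    · exact mul_lt_or_eq_star_of_touch ht htk hn hA hB hAB huv hle hvk hBv hta htb
        ⟨a₀, ha₀, ha₀u⟩ ⟨b₀, hb₀, hb₀v⟩
    · have := mul_lt_or_eq_star_of_touch ht htk hn hB hA hBA (by omega) hle huk hAu htb hta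
        ⟨b₀, hb₀, hb₀v⟩ ⟨a₀, ha₀, ha₀u⟩
      rw [mul_comm]
      exact this.imp_right And.symm
  · left
    have hA4 : ∀ u' ≤ u, A.card ≤ n.choose (k - u') := fun u' hu' => by
      refine le_trans (Finset.card_le_card fun b hb => ?_) (card_reaches_le (n := n) (hu'.trans huk))
      exact Finset.mem_filter.2 ⟨hA hb, (hAu b hb).mono hu'⟩
    have hB4 : ∀ v' ≤ v, B.card ≤ n.choose (k - v') := fun v' hv' => by
      refine le_trans (Finset.card_le_card fun b hb => ?_) (card_reaches_le (n := n) (hv'.trans hvk))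
      exact Finset.mem_filter.2 ⟨hB hb, (hBv b hb).mono hv'⟩
    obtain ⟨u', v', hu', hv', hs⟩ : ∃ u' v', u' ≤ u ∧ v' ≤ v ∧ u' + v' = 2 * t + 1 := by
      rcases le_total u (2 * t + 1) with h | h
      · exact ⟨u, 2 * t + 1 - u, le_rfl, by omega, by omega⟩
      · exact ⟨2 * t + 1, 0, h, Nat.zero_le _, rfl⟩
    refine lt_of_le_of_lt (Nat.mul_le_mul (hA4 u' hu') (hB4 v' hv')) ?_
    rcases le_total u' v' with h | h
    · have := choose_mul_choose_lt ht htk hn hs h (by omega)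
      exact_mod_cast this
    · have := choose_mul_choose_lt ht htk hn (by omega : v' + u' = 2 * t + 1) h (by omega)
      rw [mul_comm]
      exact_mod_cast this

/-! ### Characteristic words and shifting -/

section Encoding

variable {n : ℕ}

/-- The characteristic word of a set. -/
def charWord (F : Finset (Fin n)) : List Bool := List.ofFn fun x => decide (x ∈ F)

theorem charWord_injective : Function.Injective (charWord (n := n)) := by
  intro F G h
  have h1 := List.ofFn_injective h
  ext x
  simpa using congrFun h1 x

theorem ups_charWord (F : Finset (Fin n)) (m : ℕ) :
    ups (charWord F) m = (F.filter fun x : Fin n => (x : ℕ) < m).card := by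
  induction m with
  | zero => simp
  | succ m ih =>
    rw [ups, List.take_add_one, List.count_append, ← ups, ih, charWord, List.getElem?_ofFn]
    by_cases hm : m < n
    · rw [dif_pos hm]
      by_cases hF : (⟨m, hm⟩ : Fin n) ∈ F
      · have e : (F.filter fun x : Fin n => (x : ℕ) < m + 1) =
            insert ⟨m, hm⟩ (F.filter fun x : Fin n => (x : ℕ) < m) := by
          ext x
          simp only [Finset.mem_filter, Finset.mem_insert, Fin.ext_iff]
          constructor
          · rintro ⟨h1, h2⟩
            by_cases h3 : (x : ℕ) = m
            · exact Or.inl h3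
            · exact Or.inr ⟨h1, by omega⟩
          · rintro (h1 | ⟨h1, h2⟩)
            · have : x = ⟨m, hm⟩ := Fin.ext h1
              exact ⟨this ▸ hF, by omega⟩
            · exact ⟨h1, by omega⟩
        rw [e, Finset.card_insert_of_notMem (by simp)]
        simp [hF]
      · have e : (F.filter fun x : Fin n => (x : ℕ) < m + 1) =
            F.filter fun x : Fin n => (x : ℕ) < m := by
          ext x
          simp only [Finset.mem_filter]
          refine and_congr_right fun h1 => ?_
          have : (x : ℕ) ≠ m := fun h => hF (by
            have : x = ⟨m, hm⟩ := Fin.ext h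
            exact this ▸ h1)
          omega
        rw [e]
        simp [hF]
    · rw [dif_neg hm]
      have e : (F.filter fun x : Fin n => (x : ℕ) < m + 1) =
          F.filter fun x : Fin n => (x : ℕ) < m := by
        ext x
        have := x.2
        simp only [Finset.mem_filter]
        exact and_congr_right fun h1 => by omega
      rw [e]
      simp

theorem charWord_mem_words {F : Finset (Fin n)} {k : ℕ} :
    charWord F ∈ words n k ↔ F.card = k := by
  have h1 : (charWord F).length = n := by simp [charWord]
  have h2 := ups_charWord F n
  rw [ups_of_length_le h1.le, Finset.filter_true_of_mem fun x _ => x.2] at h2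
  rw [mem_words, h2]
  simp [h1]

theorem inter_initialSegment (F : Finset (Fin n)) (m : ℕ) :
    F ∩ initialSegment n m = F.filter fun x : Fin n => (x : ℕ) < m := by
  ext x
  simp [initialSegment]

theorem card_initialSegment {m : ℕ} (hm : m ≤ n) : (initialSegment n m).card = m := by
  rw [initialSegment, Fin.card_filter_val_lt, Nat.min_eq_right hm]

end Encoding

section Shifting

open UV

variable {n : ℕ} {i j : Fin n} {A B : Finset (Finset (Fin n))}

theorem compress_singleton_of_mem {F : Finset (Fin n)} (hj : j ∈ F) (hi : i ∉ F) :
    compress {i} {j} F = insert i (F.erase j) := by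
  have hij : i ≠ j := fun h => hi (h ▸ hj)
  rw [compress_of_disjoint_of_le (Finset.disjoint_singleton_left.2 hi)
    (Finset.singleton_subset_iff.2 hj)]
  ext x
  simp only [Finset.sup_eq_union, Finset.mem_sdiff, Finset.mem_union, Finset.mem_singleton,
    Finset.mem_insert, Finset.mem_erase]
  constructor
  · rintro ⟨h1 | h1, h2⟩
    · exact Or.inr ⟨h2, h1⟩
    · exact Or.inl h1
  · rintro (rfl | ⟨h1, h2⟩)
    · exact ⟨Or.inr rfl, hij⟩
    · exact ⟨Or.inl h2, h1⟩

theorem compress_singleton_of_not {F : Finset (Fin n)} (h : ¬ (j ∈ F ∧ i ∉ F)) :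
    compress {i} {j} F = F := by
  unfold compress
  rw [if_neg]
  rintro ⟨h1, h2⟩
  exact h ⟨Finset.singleton_subset_iff.1 h2, Finset.disjoint_singleton_left.1 h1⟩

/-- Membership in the `(i, j)`-shift of a family, which replaces `j` by `i`. -/
theorem mem_shift (hij : i ≠ j) {F : Finset (Fin n)} :
    F ∈ compression {i} {j} A ↔ (F ∈ A ∧ (j ∈ F → i ∉ F → insert i (F.erase j) ∈ A)) ∨
      (F ∉ A ∧ i ∈ F ∧ j ∉ F ∧ insert j (F.erase i) ∈ A) := by
  rw [mem_compression]
  refine or_congr ?_ ?_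
  · refine and_congr_right fun hF => ?_
    by_cases h : j ∈ F ∧ i ∉ F
    · rw [compress_singleton_of_mem h.1 h.2]
      exact ⟨fun h' _ _ => h', fun h' => h' h.1 h.2⟩
    · rw [compress_singleton_of_not h]
      exact ⟨fun _ h1 h2 => absurd ⟨h1, h2⟩ h, fun _ => hF⟩
  · refine and_congr_right fun hF => ?_
    constructor
    · rintro ⟨G, hG, hGF⟩
      by_cases h : j ∈ G ∧ i ∉ G
      · rw [compress_singleton_of_mem h.1 h.2] at hGF
        subst hGF
        refine ⟨Finset.mem_insert_self _ _, by simp [hij.symm], ?_⟩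
        rw [Finset.erase_insert (by simp [h.2]), Finset.insert_erase h.1]
        exact hG
      · rw [compress_singleton_of_not h] at hGF
        exact absurd (hGF ▸ hG) hF
    · rintro ⟨h1, h2, h3⟩
      refine ⟨_, h3, ?_⟩
      rw [compress_singleton_of_mem (Finset.mem_insert_self _ _) (by simp [hij]),
        Finset.erase_insert (by simp [h2]), Finset.insert_erase h1]

theorem compression_subset_powersetCard {k : ℕ} (hA : A ⊆ Finset.powersetCard k Finset.univ) :
    compression {i} {j} A ⊆ Finset.powersetCard k Finset.univ := by
  intro F hF
  rw [Finset.mem_powersetCard]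
  refine ⟨Finset.subset_univ _, ?_⟩
  rcases mem_compression.1 hF with ⟨h1, -⟩ | ⟨-, G, hG, rfl⟩
  · exact (Finset.mem_powersetCard.1 (hA h1)).2
  · rw [card_compress (by simp)]
    exact (Finset.mem_powersetCard.1 (hA hG)).2

theorem card_eq_card_sdiff_pair_add (hij : i ≠ j) (S : Finset (Fin n)) :
    S.card = (S \ {i, j}).card + ((if i ∈ S then 1 else 0) + (if j ∈ S then 1 else 0)) := by
  rw [← Finset.card_sdiff_add_card_inter S {i, j}]
  congr 1
  by_cases hi : i ∈ S <;> by_cases hj : j ∈ S <;>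
    simp [hi, hj, Finset.inter_insert_of_mem, Finset.inter_insert_of_notMem, hij]

/-- Shifting both families preserves the cross `t`-intersecting property. -/
theorem CrossIntersecting.shift {t : ℕ} (hij : i ≠ j) (h : CrossIntersecting t A B) :
    CrossIntersecting t (compression {i} {j} A) (compression {i} {j} B) := by
  intro S hS T hT
  have hsd : ∀ {F G : Finset (Fin n)} {x y : Fin n}, x ∈ ({i, j} : Finset (Fin n)) →
      y ∈ ({i, j} : Finset (Fin n)) → ((insert x (F.erase y)) ∩ G) \ {i, j} = (F ∩ G) \ {i, j} := by
    intro F G x y hx hy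
    ext z
    simp only [Finset.mem_insert, Finset.mem_singleton] at hx hy
    simp only [Finset.mem_sdiff, Finset.mem_inter, Finset.mem_insert, Finset.mem_erase,
      Finset.mem_singleton]
    constructor
    · rintro ⟨⟨h1 | h1, h2⟩, h3⟩
      · exact absurd (h1 ▸ hx) h3
      · exact ⟨⟨h1.2, h2⟩, h3⟩
    · rintro ⟨⟨h1, h2⟩, h3⟩
      exact ⟨⟨Or.inr ⟨fun h4 => h3 (h4 ▸ hy), h1⟩, h2⟩, h3⟩
  have hi : i ∈ ({i, j} : Finset (Fin n)) := by simp
  have hj : j ∈ ({i, j} : Finset (Fin n)) := by simp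
  rcases (mem_shift hij).1 hS with ⟨hS1, hS2⟩ | ⟨hS1, hS2, hS3, hS4⟩
  · rcases (mem_shift hij).1 hT with ⟨hT1, hT2⟩ | ⟨hT1, hT2, hT3, hT4⟩
    · exact h S hS1 T hT1
    · by_cases hc : j ∈ S ∧ i ∉ S
      · have h1 := h _ (hS2 hc.1 hc.2) _ hT4
        rw [card_eq_card_sdiff_pair_add hij, hsd hi hj, Finset.inter_comm S, hsd hj hi,
          Finset.inter_comm T] at h1
        rw [card_eq_card_sdiff_pair_add hij]
        simp [hij, hij.symm] at h1
        omega
      · have h1 := h _ hS1 _ hT4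
        rw [Finset.inter_comm, card_eq_card_sdiff_pair_add hij, hsd hj hi,
          Finset.inter_comm T] at h1
        rw [card_eq_card_sdiff_pair_add hij]
        by_cases h2 : j ∈ S <;> by_cases h3 : i ∈ S <;> (simp_all; try omega)
  · rcases (mem_shift hij).1 hT with ⟨hT1, hT2⟩ | ⟨hT1, hT2, hT3, hT4⟩
    · by_cases hc : j ∈ T ∧ i ∉ T
      · have h1 := h _ hS4 _ (hT2 hc.1 hc.2)
        rw [card_eq_card_sdiff_pair_add hij, hsd hj hi, Finset.inter_comm S, hsd hi hj,
          Finset.inter_comm T] at h1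
        rw [card_eq_card_sdiff_pair_add hij]
        simp [hij, hij.symm] at h1
        omega
      · have h1 := h _ hS4 _ hT1
        rw [card_eq_card_sdiff_pair_add hij, hsd hj hi] at h1
        rw [card_eq_card_sdiff_pair_add hij]
        by_cases h2 : j ∈ T <;> by_cases h3 : i ∈ T <;> (simp_all; try omega)
    · have h1 := h _ hS4 _ hT4
      rw [card_eq_card_sdiff_pair_add hij, hsd hj hi, Finset.inter_comm S, hsd hj hi,
        Finset.inter_comm T] at h1
      rw [card_eq_card_sdiff_pair_add hij]
      simp [hij, hij.symm] at h1
      simp [hS2, hT2, hS3]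
      omega

/-- The sum of all elements of all members of a family; a shift towards smaller elements that
changes the family decreases it. -/
def familyWeight (A : Finset (Finset (Fin n))) : ℕ := ∑ F ∈ A, ∑ x ∈ F, (x : ℕ)

theorem familyWeight_compression_lt (hij : i < j) (hA : compression {i} {j} A ≠ A) :
    familyWeight (compression {i} {j} A) < familyWeight A := by
  rw [compression] at hA ⊢
  have uA : A.filter (fun F => compress {i} {j} F ∈ A) ∪
      A.filter (fun F => compress {i} {j} F ∉ A) = A :=
    Finset.filter_union_filter_not_eq _ _
  have ne₂ : (A.filter fun F => compress {i} {j} F ∉ A).Nonempty := by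
    by_contra hcon
    rw [Finset.not_nonempty_iff_eq_empty] at hcon
    rw [Finset.filter_image, hcon, Finset.image_empty, Finset.union_empty] at hA
    rw [hcon, Finset.union_empty] at uA
    exact hA uA
  rw [familyWeight, familyWeight, Finset.sum_union compress_disjoint]
  conv_rhs => rw [← uA]
  rw [Finset.sum_union (Finset.disjoint_filter_filter_not _ _ _), add_lt_add_iff_left,
    Finset.filter_image, Finset.sum_image compress_injOn]
  refine Finset.sum_lt_sum_of_nonempty ne₂ fun F hF => ?_
  obtain ⟨hFA, hF⟩ := Finset.mem_filter.1 hF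
  by_cases h : j ∈ F ∧ i ∉ F
  · rw [compress_singleton_of_mem h.1 h.2, Finset.sum_insert (by simp [h.2]),
      ← Finset.add_sum_erase F (fun x => (x : ℕ)) h.1]
    have : (i : ℕ) < j := hij
    omega
  · rw [compress_singleton_of_not h] at hF
    exact absurd hFA hF

theorem familyWeight_compression_le (hij : i < j) :
    familyWeight (compression {i} {j} A) ≤ familyWeight A := by
  by_cases h : compression {i} {j} A = A
  · rw [h]
  · exact (familyWeight_compression_lt hij h).le

/-- Frankl's prefix criterion: if `A` is shifted, the cross `t`-intersecting property passes to a
prefix. In a counterexample with `|S ∩ T|` minimal, the `t`-th common element of `S` and `T` could be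
replaced in `S` by a smaller element that lies in neither set. -/
theorem CrossIntersecting.meets {t : ℕ} (ht : 0 < t) (h : CrossIntersecting t A B)
    (hA : ∀ i j : Fin n, i < j → compression {i} {j} A = A) :
    ∀ S ∈ A, ∀ T ∈ B, Meets t (charWord S) (charWord T) := by
  intro S hS T hT
  induction hc : (S ∩ T).card using Nat.strong_induction_on generalizing S with
  | _ c ih =>
    subst hc
    by_contra hcon
    have hcon' : ∀ m, (S.filter fun x : Fin n => (x : ℕ) < m).card +
        (T.filter fun x : Fin n => (x : ℕ) < m).card < m + t := by
      intro m
      by_contra hm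
      refine hcon ⟨m, ?_⟩
      rw [ups_charWord, ups_charWord]
      omega
    -- `m` is minimal such that `S` and `T` have `t` common elements below `m + 1`
    obtain ⟨m, hm1, hm2⟩ : ∃ m, t ≤ ((S ∩ T).filter fun x : Fin n => (x : ℕ) < m + 1).card ∧
        ((S ∩ T).filter fun x : Fin n => (x : ℕ) < m).card < t := by
      have hex : ∃ m, t ≤ ((S ∩ T).filter fun x : Fin n => (x : ℕ) < m).card :=
        ⟨n, by rw [Finset.filter_true_of_mem fun x _ => x.2]; exact h S hS T hT⟩
      have h0 : Nat.find hex ≠ 0 := by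
        intro h0
        have := Nat.find_spec hex
        rw [h0] at this
        simp at this
        omega
      obtain ⟨m, hm⟩ := Nat.exists_eq_succ_of_ne_zero h0
      refine ⟨m, ?_, ?_⟩
      · have := Nat.find_spec hex
        rwa [hm] at this
      · have := Nat.find_min hex (m := m) (by omega)
        omega
    have hy : ∃ y ∈ S ∩ T, (y : ℕ) = m := by
      by_contra hne
      push Not at hne
      have : ((S ∩ T).filter fun x : Fin n => (x : ℕ) < m + 1) =
          (S ∩ T).filter fun x : Fin n => (x : ℕ) < m :=
        Finset.filter_congr fun x hx => by have := hne x hx; omega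
      rw [this] at hm1
      omega
    obtain ⟨y, hyST, hym⟩ := hy
    obtain ⟨hyS, hyT⟩ := Finset.mem_inter.1 hyST
    have hsum : ∀ (X : Finset (Fin n)) m, (X.filter fun x : Fin n => (x : ℕ) < m).card +
        (T.filter fun x : Fin n => (x : ℕ) < m).card = ((X ∪ T).filter fun x : Fin n => (x : ℕ) < m).card +
        ((X ∩ T).filter fun x : Fin n => (x : ℕ) < m).card := by
      intro X m
      rw [Finset.filter_union, Finset.filter_inter_distrib, Finset.card_union_add_card_inter]
    have hle : ∀ (X : Finset (Fin n)) m, (X.filter fun x : Fin n => (x : ℕ) < m).card ≤ m := by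
      intro X m
      rw [← ups_charWord]
      exact ups_le _ _
    have hx : ∃ x : Fin n, (x : ℕ) < m + 1 ∧ x ∉ S ∪ T := by
      by_contra hne
      push Not at hne
      have h1 : initialSegment n (m + 1) ⊆ (S ∪ T).filter fun x : Fin n => (x : ℕ) < m + 1 := by
        intro x hx
        have hx := (Finset.mem_filter.1 hx).2
        exact Finset.mem_filter.2 ⟨hne x hx, hx⟩
      have h2 := Finset.card_le_card h1
      rw [card_initialSegment (by have := y.2; omega)] at h2
      have h3 := hsum S (m + 1)
      have h4 := hcon' (m + 1)
      omega
    obtain ⟨x, hxm, hxST⟩ := hx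
    rw [Finset.mem_union, not_or] at hxST
    have hxy : x ≠ y := fun h => hxST.1 (h ▸ hyS)
    have hlt : x < y := by
      rw [Fin.lt_def]
      have : (x : ℕ) ≠ y := fun h => hxy (Fin.ext h)
      omega
    have hS' : insert x (S.erase y) ∈ A := by
      have h1 := compress_mem_compression (u := {x}) (v := {y}) hS
      rwa [hA x y hlt, compress_singleton_of_mem hyS hxST.1] at h1
    have hST' : insert x (S.erase y) ∩ T = (S ∩ T).erase y := by
      rw [Finset.insert_inter_of_notMem hxST.2, Finset.erase_inter]
    have hcard : (insert x (S.erase y) ∩ T).card < (S ∩ T).card := by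
      rw [hST']
      exact Finset.card_erase_lt_of_mem hyST
    obtain ⟨m', hm'⟩ := ih _ hcard _ hS' rfl
    rw [ups_charWord, ups_charWord] at hm'
    rcases Nat.lt_or_ge m m' with hmm | hmm
    · have h1 : ((insert x (S.erase y)).filter fun x : Fin n => (x : ℕ) < m').card ≤
          (S.filter fun x : Fin n => (x : ℕ) < m').card := by
        rw [Finset.filter_insert, Finset.filter_erase, if_pos (by omega)]
        refine (Finset.card_insert_le _ _).trans ?_
        rw [Finset.card_erase_add_one]
        exact Finset.mem_filter.2 ⟨hyS, by omega⟩
      have := hcon' m'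
      omega
    · have h1 := hsum (insert x (S.erase y)) m'
      have h2 := hle (insert x (S.erase y) ∪ T) m'
      have h3 : ((insert x (S.erase y) ∩ T).filter fun x : Fin n => (x : ℕ) < m').card ≤
          ((S ∩ T).filter fun x : Fin n => (x : ℕ) < m).card := by
        rw [hST']
        apply Finset.card_le_card
        intro z hz
        obtain ⟨hz1, hz2⟩ := Finset.mem_filter.1 hz
        exact Finset.mem_filter.2 ⟨Finset.mem_of_mem_erase hz1, by omega⟩
      omega

end Shifting

/-! ### Stars and the theorem for families of sets -/

section Stars

open UV

variable {n k : ℕ} {A B : Finset (Finset (Fin n))}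

/-- The star with centre `T`: all `k`-subsets of `[n]` that contain `T`. -/
def starFamily (n k : ℕ) (T : Finset (Fin n)) : Finset (Finset (Fin n)) :=
  (Finset.powersetCard k Finset.univ).filter fun F => T ⊆ F

theorem mem_starFamily {T F : Finset (Fin n)} : F ∈ starFamily n k T ↔ F.card = k ∧ T ⊆ F := by
  simp [starFamily]

theorem card_starFamily {T : Finset (Fin n)} (hT : T.card ≤ k) :
    (starFamily n k T).card = (n - T.card).choose (k - T.card) := by
  have h : starFamily n k T = (Finset.powersetCard (k - T.card) Tᶜ).image fun E => T ∪ E := by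
    ext F
    rw [mem_starFamily, Finset.mem_image]
    constructor
    · rintro ⟨h1, h2⟩
      refine ⟨F \ T, Finset.mem_powersetCard.2 ⟨?_, ?_⟩, Finset.union_sdiff_of_subset h2⟩
      · intro x hx
        exact Finset.mem_compl.2 (Finset.mem_sdiff.1 hx).2
      · rw [Finset.card_sdiff_of_subset h2, h1]
    · rintro ⟨E, hE, rfl⟩
      obtain ⟨h1, h2⟩ := Finset.mem_powersetCard.1 hE
      have hd : Disjoint T E := (Finset.subset_compl_iff_disjoint_left).1 h1
      exact ⟨by rw [Finset.card_union_of_disjoint hd, h2]; omega, Finset.subset_union_left⟩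
  rw [h, Finset.card_image_of_injOn, Finset.card_powersetCard, Finset.card_compl,
    Fintype.card_fin]
  intro E hE E' hE' heq
  have hd : ∀ {X : Finset (Fin n)}, X ∈ Finset.powersetCard (k - T.card) Tᶜ → (T ∪ X) \ T = X := by
    intro X hX
    have h1 := (Finset.mem_powersetCard.1 hX).1
    have hd : Disjoint T X := (Finset.subset_compl_iff_disjoint_left).1 h1
    rw [Finset.union_sdiff_left, Finset.sdiff_eq_self_of_disjoint hd.symm]
  rw [← hd hE, ← hd hE']
  simp only at heq
  rw [heq]

theorem exists_disjoint_of_card_le {X : Finset (Fin n)} {r : ℕ} (h : X.card + r ≤ n) :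
    ∃ E : Finset (Fin n), E.card = r ∧ Disjoint E X := by
  obtain ⟨E, hE, hc⟩ := Finset.exists_subset_card_eq (s := Xᶜ) (n := r)
    (by rw [Finset.card_compl, Fintype.card_fin]; omega)
  exact ⟨E, hc, (Finset.subset_compl_iff_disjoint_right).1 hE⟩

/-- A family that is cross `t`-intersecting with a star lies in the star. -/
theorem subset_of_cross_star {t : ℕ} (hn : 2 * k ≤ n)
    (hB : B ⊆ Finset.powersetCard k Finset.univ) {T : Finset (Fin n)} (hT : T.card = t)
    (htk : t ≤ k) (h : CrossIntersecting t (starFamily n k T) B) : B ⊆ starFamily n k T := by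
  intro H hH
  have hHk := (Finset.mem_powersetCard.1 (hB hH)).2
  refine mem_starFamily.2 ⟨hHk, ?_⟩
  by_contra hTH
  obtain ⟨x, hxT, hxH⟩ := Finset.not_subset.1 hTH
  have hcard : (H ∪ T).card ≤ k + t := by
    rw [← hHk, ← hT]; exact Finset.card_union_le _ _
  obtain ⟨E, hE, hd⟩ := exists_disjoint_of_card_le (X := H ∪ T) (r := k - t) (by omega)
  rw [Finset.disjoint_union_right] at hd
  have h1 := h (T ∪ E) (mem_starFamily.2 ⟨by
    rw [Finset.card_union_of_disjoint hd.2.symm, hE, hT]; omega, Finset.subset_union_left⟩) H hH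
  rw [Finset.union_inter_distrib_right, Finset.disjoint_iff_inter_eq_empty.1 hd.1,
    Finset.union_empty] at h1
  have h2 : (T ∩ H).card < T.card := Finset.card_lt_card ⟨Finset.inter_subset_left, fun h3 =>
    hxH (Finset.mem_inter.1 (h3 hxT)).2⟩
  omega

/-- If shifting turns `A` and `B` into the same star, both were one star before, possibly with
another centre. The main case is that of `i ∈ T` and `j ∉ T`: a member `G₀` of `A`
that misses `T` forces many sets `T' ∪ E` into `B`, where `T'` is `T` with `i` replaced by `j`, and
these force all of `A` into the star with centre `T'`. -/
theorem exists_star_of_compression {t : ℕ} (hn : 4 * k ≤ n) (ht : 0 < t) (htk : t ≤ k)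
    (hA : A ⊆ Finset.powersetCard k Finset.univ) (hB : B ⊆ Finset.powersetCard k Finset.univ)
    (hAB : CrossIntersecting t A B) {i j : Fin n} (hij : i ≠ j) {T : Finset (Fin n)}
    (hT : T.card = t) (hSA : compression {i} {j} A = starFamily n k T)
    (hSB : compression {i} {j} B = starFamily n k T) :
    ∃ T' : Finset (Fin n), T'.card = t ∧ A = starFamily n k T' ∧ B = starFamily n k T' := by
  have hBA : CrossIntersecting t B A := fun S hS T hT => by
    rw [Finset.inter_comm]; exact hAB T hT S hS
  have hcA : A.card = (starFamily n k T).card := by rw [← hSA, card_compression]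
  have hcB : B.card = (starFamily n k T).card := by rw [← hSB, card_compression]
  by_cases hcase : i ∈ T ∧ j ∉ T
  · obtain ⟨hi, hj⟩ := hcase
    set T' := insert j (T.erase i) with hT'
    have hT'c : T'.card = t := by
      rw [hT', Finset.card_insert_of_notMem (by simp [hj]), Finset.card_erase_of_mem hi]
      omega
    have hcT : (starFamily n k T).card = (starFamily n k T').card := by
      rw [card_starFamily (by omega), card_starFamily (by omega), hT, hT'c]
    -- a member of either family that misses `T` comes from the other star
    have hmem : ∀ {C : Finset (Finset (Fin n))}, C ⊆ Finset.powersetCard k Finset.univ →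
        compression {i} {j} C = starFamily n k T → ∀ G ∈ C, ¬ T ⊆ G → T' ⊆ G ∧ i ∉ G := by
      intro C hC hSC G hG hTG
      have h1 := compress_mem_compression (u := {i}) (v := {j}) hG
      rw [hSC] at h1
      by_cases h : j ∈ G ∧ i ∉ G
      · rw [compress_singleton_of_mem h.1 h.2] at h1
        refine ⟨?_, h.2⟩
        have h2 := (mem_starFamily.1 h1).2
        refine Finset.insert_subset h.1 fun x hx => ?_
        obtain ⟨hxi, hxT⟩ := Finset.mem_erase.1 hx
        rcases Finset.mem_insert.1 (h2 hxT) with h3 | h3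
        · exact absurd h3 hxi
        · exact Finset.mem_of_mem_erase h3
      · rw [compress_singleton_of_not h] at h1
        exact absurd (mem_starFamily.1 h1).2 hTG
    by_cases hAT : A ⊆ starFamily n k T
    · have hAe : A = starFamily n k T := Finset.eq_of_subset_of_card_le hAT hcA.ge
      have hBT := subset_of_cross_star (by omega) hB hT htk (hAe ▸ hAB)
      exact ⟨T, hT, hAe, Finset.eq_of_subset_of_card_le hBT hcB.ge⟩
    · obtain ⟨G₀, hG₀, hG₀T⟩ := Finset.not_subset.1 hAT
      have hG₀k := (Finset.mem_powersetCard.1 (hA hG₀)).2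
      have hTG₀ : ¬ T ⊆ G₀ := fun h => hG₀T (mem_starFamily.2 ⟨hG₀k, h⟩)
      obtain ⟨hG₀T', hG₀i⟩ := hmem hA hSA G₀ hG₀ hTG₀
      have hTerase : (T.erase i).card < t := by
        rw [Finset.card_erase_of_mem hi]; omega
      -- all sets `T' ∪ E` with `E` disjoint from `G₀` belong to `B`
      have hBmem : ∀ E : Finset (Fin n), E.card = k - t → Disjoint E (G₀ ∪ insert j T) →
          T' ∪ E ∈ B := by
        intro E hE hd
        rw [Finset.disjoint_union_right, Finset.disjoint_insert_right] at hd
        obtain ⟨hd1, hd2, hd3⟩ := hd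
        have h1 : T ∪ E ∈ compression {i} {j} B := by
          rw [hSB, mem_starFamily]
          exact ⟨by rw [Finset.card_union_of_disjoint hd3.symm, hE, hT]; omega,
            Finset.subset_union_left⟩
        have hiE : i ∉ E := fun h => Finset.disjoint_left.1 hd3 h hi
        rcases (mem_shift hij).1 h1 with ⟨h2, -⟩ | ⟨-, -, -, h2⟩
        · exfalso
          have h3 := hAB G₀ hG₀ _ h2
          have h4 : G₀ ∩ (T ∪ E) ⊆ T.erase i := by
            intro x hx
            obtain ⟨hx1, hx2⟩ := Finset.mem_inter.1 hx
            rcases Finset.mem_union.1 hx2 with hx2 | hx2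
            · exact Finset.mem_erase.2 ⟨fun h => hG₀i (h ▸ hx1), hx2⟩
            · exact absurd hx1 (Finset.disjoint_left.1 hd1 hx2)
          have := Finset.card_le_card h4
          omega
        · rwa [Finset.erase_union_distrib, Finset.erase_eq_of_notMem hiE,
            ← Finset.insert_union] at h2
      have hAT' : A ⊆ starFamily n k T' := by
        intro G hG
        have hGk := (Finset.mem_powersetCard.1 (hA hG)).2
        refine mem_starFamily.2 ⟨hGk, ?_⟩
        by_cases hTG : T ⊆ G
        · have hjG : j ∈ G := by
            by_contra hjG
            have hX : (G ∪ (G₀ ∪ insert j T)).card ≤ k + (k + (t + 1)) := by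
              refine (Finset.card_union_le _ _).trans (add_le_add hGk.le ?_)
              refine (Finset.card_union_le _ _).trans (add_le_add hG₀k.le ?_)
              rw [← hT]; exact Finset.card_insert_le _ _
            obtain ⟨E, hE, hd⟩ := exists_disjoint_of_card_le (X := G ∪ (G₀ ∪ insert j T))
              (r := k - t) (by omega)
            rw [Finset.disjoint_union_right] at hd
            have h1 := hAB G hG _ (hBmem E hE hd.2)
            have h2 : G ∩ (T' ∪ E) ⊆ T.erase i := by
              intro x hx
              obtain ⟨hx1, hx2⟩ := Finset.mem_inter.1 hx
              rcases Finset.mem_union.1 hx2 with hx2 | hx2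
              · rcases Finset.mem_insert.1 hx2 with hx2 | hx2
                · exact absurd (hx2 ▸ hx1) hjG
                · exact hx2
              · exact absurd hx1 (Finset.disjoint_left.1 hd.1 hx2)
            have := Finset.card_le_card h2
            omega
          exact Finset.insert_subset hjG ((Finset.erase_subset _ _).trans hTG)
        · exact (hmem hA hSA G hG hTG).1
      have hAe : A = starFamily n k T' :=
        Finset.eq_of_subset_of_card_le hAT' (by rw [hcA, hcT])
      have hBT := subset_of_cross_star (by omega) hB hT'c htk (hAe ▸ hAB)
      exact ⟨T', hT'c, hAe, Finset.eq_of_subset_of_card_le hBT (by rw [hcB, hcT])⟩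
  · -- in this case the shift fixes the families
    have hfix : ∀ {C : Finset (Finset (Fin n))}, compression {i} {j} C = starFamily n k T →
        starFamily n k T ⊆ C := by
      intro C hSC F hF
      rw [← hSC] at hF
      rcases (mem_shift hij).1 hF with ⟨h1, -⟩ | ⟨h1, hiF, hjF, h2⟩
      · exact h1
      · exfalso
        rw [hSC] at hF
        obtain ⟨hFk, hTF⟩ := mem_starFamily.1 hF
        have hjT : j ∉ T := fun h => hjF (hTF h)
        have hiT : i ∉ T := fun h => hcase ⟨h, hjT⟩
        have h3 : insert j (F.erase i) ∈ compression {i} {j} C := by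
          rw [hSC, mem_starFamily]
          refine ⟨?_, fun x hx => ?_⟩
          · have := Finset.card_pos.2 ⟨i, hiF⟩
            rw [Finset.card_insert_of_notMem (by simp [hjF]), Finset.card_erase_of_mem hiF, hFk]
            omega
          · exact Finset.mem_insert_of_mem
              (Finset.mem_erase.2 ⟨fun h => hiT (h ▸ hx), hTF hx⟩)
        rcases (mem_shift hij).1 h3 with ⟨-, h4⟩ | ⟨h4, -⟩
        · have h5 := h4 (Finset.mem_insert_self _ _) (by simp [hij])
          rw [Finset.erase_insert (by simp [hjF]), Finset.insert_erase hiF] at h5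
          exact h1 h5
        · exact h4 h2
    exact ⟨T, hT, (Finset.eq_of_subset_of_card_le (hfix hSA) hcA.le).symm,
      (Finset.eq_of_subset_of_card_le (hfix hSB) hcB.le).symm⟩

end Stars

/-- The theorem for shifted families. -/
theorem mul_card_lt_or_eq_starFamily_of_shifted {n k t : ℕ} {A B : Finset (Finset (Fin n))}
    (ht : 14 ≤ t) (htk : t ≤ k) (hn : (t + 1) * k ≤ n)
    (hA : A ⊆ Finset.powersetCard k Finset.univ) (hB : B ⊆ Finset.powersetCard k Finset.univ)
    (hAB : CrossIntersecting t A B)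
    (hsh : ∀ i j : Fin n, i < j → UV.compression {i} {j} A = A) :
    A.card * B.card < (n - t).choose (k - t) ^ 2 ∨
      ∃ T : Finset (Fin n), T.card = t ∧ A = starFamily n k T ∧ B = starFamily n k T := by
  have hkn : 15 * k ≤ n := le_trans (Nat.mul_le_mul_right _ (by omega)) hn
  have hm := hAB.meets (by omega) hsh
  have himage : ∀ {C : Finset (Finset (Fin n))}, C ⊆ Finset.powersetCard k Finset.univ →
      C.image charWord ⊆ words n k := by
    intro C hC l hl
    obtain ⟨F, hF, rfl⟩ := Finset.mem_image.1 hl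
    exact charWord_mem_words.2 (Finset.mem_powersetCard.1 (hC hF)).2
  have hcapped : ∀ {C : Finset (Finset (Fin n))}, C.image charWord = capped n k t 0 →
      C = starFamily n k (initialSegment n t) := by
    intro C hC
    ext F
    have h1 : F ∈ C ↔ charWord F ∈ C.image charWord := by
      rw [Finset.mem_image]
      refine ⟨fun h => ⟨F, h, rfl⟩, ?_⟩
      rintro ⟨G, hG, hGF⟩
      exact charWord_injective hGF ▸ hG
    rw [h1, hC, capped_zero_eq, Finset.mem_filter, charWord_mem_words, mem_starFamily,
      ups_charWord, ← inter_initialSegment]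
    refine and_congr_right fun _ => ?_
    have h2 := card_initialSegment (n := n) (m := t) (by omega)
    constructor
    · intro h3
      have h4 := Finset.eq_of_subset_of_card_le
        (Finset.inter_subset_right (s₁ := F) (s₂ := initialSegment n t)) (by omega)
      exact Finset.inter_eq_right.1 h4
    · intro h3
      rw [Finset.inter_eq_right.2 h3, h2]
  have key := mul_card_lt_or_eq_star ht htk hn (himage hA) (himage hB) (by
    intro a ha b hb
    obtain ⟨F, hF, rfl⟩ := Finset.mem_image.1 ha
    obtain ⟨G, hG, rfl⟩ := Finset.mem_image.1 hb
    exact hm F hF G hG)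
  rw [Finset.card_image_of_injective _ charWord_injective,
    Finset.card_image_of_injective _ charWord_injective] at key
  refine key.imp_right fun h => ⟨initialSegment n t, card_initialSegment (by omega), ?_, ?_⟩
  · exact hcapped h.1
  · exact hcapped h.2

/-- Induction on the weight: a shift that changes `A` decreases it, and stars are pulled back by
`exists_star_of_compression`. -/
theorem mul_card_lt_or_eq_starFamily {n k t : ℕ} {A B : Finset (Finset (Fin n))}
    (ht : 14 ≤ t) (htk : t ≤ k) (hn : (t + 1) * k ≤ n)
    (hA : A ⊆ Finset.powersetCard k Finset.univ) (hB : B ⊆ Finset.powersetCard k Finset.univ)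
    (hAB : CrossIntersecting t A B) :
    A.card * B.card < (n - t).choose (k - t) ^ 2 ∨
      ∃ T : Finset (Fin n), T.card = t ∧ A = starFamily n k T ∧ B = starFamily n k T := by
  have hkn : 15 * k ≤ n := le_trans (Nat.mul_le_mul_right _ (by omega)) hn
  induction hw : familyWeight A + familyWeight B using Nat.strong_induction_on
    generalizing A B with
  | _ w ih =>
    by_cases hsh : ∀ i j : Fin n, i < j → UV.compression {i} {j} A = A
    · exact mul_card_lt_or_eq_starFamily_of_shifted ht htk hn hA hB hAB hsh
    · push Not at hsh
      obtain ⟨i, j, hij, hne⟩ := hsh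
      have h1 := familyWeight_compression_lt hij hne
      have h2 := familyWeight_compression_le (A := B) hij
      have h3 := ih _ (by omega) (compression_subset_powersetCard hA)
        (compression_subset_powersetCard hB) (hAB.shift hij.ne) rfl
      rw [UV.card_compression, UV.card_compression] at h3
      refine h3.imp_right ?_
      rintro ⟨T, hT, hTA, hTB⟩
      exact exists_star_of_compression (by omega) (by omega) htk hA hB hAB hij.ne hT hTA hTB

theorem franklFamily_zero_eq {n k t : ℕ} (htn : t ≤ n) :
    franklFamily n k t 0 = starFamily n k (initialSegment n t) := by
  ext F
  have h1 := card_initialSegment htn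
  simp only [franklFamily, starFamily, Finset.mem_filter, mul_zero, add_zero]
  refine and_congr_right fun _ => ?_
  constructor
  · intro h2
    exact Finset.inter_eq_right.1 (Finset.eq_of_subset_of_card_le
      (Finset.inter_subset_right (s₁ := F) (s₂ := initialSegment n t)) (by omega))
  · intro h2
    rw [Finset.inter_eq_right.2 h2, h1]

theorem familyIsomorphic_starFamily {n k : ℕ} {T T' : Finset (Fin n)} (h : T.card = T'.card) :
    FamilyIsomorphic (starFamily n k T) (starFamily n k T') := by
  classical
  have e : {x // x ∈ T'} ≃ {x // x ∈ T} := Finset.equivOfCardEq h.symm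
  set f : Equiv.Perm (Fin n) := e.extendSubtype with hf
  have hfT : T'.image f = T := by
    refine Finset.eq_of_subset_of_card_le ?_ ?_
    · intro x hx
      obtain ⟨y, hy, rfl⟩ := Finset.mem_image.1 hx
      exact e.extendSubtype_mem y hy
    · rw [Finset.card_image_of_injective _ f.injective, h]
  refine ⟨f, ?_⟩
  ext F
  rw [Finset.mem_image]
  constructor
  · intro hF
    obtain ⟨h1, h2⟩ := mem_starFamily.1 hF
    refine ⟨F.image f.symm, mem_starFamily.2 ⟨?_, ?_⟩, ?_⟩
    · rw [Finset.card_image_of_injective _ f.symm.injective, h1]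
    · intro x hx
      exact Finset.mem_image.2 ⟨f x, h2 (hfT ▸ Finset.mem_image_of_mem f hx), by simp⟩
    · simp [Finset.image_image]
  · rintro ⟨G, hG, rfl⟩
    obtain ⟨h1, h2⟩ := mem_starFamily.1 hG
    refine mem_starFamily.2 ⟨?_, ?_⟩
    · rw [Finset.card_image_of_injective _ f.injective, h1]
    · rw [← hfT]
      exact Finset.image_subset_image h2

theorem FamilyIsomorphic.card_eq {n : ℕ} {A B : Finset (Finset (Fin n))}
    (h : FamilyIsomorphic A B) : A.card = B.card := by
  obtain ⟨f, rfl⟩ := h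
  exact Finset.card_image_of_injective _ (Finset.image_injective f.injective)

theorem theorem1 (n k t : ℕ) (ht : 14 ≤ t) (htk : t ≤ k) (hn : (t + 1) * k ≤ n)
    (A B : Finset (Finset (Fin n)))
    (hA : A ⊆ Finset.powersetCard k Finset.univ)
    (hB : B ⊆ Finset.powersetCard k Finset.univ)
    (hAB : CrossIntersecting t A B) :
    A.card * B.card ≤ (n - t).choose (k - t) ^ 2 ∧
      (A.card * B.card = (n - t).choose (k - t) ^ 2 ↔
        A = B ∧ FamilyIsomorphic B (franklFamily n k t 0)) := by
  have hkn : 15 * k ≤ n := le_trans (Nat.mul_le_mul_right _ (by omega)) hn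
  have htn : t ≤ n := by omega
  have hfc : (franklFamily n k t 0).card = (n - t).choose (k - t) := by
    have h := card_initialSegment htn
    rw [franklFamily_zero_eq htn, card_starFamily (by omega), h]
  have hiff : A = B ∧ FamilyIsomorphic B (franklFamily n k t 0) →
      A.card * B.card = (n - t).choose (k - t) ^ 2 := by
    rintro ⟨rfl, h⟩
    rw [h.card_eq, hfc, sq]
  rcases mul_card_lt_or_eq_starFamily ht htk hn hA hB hAB with h | ⟨T, hT, hTA, hTB⟩
  · exact ⟨h.le, fun h' => absurd h' h.ne, hiff⟩
  · have h : A = B ∧ FamilyIsomorphic B (franklFamily n k t 0) := by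
      refine ⟨hTA.trans hTB.symm, ?_⟩
      rw [hTB, franklFamily_zero_eq htn]
      exact familyIsomorphic_starFamily (by rw [hT, card_initialSegment htn])
    exact ⟨(hiff h).le, fun _ => h, hiff⟩
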